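/- **Conventions.** Fix $\eta\in\mathbb C$ with $\operatorname{Im}\eta>0$; put $q^x=e^{\pi i\eta x}$, $[x]=\frac{q^x-q^{-x}}{q-q^{-1}}$, $[x]_k=[x][x+1]\cdots[x+k-1]$, $[k]!=[1]\cdots[k]$. $\mathcal U_q(\mathfrak{sl}_2)$ has generators $E,F,q^{x\mathbf h}$ and coproduct $\Delta(E)=E\otimes1+q^{\mathbf h}\otimes E$, $\Delta(F)=F\otimes q^{-\mathbf h}+1\otimes F$, $\Delta(q^{x\mathbf h})=q^{x\mathbf h}\otimes q^{x\mathbf h}$. The Verma module $M_\Lambda$ has basis $v_\Lambda^{(m)}$, $m\ge0$, with $Ev^{(m)}=[\Lambda-m+1]v^{(m-1)}$, $Fv^{(m)}=[m+1]v^{(m+1)}$, $q^{x\mathbf h}v^{(m)}=q^{(\Lambda-2m)x}v^{(m)}$. Its contragredient dual $M_\Lambda^*$ has the dual basis $u_m^\Lambda$, with $Eu_m=[m]u_{m-1}$, $Fu_m=[\Lambda-m]u_{m+1}$, $q^{x\mathbf h}u_m=q^{(\Lambda-2m)x}u_m$. Let $n\ge1$, $\mathbf m\ge0$ be integers, $\vec\Lambda\in\mathbb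 C^n$ with $\sum\Lambda_i=2\mathbf m$, and $M_{\vec\Lambda}=M_{\Lambda_1}\otimes\dots\otimes M_{\Lambda_n}$. The zero weight spaces $M_{\vec\Lambda}[0]$, $M^*_{\vec\Lambda}[0]$ have bases $v^{(\vec m)}$, $u_{\vec m}$ indexed by $\vec m\in\mathbb Z_{\ge0}^n$ with $\sum m_i=\mathbf m$. **Trace matrix.** Let $\Phi_m^\Lambda(\lambda):M_{\lambda-1}\to M_{\lambda-\Lambda+2m-1}\otimes M_\Lambda^*$ be the intertwining operator with $$\Phi_m^\Lambda(\lambda)v_{\lambda-1}^{(0)}=\sum_{i=0}^m q^{i(\lambda-\Lambda+2m-i)}[-\lambda+\Lambda-2m+i+1]_{m-i}\;v^{(i)}_{\lambda-\Lambda+2m-1}\otimes E^iu_m^\Lambda,$$ and let $$\Phi_{\vec m}^{\vec\Lambda}(\lambda)=\bigl(\Phi_{m_1}^{\Lambda_1}(\lambda-\textstyle\sum_{i\ge2}(\Lambda_i-2m_i))\otimes1\bigr)\cdots\bigl(\Phi_{m_{n-1}}^{\Lambda_{n-1}}(\lambda-\Lambda_n+2m_n)\otimes1\bigr)\Phi_{m_n}^{\Lambda_n}(\lambda).$$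 The function $$\mathcal F_{\vec m}(\lambda,x;\vec\Lambda)=q^{-\mathbf m(\mathbf m+1)/2}(q-q^{-1})^{\mathbf m}(q^x-q^{-x})\operatorname{Tr}\big|_{M_{\lambda-1}}\bigl(\Phi_{\vec m}^{\vec\Lambda}(\lambda)q^{x\mathbf h}\bigr)=\sum_{\vec m'}\mathcal F_{\vec m}^{\vec m'}(\lambda,x;\vec\Lambda)\,u_{\vec m'}$$ is given by a series which converges for $|q^{2x}|\gg1$, and is continued meromorphically to $x\in\mathbb C$. The universal trace matrix is the operator $\mathcal F(\lambda,x;\vec\Lambda):v^{(\vec m')}\mapsto\sum_{\vec m}\mathcal F_{\vec m}^{\vec m'}(\lambda,x;\vec\Lambda)v^{(\vec m)}$. **R-matrices.** The quantum R-matrix $\mathcal R_{\Lambda_1,\Lambda_2}\in\operatorname{End}(M_{\Lambda_1}\otimes M_{\Lambda_2})$ is the action of $q^{-\Lambda_1\Lambda_2/2}\bigl(\sum_{k\ge0}q^{k(k-1)/2}\frac{(q-q^{-1})^k}{[k]!}E^k\otimes F^k\bigr)q^{\mathbf h\otimes\mathbf h/2}$. The dynamical R-matrix $\mathbb R_{\Lambda_1,\Lambda_2}(\lambda)$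 is given by $\mathbb R_{\Lambda_1,\Lambda_2}(\lambda)(v^{(m_1)}\otimes v^{(m_2)})=\sum_{n_1,n_2}\mathbb R^{m_1,m_2}_{n_1,n_2}\,v^{(n_1)}\otimes v^{(n_2)}$, where $\mathbb R^{m_1,m_2}_{n_1,n_2}=0$ unless $m_1+m_2=n_1+n_2=:N$, and then, with $\mu=\lambda-\Lambda_2+2n_2$, $\nu=\lambda-\Lambda_1-\Lambda_2+2N$, $$\mathbb R^{m_1,m_2}_{n_1,n_2}=\sum_{p=\max(m_1,n_1)}^{N}(-1)^{m_1}\frac{[1-\nu]_{n_1}}{[1-\nu]_{m_2}}\cdot\frac{q^{-(p-n_1)(\mu-p+n_1)}[-\mu+p-n_1+1]_{N-p}}{[p-n_1]!}\cdot\frac{[n_2]!}{[N-p]!}\prod_{s=n_1}^{p-1}[\Lambda_1-s]$$ $$\times\; q^{-p\Lambda_2-(N-p)\Lambda_1+2p(N-p)}\cdot\frac{[p]!}{[m_1]!}\prod_{s=m_1+1}^{p}[\Lambda_2-N+s]\cdot\frac{q^{(p-m_1)(\lambda-\Lambda_1+p+m_1)}[\lambda-\Lambda_1+2m_1]}{[p-m_1]!\,[\lambda-\Lambda_1+m_1]_{p+1}}.$$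 Put $\check{\mathcal R}_{\Lambda,\Lambda'}=\mathcal R_{\Lambda',\Lambda}P$ and $\check{\mathbb R}_{\Lambda,\Lambda'}(\lambda)=\mathbb R_{\Lambda',\Lambda}(\lambda)P$, where $P(x\otimes y)=y\otimes x$. In $\lambda-\mathbf h^{(i,\dots,k)}$ the symbol $\mathbf h^{(i,\dots,k)}$ is replaced by the total weight in the tensor factors labelled $i,\dots,k$. **The operators.** With $P_\circlearrowleft(x_1\otimes\dots\otimes x_n)=x_2\otimes\dots\otimes x_n\otimes x_1$, let $(q^{-x\mathbf h})_\circlearrowleft=P_\circlearrowleft(q^{-x\mathbf h})_1$ (the subscript $1$ meaning the action in the first factor) and $\Gamma_\circlearrowleft=P_\circlearrowleft\Gamma_1$, where $(\Gamma_1\psi)(\lambda)=\psi(\lambda-\mathbf h^{(1)})$. On $M_{\vec\Lambda}[0]$, and on $M_{\vec\Lambda}[0]$-valued functions $\psi$ of $\lambda$, respectively, define for $j=1,\dots,n$ $$\mathcal K_j(x)=(\check{\mathcal R}_{\Lambda_j,\Lambda_{j+1}})^{-1}\cdots(\check{\mathcal R}_{\Lambda_j,\Lambda_n})^{-1}(q^{-x\mathbf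 h})_\circlearrowleft\check{\mathcal R}_{\Lambda_1,\Lambda_j}\cdots\check{\mathcal R}_{\Lambda_{j-1},\Lambda_j},$$ $$\mathbb K_j\psi(\lambda)=\bigl(\check{\mathbb R}_{\Lambda_j,\Lambda_{j+1}}(\lambda-\mathbf h^{(j+2,\dots,n)})\bigr)^{-1}\cdots\bigl(\check{\mathbb R}_{\Lambda_j,\Lambda_n}(\lambda)\bigr)^{-1}\Gamma_\circlearrowleft\check{\mathbb R}_{\Lambda_1,\Lambda_j}(\lambda-\mathbf h^{(2,\dots,j-1)}-\mathbf h^{(j+1,\dots,n)})\cdots\check{\mathbb R}_{\Lambda_{j-1},\Lambda_j}(\lambda-\mathbf h^{(j+1,\dots,n)})\psi(\lambda).$$ **Theorem 6.1.** (a) $\mathbb R$ has the properties that single out the dynamical R-matrix, as identities of meromorphic functions of $\lambda$: it preserves weights; each matrix element is a rational function of $q^{\Lambda_1},q^{\Lambda_2},q^{2\lambda}$ (with a denominator not vanishing identically in $\lambda$ for any $\Lambda_1,\Lambda_2$); with $\gamma_{\Lambda',\Lambda''}v_{\Lambda'+\Lambda''}^{(m)}=\sum_{m'+m''=m}v_{\Lambda'}^{(m')}\otimes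 v_{\Lambda''}^{(m'')}$ it satisfies $$\gamma_{\Lambda_1,\Lambda_2}\mathbb R_{\Lambda_1+\Lambda_2,\Lambda_3}(\lambda)=\mathbb R_{\Lambda_2,\Lambda_3}(\lambda)\mathbb R_{\Lambda_1,\Lambda_3}(\lambda-\mathbf h^{(2)})\gamma_{\Lambda_1,\Lambda_2},\qquad \gamma_{\Lambda_2,\Lambda_3}\mathbb R_{\Lambda_1,\Lambda_2+\Lambda_3}(\lambda)=\mathbb R_{\Lambda_1,\Lambda_2}(\lambda-\mathbf h^{(3)})\mathbb R_{\Lambda_1,\Lambda_3}(\lambda)\gamma_{\Lambda_2,\Lambda_3};$$ $\mathbb R_{n_1,n_2}^{m_1,m_2}=0$ if $\Lambda_i\in\{n_i,\dots,m_i-1\}$ for $i=1$ or $i=2$; and for $\Lambda_1=\Lambda_2=1$, in the basis $v^{(0)}\otimes v^{(0)},v^{(0)}\otimes v^{(1)},v^{(1)}\otimes v^{(0)},v^{(1)}\otimes v^{(1)}$, its matrix elements are those of $$\begin{pmatrix}1&0&0&0\\0&\frac{q^{-1}[\lambda+1]}{[\lambda]}&-\frac{q^{-\lambda-1}}{[\lambda]}&0\\0&\frac{q^{\lambda-1}}{[\lambda]}&\frac{q^{-1}[\lambda-1]}{[\lambda]}&0\\0&0&0&1\end{pmatrix}.$$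 (b) The objects above are well defined for all $n,\mathbf m,\vec\Lambda$ as above: the traces converge for $|q^{2x}|\gg1$ to meromorphic functions of $x$, which are holomorphic at every $x$ with $[x+k]\ne0$ for $k=1,\dots,\mathbf m$; the operators $\check{\mathcal R}$ are invertible on the zero weight space, and the operators $\check{\mathbb R}(\lambda-\cdots)$ are invertible there for all $\lambda$ outside a closed discrete set. (c) For every $\vec\Lambda\in\mathbb C^n$ with $\sum\Lambda_i=2\mathbf m$, all $\lambda$ outside a closed discrete set (depending only on $\eta$, $\vec\Lambda$), all $x\in\mathbb C$ with $[x+k]\neq0$ for $k=1,\dots,\mathbf m$, and all $j=1,\dots,n$, one has on $M_{\vec\Lambda}[0]$ $$\mathbb K_j\,\mathcal F(\lambda,x;\vec\Lambda)=\mathcal F(\lambda,x;\vec\Lambda)\,\mathcal K_j(x).$$ -/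

import Mathlib

open Filter Complex

namespace QKZB

noncomputable section

/-! Throughout, `η` is a complex number with positive imaginary part and `q ^ x = exp (π i η x)`. -/

/-- The `q`-power `q ^ x = exp (π i η x)`. -/
def qpow (η x : ℂ) : ℂ := Complex.exp (Real.pi * Complex.I * η * x)

/-- The `q`-number `[x] = (q ^ x - q ^ (-x)) / (q - q⁻¹)`. -/
def qnum (η x : ℂ) : ℂ := (qpow η x - qpow η (-x)) / (qpow η 1 - qpow η (-1))

/-- `[x]_k = [x] [x+1] ⋯ [x+k-1]`. -/
def qpoch (η x : ℂ) (k : ℕ) : ℂ := ∏ s ∈ Finset.range k, qnum η (x + s)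

/-- `[k]! = [1] [2] ⋯ [k]`. -/
def qfact (η : ℂ) (k : ℕ) : ℂ := ∏ s ∈ Finset.range k, qnum η (s + 1)

/-! ### Verma modules and contragredient Verma modules

All Verma modules `M_Λ` (basis `v^{(m)}`) and their restricted duals `M_Λ^*` (dual basis `u_m`) have
the underlying space `V = ℕ →₀ ℂ`; the tensor product of two of them has the underlying space
`ℕ × ℕ →₀ ℂ`, and so on, in terms of the monomial bases. -/

/-- The space with basis indexed by `ℕ`. -/
abbrev V : Type := ℕ →₀ ℂ

/-- `E` on `M_Λ`: `E v^{(0)} = 0`, `E v^{(m+1)} = [Λ - m] v^{(m)}`. -/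
def vermaE (η L : ℂ) : V →ₗ[ℂ] V :=
  Finsupp.linearCombination ℂ fun m : ℕ =>
    match m with
    | 0 => (0 : V)
    | k + 1 => Finsupp.single k (qnum η (L - k))

/-- `F` on `M_Λ`: `F v^{(m)} = [m + 1] v^{(m+1)}`. -/
def vermaF (η : ℂ) : V →ₗ[ℂ] V :=
  Finsupp.linearCombination ℂ fun m : ℕ => Finsupp.single (m + 1) (qnum η (m + 1))

/-- `E` on `M_Λ^*`: `E u_0 = 0`, `E u_{m+1} = [m + 1] u_m`. -/
def dualE (η : ℂ) : V →ₗ[ℂ] V :=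
  Finsupp.linearCombination ℂ fun m : ℕ =>
    match m with
    | 0 => (0 : V)
    | k + 1 => Finsupp.single k (qnum η (k + 1))

/-- `Δ(F) = F ⊗ q^{-h} + 1 ⊗ F` on `M_μ ⊗ M_Λ^*` (it does not depend on `μ`), where
`F v^{(a)} = [a+1] v^{(a+1)}`, `q^{-h} u_b = q^{-(Λ-2b)} u_b`, `F u_b = [Λ-b] u_{b+1}`. -/
def deltaF (η L : ℂ) : (ℕ × ℕ →₀ ℂ) →ₗ[ℂ] (ℕ × ℕ →₀ ℂ) :=
  Finsupp.linearCombination ℂ fun ab : ℕ × ℕ =>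
    Finsupp.single (ab.1 + 1, ab.2) (qnum η (ab.1 + 1) * qpow η (-(L - 2 * ab.2))) +
      Finsupp.single (ab.1, ab.2 + 1) (qnum η (L - ab.2))

/-! ### Holomorphic intertwining operators -/

/-- The image of the highest weight vector of `M_{λ-1}` under `Φ_m^Λ(λ)`:
`∑_{i ≤ m} q^{i(λ-Λ+2m-i)} [-λ+Λ-2m+i+1]_{m-i} v^{(i)} ⊗ E^i u_m` in `M_{λ-Λ+2m-1} ⊗ M_Λ^*`. -/
def singularVec (η L : ℂ) (m : ℕ) (lam : ℂ) : ℕ × ℕ →₀ ℂ :=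
  ∑ i ∈ Finset.range (m + 1),
    (qpow η (i * (lam - L + 2 * m - i)) * qpoch η (-lam + L - 2 * m + i + 1) (m - i)) •
      Finsupp.mapDomain (fun b : ℕ => (i, b)) (((dualE η) ^ i) (Finsupp.single m 1))

/-- The holomorphic intertwining operator `Φ_m^Λ(λ) : M_{λ-1} → M_{λ-Λ+2m-1} ⊗ M_Λ^*`. As an
intertwining operator on the Verma module it is determined by the image of the highest weight
vector, since `v^{(k)} = F^k v^{(0)} / [k]!`. -/
def Phi1 (η L : ℂ) (m : ℕ) (lam : ℂ) : V →ₗ[ℂ] (ℕ × ℕ →₀ ℂ) :=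
  Finsupp.linearCombination ℂ fun k : ℕ =>
    (qfact η k)⁻¹ • ((deltaF η L) ^ k) (singularVec η L m lam)

/-- The composition
`Φ_{m⃗}^{Λ⃗}(λ) = (Φ_{m_1}^{Λ_1}(λ-∑_{i≥2}(Λ_i-2m_i)) ⊗ 1) ⋯ (Φ_{m_{n-1}}^{Λ_{n-1}}(λ-Λ_n+2m_n) ⊗ 1) Φ_{m_n}^{Λ_n}(λ)`,
a map from `M_{λ-1}` to `M_{λ-1-∑(Λ_i-2m_i)} ⊗ M_{Λ_1}^* ⊗ ⋯ ⊗ M_{Λ_n}^*`. The basis element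
`(k, (a_1, …, a_n))` of the target stands for `v^{(k)} ⊗ u_{a_1} ⊗ ⋯ ⊗ u_{a_n}`. -/
def Phi (η : ℂ) : (n : ℕ) → (Fin n → ℂ) → (Fin n → ℕ) → ℂ → V →ₗ[ℂ] (ℕ × (Fin n → ℕ) →₀ ℂ)
  | 0, _, _, _ => Finsupp.lmapDomain ℂ ℂ fun k : ℕ => (k, Fin.elim0)
  | n + 1, L, m, lam =>
    (Finsupp.linearCombination ℂ fun ka : ℕ × ℕ =>
      Finsupp.mapDomain
        (fun lb : ℕ × (Fin n → ℕ) => (lb.1, (Fin.snoc lb.2 ka.2 : Fin (n + 1) → ℕ)))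
        (Phi η n (Fin.init L) (Fin.init m) (lam - L (Fin.last n) + 2 * m (Fin.last n))
          (Finsupp.single ka.1 1))) ∘ₗ
      Phi1 η (L (Fin.last n)) (m (Fin.last n)) lam

/-! ### The universal trace matrix -/

/-- The multi-indices `(m_1, …, m_n)` with `m_1 + ⋯ + m_n = N`. When `Λ_1 + ⋯ + Λ_n = 2 N` they index
the monomial bases of the zero weight spaces `M_Λ⃗[0]` and `M_Λ⃗^*[0]`; we identify
`M_Λ⃗[0]` with `Level n N → ℂ`. -/
abbrev Level (n N : ℕ) : Type := {m : Fin n → ℕ // m ∈ Finset.Nat.antidiagonalTuple n N}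

/-- The contribution of the basis vector `v^{(k)}` of `M_{λ-1}` to the coefficient at `u_{m⃗'}` of
`q^{-N(N+1)/2} (q - q⁻¹)^N (q^x - q^{-x}) Tr|_{M_{λ-1}} (Φ_{m⃗}^{Λ⃗}(λ) q^{xh})`. -/
def traceTerm (η : ℂ) {n N : ℕ} (L : Fin n → ℂ) (lam : ℂ) (m m' : Level n N) (k : ℕ) (x : ℂ) : ℂ :=
  qpow η (-(N * (N + 1) / 2)) * (qpow η 1 - qpow η (-1)) ^ N * (qpow η x - qpow η (-x)) *
    (Phi η n L m.1 lam (Finsupp.single k 1) (k, m'.1) * qpow η ((lam - 1 - 2 * k) * x))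

/-- `G` is the meromorphic function of `x` defined by the trace: the trace converges to `G x` when
`|q^{2x}|` is large enough, and `G` is meromorphic on `ℂ` (with removable singularities removed). -/
def IsTraceFunction (η : ℂ) {n N : ℕ} (L : Fin n → ℂ) (lam : ℂ) (m m' : Level n N)
    (G : ℂ → ℂ) : Prop :=
  MeromorphicNFOn G Set.univ ∧
    ∃ C : ℝ, ∀ x : ℂ, C < ‖qpow η (2 * x)‖ →
      HasSum (fun k : ℕ => traceTerm η L lam m m' k x) (G x)

/-- The matrix element `F_{m⃗}^{m⃗'}(λ, x; Λ⃗)` as a function of `x`: the meromorphic continuation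
of the trace. -/
def traceFun (η : ℂ) {n N : ℕ} (L : Fin n → ℂ) (lam : ℂ) (m m' : Level n N) : ℂ → ℂ :=
  Classical.epsilon fun G : ℂ → ℂ => IsTraceFunction η L lam m m' G

/-- The universal trace matrix `F(λ, x; Λ⃗)`, with rows indexed by `m⃗` and columns by `m⃗'`. -/
def traceMatrix (η : ℂ) {n N : ℕ} (L : Fin n → ℂ) (lam x : ℂ) :
    Matrix (Level n N) (Level n N) ℂ :=
  fun m m' => traceFun η L lam m m' x

/-! ### R-matrices

A family of operators on `M_{Λ₁} ⊗ M_{Λ₂}` depending on a parameter `λ` is given by its matrix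
elements: `R Λ₁ Λ₂ λ m₁ m₂ n₁ n₂` is the coefficient of `v^{(n₁)} ⊗ v^{(n₂)}` in the image of
`v^{(m₁)} ⊗ v^{(m₂)}`. -/

/-- Families of matrix elements `R Λ₁ Λ₂ λ m₁ m₂ n₁ n₂`. -/
abbrev RFamily : Type := ℂ → ℂ → ℂ → ℕ → ℕ → ℕ → ℕ → ℂ

/-- The quantum R-matrix: the action of
`q^{-Λ₁Λ₂/2} (∑_k q^{k(k-1)/2} (q - q⁻¹)^k / [k]! E^k ⊗ F^k) q^{h⊗h/2}` on `M_{Λ₁} ⊗ M_{Λ₂}`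
(`E^k v^{(m₁)} = 0` for `k > m₁`). It does not depend on the third argument. -/
def quantumR (η : ℂ) : RFamily := fun L₁ L₂ _ m₁ m₂ n₁ n₂ =>
  qpow η (-(L₁ * L₂ / 2)) *
    (∑ k ∈ Finset.range (m₁ + 1),
      qpow η (k * (k - 1) / 2) * (qpow η 1 - qpow η (-1)) ^ k / qfact η k *
        (((vermaE η L₁) ^ k) (Finsupp.single m₁ 1) n₁ *
          ((vermaF η) ^ k) (Finsupp.single m₂ 1) n₂)) *
    qpow η ((L₁ - 2 * m₁) * (L₂ - 2 * m₂) / 2)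

/-- The dynamical R-matrix `R_{Λ₁,Λ₂}(λ)`, in closed form: it is a product of an upper and a lower
triangular matrix in each weight space, and `p` is the index of summation in this product. -/
def dynamicalR (η : ℂ) : RFamily := fun L₁ L₂ lam m₁ m₂ n₁ n₂ =>
  if m₁ + m₂ = n₁ + n₂ then
    ∑ p ∈ Finset.Icc (max m₁ n₁) (m₁ + m₂),
      (-1) ^ m₁ *
      (qpoch η (-(lam - L₁ - L₂ + 2 * (m₁ + m₂ : ℕ)) + 1) n₁ /
        qpoch η (-(lam - L₁ - L₂ + 2 * (m₁ + m₂ : ℕ)) + 1) m₂) *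
      (qpow η (-((p - n₁ : ℕ) * (lam - L₂ + 2 * n₂ - (p - n₁ : ℕ)))) *
        qpoch η (-(lam - L₂ + 2 * n₂) + (p - n₁ : ℕ) + 1) (m₁ + m₂ - p) / qfact η (p - n₁)) *
      (qfact η n₂ / qfact η (m₁ + m₂ - p) * ∏ s ∈ Finset.Ico n₁ p, qnum η (L₁ - s)) *
      qpow η (-(p * L₂) - (m₁ + m₂ - p : ℕ) * L₁ + 2 * p * (m₁ + m₂ - p : ℕ)) *
      (qfact η p / qfact η m₁ * ∏ s ∈ Finset.Ioc m₁ p, qnum η (L₂ - (m₁ + m₂ : ℕ) + s)) *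
      (qpow η ((p - m₁ : ℕ) * (lam - L₁ + p + m₁)) * qnum η (lam - L₁ + 2 * m₁) /
        (qfact η (p - m₁) * qpoch η (lam - L₁ + m₁) (p + 1)))
  else 0

/-- The properties which single out the dynamical R-matrix: it preserves weights, its matrix
elements are rational functions of `q^{Λ₁}, q^{Λ₂}, q^{2λ}` (with a denominator that does not vanish
identically in `λ` for any `Λ₁, Λ₂`), it is compatible with fusion, it vanishes from non-admissible
to admissible indices, and for `Λ₁ = Λ₂ = 1` its admissible part is the fundamental dynamical
R-matrix. Identities between meromorphic functions of `λ` are required outside of a closed discrete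
set of `λ`. -/
structure IsDynamicalRMatrix (η : ℂ) (R : RFamily) : Prop where
  weight : ∀ (L₁ L₂ lam : ℂ) (m₁ m₂ n₁ n₂ : ℕ), m₁ + m₂ ≠ n₁ + n₂ → R L₁ L₂ lam m₁ m₂ n₁ n₂ = 0
  rational : ∀ m₁ m₂ n₁ n₂ : ℕ, ∃ P Q : MvPolynomial (Fin 3) ℂ, ∀ L₁ L₂ : ℂ,
    ∀ᶠ lam in codiscrete ℂ,
      MvPolynomial.eval ![qpow η L₁, qpow η L₂, qpow η (2 * lam)] Q ≠ 0 ∧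
      R L₁ L₂ lam m₁ m₂ n₁ n₂ =
        MvPolynomial.eval ![qpow η L₁, qpow η L₂, qpow η (2 * lam)] P /
          MvPolynomial.eval ![qpow η L₁, qpow η L₂, qpow η (2 * lam)] Q
  /-- `γ_{Λ₁,Λ₂} R_{Λ₁+Λ₂,Λ₃}(λ) = R_{Λ₂,Λ₃}(λ) R_{Λ₁,Λ₃}(λ - h^{(2)}) γ_{Λ₁,Λ₂}`, where
  `γ v^{(m)} = ∑_{m'+m''=m} v^{(m')} ⊗ v^{(m'')}`. -/
  fusion_left : ∀ (L₁ L₂ L₃ : ℂ) (m m₃ a b c : ℕ), ∀ᶠ lam in codiscrete ℂ,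
    R (L₁ + L₂) L₃ lam m m₃ (a + b) c =
      ∑ mm ∈ Finset.HasAntidiagonal.antidiagonal m, ∑ c' ∈ Finset.range (mm.1 + m₃ + 1),
        R L₂ L₃ lam mm.2 c' b c * R L₁ L₃ (lam - (L₂ - 2 * mm.2)) mm.1 m₃ a c'
  /-- `γ_{Λ₂,Λ₃} R_{Λ₁,Λ₂+Λ₃}(λ) = R_{Λ₁,Λ₂}(λ - h^{(3)}) R_{Λ₁,Λ₃}(λ) γ_{Λ₂,Λ₃}`. -/
  fusion_right : ∀ (L₁ L₂ L₃ : ℂ) (m₁ m a b c : ℕ), ∀ᶠ lam in codiscrete ℂ,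
    R L₁ (L₂ + L₃) lam m₁ m a (b + c) =
      ∑ mm ∈ Finset.HasAntidiagonal.antidiagonal m, ∑ a' ∈ Finset.range (m₁ + mm.2 + 1),
        R L₁ L₂ (lam - (L₃ - 2 * c)) a' mm.1 a b * R L₁ L₃ lam m₁ mm.2 a' c
  vanish_left : ∀ (L : ℕ) (L₂ : ℂ) (m₁ m₂ n₁ n₂ : ℕ), n₁ ≤ L → L < m₁ →
    ∀ᶠ lam in codiscrete ℂ, R L L₂ lam m₁ m₂ n₁ n₂ = 0
  vanish_right : ∀ (L₁ : ℂ) (L : ℕ) (m₁ m₂ n₁ n₂ : ℕ), n₂ ≤ L → L < m₂ →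
    ∀ᶠ lam in codiscrete ℂ, R L₁ L lam m₁ m₂ n₁ n₂ = 0
  fundamental : ∀ᶠ lam in codiscrete ℂ,
    R 1 1 lam 0 0 0 0 = 1 ∧ R 1 1 lam 1 1 1 1 = 1 ∧
    R 1 1 lam 0 1 0 1 = qpow η (-1) * qnum η (lam + 1) / qnum η lam ∧
    R 1 1 lam 1 0 0 1 = -(qpow η (-lam - 1) / qnum η lam) ∧
    R 1 1 lam 0 1 1 0 = qpow η (lam - 1) / qnum η lam ∧
    R 1 1 lam 1 0 1 0 = qpow η (-1) * qnum η (lam - 1) / qnum η lam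

/-! ### The qKZ and qKZB operators

Positions of tensor factors are numbered from `0`. An arrangement `L : Fin n → ℂ` lists the highest
weights of the factors in their current order. -/

/-- The arrangement after the interchange of the factors at positions `p` and `p + 1`. -/
def swapAt {n : ℕ} (L : Fin n → ℂ) (p : ℕ) : Fin n → ℂ :=
  if h : p + 1 < n then L ∘ Equiv.swap (⟨p, by omega⟩ : Fin n) ⟨p + 1, h⟩ else L

/-- The operator `Ř_{L_p, L_{p+1}}(λ - h^{(p+2, …)}) = R_{L_{p+1}, L_p}(λ - h^{(p+2, …)}) P` in the
positions `p, p + 1` of the arrangement `L`, on the zero weight space. Here `h^{(p+2, …)}` is the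
total weight of the factors to the right of these positions. -/
def braid (R : RFamily) {n N : ℕ} (L : Fin n → ℂ) (p : ℕ) (lam : ℂ) :
    Matrix (Level n N) (Level n N) ℂ :=
  if h : p + 1 < n then fun b a =>
    if ∀ r : Fin n, (r : ℕ) ≠ p → (r : ℕ) ≠ p + 1 → b.1 r = a.1 r then
      R (L ⟨p + 1, h⟩) (L ⟨p, by omega⟩)
        (lam - ∑ r : Fin n, if p + 1 < (r : ℕ) then L r - 2 * a.1 r else 0)
        (a.1 ⟨p + 1, h⟩) (a.1 ⟨p, by omega⟩) (b.1 ⟨p, by omega⟩) (b.1 ⟨p + 1, h⟩)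
    else 0
  else 1

/-- The product `Ř_{L_0,L_p} ⋯ Ř_{L_{p-1},L_p}` which moves the factor at position `p` to the
front. -/
def toFront (R : RFamily) {n N : ℕ} :
    (p : ℕ) → (Fin n → ℂ) → ℂ → Matrix (Level n N) (Level n N) ℂ
  | 0, _, _ => 1
  | p + 1, L, lam => toFront R p (swapAt L p) lam * braid R L p lam

/-- For `d = n - 1 - p`, the product `Ř_{L_p,L_{p+1}}⁻¹ ⋯ Ř_{L_p,L_{n-1}}⁻¹` which moves the factor with
highest weight `L_p` from the last position back to position `p`. -/
def fromBack (R : RFamily) {n N : ℕ} :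
    (d : ℕ) → (p : ℕ) → (Fin n → ℂ) → ℂ → Matrix (Level n N) (Level n N) ℂ
  | 0, _, _, _ => 1
  | d + 1, p, L, lam => (braid R L p lam)⁻¹ * fromBack R d (p + 1) (swapAt L p) lam

/-- `(q^{-xh})_↻ = P_↻ (q^{-xh})_1` on the zero weight space, where the first tensor factor has highest
weight `Λ` and `P_↻ (v^{(a_1)} ⊗ ⋯ ⊗ v^{(a_n)}) = v^{(a_2)} ⊗ ⋯ ⊗ v^{(a_n)} ⊗ v^{(a_1)}`. -/
def cyclicQ (η : ℂ) {n N : ℕ} [NeZero n] (Λ x : ℂ) : Matrix (Level n N) (Level n N) ℂ :=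
  fun b a => if b.1 = a.1 ∘ finRotate n then qpow η (-((Λ - 2 * a.1 0) * x)) else 0

/-- `Γ_↻ = P_↻ Γ_1` on `M_Λ⃗[0]`-valued functions of `λ`, where the first tensor factor has highest
weight `Λ` and `Γ_1` replaces the coordinate `ξ(λ)` at `v^{(a_1)} ⊗ ⋯ ⊗ v^{(a_n)}` by
`ξ(λ - Λ + 2 a_1)`. -/
def cyclicShift {n N : ℕ} [NeZero n] (Λ : ℂ) (ψ : ℂ → Level n N → ℂ) : ℂ → Level n N → ℂ :=
  fun lam b => ∑ a : Level n N, if b.1 = a.1 ∘ finRotate n then ψ (lam - Λ + 2 * a.1 0) a else 0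

/-- The qKZ operator
`Ř_{Λ_j,Λ_{j+1}}⁻¹ ⋯ Ř_{Λ_j,Λ_n}⁻¹ (q^{-xh})_↻ Ř_{Λ_1,Λ_j} ⋯ Ř_{Λ_{j-1},Λ_j}` on `M_Λ⃗[0]`. -/
def qKZ (η : ℂ) {n N : ℕ} [NeZero n] (L : Fin n → ℂ) (j : Fin n) (x : ℂ) :
    Matrix (Level n N) (Level n N) ℂ :=
  fromBack (quantumR η) (n - 1 - j) j L 0 * cyclicQ η (L j) x * toFront (quantumR η) j L 0

/-- The qKZB operator
`Ř_{Λ_j,Λ_{j+1}}(λ-h^{(j+2,…,n)})⁻¹ ⋯ Ř_{Λ_j,Λ_n}(λ)⁻¹ Γ_↻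
  Ř_{Λ_1,Λ_j}(λ-h^{(2,…,j-1)}-h^{(j+1,…,n)}) ⋯ Ř_{Λ_{j-1},Λ_j}(λ-h^{(j+1,…,n)})`
on `M_Λ⃗[0]`-valued functions of `λ`, with the dynamical R-matrix. -/
def qKZB (η : ℂ) {n N : ℕ} [NeZero n] (L : Fin n → ℂ) (j : Fin n) (ψ : ℂ → Level n N → ℂ) :
    ℂ → Level n N → ℂ :=
  fun lam =>
    (fromBack (dynamicalR η) (n - 1 - j) j L lam).mulVec
      (cyclicShift (L j) (fun mu => (toFront (dynamicalR η) j L mu).mulVec (ψ mu)) lam)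

end

end QKZB

namespace QKZB

noncomputable section

/-! ### `q`-numbers -/

/-! The trace matrix collects traces of compositions of intertwining operators, and two moves act on
such a composition. Exchanging two neighbouring operators produces a dynamical R-matrix on the
indices that label the operators and a quantum R-matrix on the values in the dual modules
(`exchange`, `braid_mul_traceMatrix`). Carrying the outermost operator around the trace produces a
shift of λ on one side and a factor q^{-xh} on the other (`cyclicShift_traceMatrix`). The qKZ and
qKZB operators are the same word in these moves: bring the j-th factor to the front, rotate it to
the end, and bring it back to its place. Composing the moves gives (c).

Everything is expressed by matrix elements. `polyCoef` is an explicit formula for one operator, and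
being an intertwining operator becomes a pair of recursions, one for F and one for E (`SingleRel`,
`PairRel`). For a generic target Verma module, a solution of the recursions is determined by the
v^{(0)}-component of the image of the highest weight vector. Identities between operators thus
reduce to finite identities between leading coefficients. For products of two operators the leading
coefficients form a triangular matrix. Up to scalars, `lowerTerm` is its inverse
(`very_well_poised_sum`), and `upperTerm` is the leading matrix of the product in the opposite order
followed by the quantum R-matrix (`sum_shifted_qpoch`). The closed form of `dynamicalR` is the
product of the two, which is exactly what the exchange relation requires.

In (a), the fusion identities follow because intertwining operators fuse under a homomorphism
M_{Λ₁}^* ⊗ M_{Λ₂}^* → M_{Λ₁+Λ₂}^* (`fusion`), the quantum R-matrix is compatible with this map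
(`hexagon_left`, `hexagon_right`), both by the q-Vandermonde identity, and products of two operators
are linearly independent for generic λ. The remaining properties are read off the closed form.

In (b), the condition ∑ Λ_i = 2N cancels the exponential factor in k, so a diagonal matrix element
is a polynomial of degree at most N in q^{-2k}. The trace is then a finite combination of geometric
series with poles only where [x+k] = 0 for some k = 1, …, N. The quantum R-matrix is triangular with
invertible diagonal, and the exchange relation transfers invertibility to the dynamical one.
Identities between traces are proved term by term where the series converge, and continued over the
complement of the countable set of possible poles, which is connected. -/

theorem qpow_add (η x y : ℂ) : qpow η (x + y) = qpow η x * qpow η y := by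
  simp only [qpow, mul_add, Complex.exp_add]

theorem qpow_zero (η : ℂ) : qpow η 0 = 1 := by simp [qpow]

theorem qpow_neg (η x : ℂ) : qpow η (-x) = (qpow η x)⁻¹ := by
  simp only [qpow, mul_neg, Complex.exp_neg]

theorem qpow_sub (η x y : ℂ) : qpow η (x - y) = qpow η x / qpow η y := by
  rw [sub_eq_add_neg, qpow_add, qpow_neg, div_eq_mul_inv]

theorem qpow_ne_zero (η x : ℂ) : qpow η x ≠ 0 := Complex.exp_ne_zero _

theorem qpow_natCast_mul (η x : ℂ) (k : ℕ) : qpow η (k * x) = qpow η x ^ k := by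
  rw [qpow, qpow, ← Complex.exp_nat_mul]; ring_nf

theorem qpow_two_mul (η x : ℂ) : qpow η (2 * x) = qpow η x ^ 2 := by
  exact_mod_cast qpow_natCast_mul η x 2

theorem norm_qpow_natCast_lt_one {η : ℂ} (hη : 0 < η.im) {k : ℕ} (hk : k ≠ 0) :
    ‖qpow η k‖ < 1 := by
  rw [qpow, Complex.norm_exp, Real.exp_lt_one_iff]
  have h : (Real.pi * I * η * (k : ℂ)).re = -(Real.pi * η.im * k) := by
    simp
  rw [h]
  have : (0 : ℝ) < k := by exact_mod_cast Nat.pos_of_ne_zero hk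
  have := Real.pi_pos
  have : 0 < Real.pi * η.im * k := by positivity
  linarith

/-- Im η > 0 makes |q| < 1, so q is not a root of unity. This is what allows division by [k] and
[k]! throughout. -/
theorem qpow_natCast_ne_one {η : ℂ} (hη : 0 < η.im) {k : ℕ} (hk : k ≠ 0) : qpow η k ≠ 1 := by
  intro h
  have := norm_qpow_natCast_lt_one hη hk
  simp [h] at this

theorem qden_ne_zero {η : ℂ} (hη : 0 < η.im) : qpow η 1 - qpow η (-1) ≠ 0 := by
  intro h
  apply qpow_natCast_ne_one hη (k := 2) (by norm_num)
  have h2 : ((2 : ℕ) : ℂ) = 1 - (-1) := by norm_num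
  rw [h2, qpow_sub, ← sub_eq_zero.mp h, div_self (qpow_ne_zero _ _)]

theorem qnum_eq_zero_iff {η : ℂ} (hη : 0 < η.im) (x : ℂ) : qnum η x = 0 ↔ qpow η (2 * x) = 1 := by
  rw [qnum, div_eq_zero_iff, or_iff_left (qden_ne_zero hη), sub_eq_zero, qpow_neg, qpow_two_mul,
    sq, mul_eq_one_iff_eq_inv₀ (qpow_ne_zero _ _)]

theorem qnum_zero (η : ℂ) : qnum η 0 = 0 := by simp [qnum]

theorem qnum_one {η : ℂ} (hη : 0 < η.im) : qnum η 1 = 1 := div_self (qden_ne_zero hη)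

theorem qnum_neg (η x : ℂ) : qnum η (-x) = -qnum η x := by
  rw [qnum, qnum, neg_neg]; ring

theorem qnum_natCast_ne_zero {η : ℂ} (hη : 0 < η.im) {k : ℕ} (hk : k ≠ 0) : qnum η k ≠ 0 := by
  rw [Ne, qnum_eq_zero_iff hη]
  exact_mod_cast qpow_natCast_ne_one hη (k := 2 * k) (by omega)

theorem qnum_natCast_succ_ne_zero {η : ℂ} (hη : 0 < η.im) (k : ℕ) : qnum η (k + 1) ≠ 0 := by
  exact_mod_cast qnum_natCast_ne_zero hη (k := k + 1) (by omega)

theorem qfact_zero (η : ℂ) : qfact η 0 = 1 := by simp [qfact]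

theorem qfact_succ (η : ℂ) (k : ℕ) : qfact η (k + 1) = qfact η k * qnum η (k + 1) := by
  simp [qfact, Finset.prod_range_succ]

theorem qfact_ne_zero {η : ℂ} (hη : 0 < η.im) (k : ℕ) : qfact η k ≠ 0 :=
  Finset.prod_ne_zero_iff.mpr fun s _ => qnum_natCast_succ_ne_zero hη s

theorem qpoch_succ (η x : ℂ) (k : ℕ) : qpoch η x (k + 1) = qpoch η x k * qnum η (x + k) := by
  simp [qpoch, Finset.prod_range_succ]

theorem qpoch_zero (η x : ℂ) : qpoch η x 0 = 1 := by simp [qpoch]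

theorem qpoch_add (η x : ℂ) (j k : ℕ) :
    qpoch η x (j + k) = qpoch η x j * qpoch η (x + j) k := by
  simp only [qpoch, Finset.prod_range_add]
  congr 1
  refine Finset.prod_congr rfl fun s _ => ?_
  push_cast; ring_nf

/-- The q-Pascal splitting, from which the recursions for divided powers are obtained; `qnum_add'`
is the form with q inverted. -/
theorem qnum_add (η a b : ℂ) : qnum η (a + b) = qpow η b * qnum η a + qpow η (-a) * qnum η b := by
  have := qpow_ne_zero η a
  have := qpow_ne_zero η b
  simp only [qnum, qpow_add, qpow_neg, neg_add]
  field_simp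
  ring

theorem qnum_add' (η a b : ℂ) : qnum η (a + b) = qpow η (-b) * qnum η a + qpow η a * qnum η b := by
  rw [add_comm, qnum_add]; ring

/-- The scalar form of [E, F] = [h]: with a = m and c = Λ - m it is the commutation relation on the
weight vector v^{(m)}. -/
theorem qnum_commutator {η : ℂ} (hη : 0 < η.im) (a c : ℂ) :
    qnum η (a + 1) * qnum η c - qnum η (c + 1) * qnum η a = qnum η (c - a) := by
  have hd : qpow η 1 - (qpow η 1)⁻¹ ≠ 0 := by rw [← qpow_neg]; exact qden_ne_zero hη
  have ha := qpow_ne_zero η a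
  have hc := qpow_ne_zero η c
  have h1 := qpow_ne_zero η 1
  have key : ∀ x y z w u : ℂ, x * y - z * w = u * (qpow η 1 - (qpow η 1)⁻¹) →
      x / (qpow η 1 - (qpow η 1)⁻¹) * (y / (qpow η 1 - (qpow η 1)⁻¹)) -
      z / (qpow η 1 - (qpow η 1)⁻¹) * (w / (qpow η 1 - (qpow η 1)⁻¹)) =
      u / (qpow η 1 - (qpow η 1)⁻¹) := by
    intro x y z w u h
    rw [div_mul_div_comm, div_mul_div_comm, ← sub_div, h, mul_div_mul_right _ _ hd]
  simp only [qnum, qpow_sub, qpow_add, qpow_neg]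
  refine key _ _ _ _ _ ?_
  field_simp
  ring

/-- The divided falling `q`-power `[x] [x-1] ⋯ [x-s+1] / [s]!`, which is `0` for `s < 0`. -/
def dfall (η x : ℂ) (s : ℤ) : ℂ :=
  if s < 0 then 0 else (∏ t ∈ Finset.range s.toNat, qnum η (x - t)) / qfact η s.toNat

theorem dfall_natCast (η x : ℂ) (s : ℕ) :
    dfall η x s = (∏ t ∈ Finset.range s, qnum η (x - t)) / qfact η s := by
  simp [dfall]

theorem dfall_of_neg (η x : ℂ) {s : ℤ} (hs : s < 0) : dfall η x s = 0 := by simp [dfall, hs]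

theorem dfall_zero (η x : ℂ) : dfall η x 0 = 1 := by simp [dfall, qfact_zero]

/-- The convention that the quantity is zero for s < 0 is consistent with the recursion because [s +
1] = 0 at s = -1. The recursion thus holds for every integer s, and later sums need no boundary
cases. -/
theorem dfall_succ {η : ℂ} (hη : 0 < η.im) (x : ℂ) (s : ℤ) :
    qnum η (s + 1) * dfall η x (s + 1) = qnum η (x - s) * dfall η x s := by
  rcases lt_trichotomy s (-1) with h | h | h
  · rw [dfall_of_neg _ _ (by omega), dfall_of_neg _ _ (by omega)]; simp
  · subst h; rw [dfall_of_neg _ _ (show (-1 : ℤ) < 0 by norm_num)]; simp [qnum_zero]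
  · obtain ⟨n, rfl⟩ := Int.eq_ofNat_of_zero_le (show 0 ≤ s by omega)
    have : ((n : ℤ) + 1) = ((n + 1 : ℕ) : ℤ) := by push_cast; rfl
    rw [this, dfall_natCast, dfall_natCast, Finset.prod_range_succ, qfact_succ]
    have h1 := qfact_ne_zero hη n
    have h2 := qnum_natCast_succ_ne_zero hη n
    push_cast
    field_simp

theorem dfall_sub_one (η x : ℂ) (i : ℕ) :
    qnum η x * dfall η (x - 1) i = qnum η (x - i) * dfall η x i := by
  rw [dfall_natCast, dfall_natCast, ← mul_div_assoc, ← mul_div_assoc]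
  congr 1
  rw [mul_comm (qnum η (x - i)), ← Finset.prod_range_succ (fun t : ℕ => qnum η (x - t)),
    Finset.prod_range_succ', mul_comm]
  congr 1
  · refine Finset.prod_congr rfl fun t _ => ?_
    push_cast; ring_nf
  · simp

theorem dfall_eq_zero_of_lt (η : ℂ) {l i : ℕ} (h : l < i) : dfall η l i = 0 := by
  rw [dfall_natCast, Finset.prod_eq_zero (Finset.mem_range.mpr h) (by simp [qnum_zero]), zero_div]

theorem dfall_self {η : ℂ} (hη : 0 < η.im) (l : ℕ) : dfall η l l = 1 := by
  rw [dfall_natCast, div_eq_one_iff_eq (qfact_ne_zero hη l), qfact,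
    ← Finset.prod_range_reflect]
  refine Finset.prod_congr rfl fun t ht => ?_
  have := Finset.mem_range.mp ht
  congr 1
  rw [show l - 1 - t = l - (t + 1) by omega, Nat.cast_sub (by omega)]
  push_cast; ring

/-! ### Matrix elements of the intertwining operators -/

/-- The scalar `q^{i(λ-Λ+2m-i)} [-λ+Λ-2m+i+1]_{m-i} [m]!/[m-i]!`, the coefficient of
`v^{(i)} ⊗ u_{m-i}` in the singular vector. -/
def singCoef (η L : ℂ) (m : ℕ) (lam : ℂ) (i : ℕ) : ℂ :=
  qpow η (i * (lam - L + 2 * m - i)) * qpoch η (-lam + L - 2 * m + i + 1) (m - i) *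
    (qfact η m / qfact η (m - i))

/-- The matrix element of `Φ_m^Λ(λ)` from `v^{(k)}` to `v^{(k+m-b)} ⊗ u_b`, as an explicit
quasi-polynomial in `q^k`. -/
def polyCoef (η L : ℂ) (m : ℕ) (lam : ℂ) (k b : ℤ) : ℂ :=
  ∑ i ∈ Finset.range (m + 1), singCoef η L m lam i *
    (qpow η (-((k - (b - m + i)) * (L - 2 * m + 2 * i)) + (b - m + i) * (k - (b - m + i))) *
      dfall η (k + m - b) i * dfall η (L - m + i) (b - m + i))

/-- The recursion for a single term of the expansion of a divided power of Δ(F): K + 1 applications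
of F are distributed as K + 1 - s on the Verma factor and s on the dual factor. Splitting [K + 1] =
q^s [K + 1 - s] + q^{-(K+1-s)} [s] separates the term whose last F acted on the left from the one
whose last F acted on the right. -/
theorem divided_power_rel {η : ℂ} (hη : 0 < η.im) (K B l z : ℂ) (s : ℤ) (i : ℕ)
    (h : l - i = K + 1 - s) :
    qnum η (K + 1) * (qpow η (-((K + 1 - s) * B) + s * (K + 1 - s)) * dfall η l i * dfall η z s) =
      qpow η (-(B - 2 * s)) * qnum η l *
        (qpow η (-((K - s) * B) + s * (K - s)) * dfall η (l - 1) i * dfall η z s) +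
      qnum η (z - s + 1) *
        (qpow η (-((K - (s - 1)) * B) + (s - 1) * (K - (s - 1))) * dfall η l i *
          dfall η z (s - 1)) := by
  have h1 := dfall_sub_one η l i
  have h2 := dfall_succ hη z (s - 1)
  rw [sub_add_cancel] at h2
  push_cast at h2
  rw [sub_add_cancel, show z - ((s : ℂ) - 1) = z - s + 1 by ring] at h2
  have e1 : qpow η (-(B - 2 * s)) * qpow η (-((K - s) * B) + s * (K - s)) =
      qpow η (-((K + 1 - s) * B) + s * (K + 1 - s)) * qpow η s := by
    rw [← qpow_add, ← qpow_add]; ring_nf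
  have e2 : qpow η (-((K - (s - 1)) * B) + (s - 1) * (K - (s - 1))) =
      qpow η (-((K + 1 - s) * B) + s * (K + 1 - s)) * qpow η (-(K + 1 - s)) := by
    rw [← qpow_add]; ring_nf
  have e3 := qnum_add η (K + 1 - s) s
  rw [sub_add_cancel] at e3
  rw [h] at h1
  rw [e2, e3]
  linear_combination (-qpow η (-(B - 2 * s)) * qpow η (-((K - s) * B) + s * (K - s)) *
    dfall η z s) * h1 - (qnum η (K + 1 - s) * dfall η l i * dfall η z s) * e1 + (qpow η (-((K + 1 - s) * B) + s * (K + 1 - s)) * qpow η (-(K + 1 - s)) * dfall η l i) * h2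

/-- The i-th summand is the contribution of v^{(i)} ⊗ u_{m-i}, and each summand satisfies the
relation by itself. Since only `divided_power_rel` is used, k and b may be arbitrary integers. -/
theorem polyCoef_F {η : ℂ} (hη : 0 < η.im) (L : ℂ) (m : ℕ) (lam : ℂ) (k b : ℤ) :
    qnum η (k + 1) * polyCoef η L m lam (k + 1) b =
      qpow η (-(L - 2 * b)) * qnum η (k + 1 + m - b) * polyCoef η L m lam k b +
        qnum η (L - b + 1) * polyCoef η L m lam k (b - 1) := by
  simp only [polyCoef, Finset.mul_sum]
  rw [← Finset.sum_add_distrib]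
  refine Finset.sum_congr rfl fun i _ => ?_
  have := divided_power_rel hη k (L - 2 * m + 2 * i) (k + 1 + m - b) (L - m + i) (b - m + i) i
    (by push_cast; ring)
  push_cast at this ⊢
  rw [show L - 2 * (m : ℂ) + 2 * i - 2 * (b - m + i) = L - 2 * b by ring,
    show (k : ℂ) + 1 + m - b - 1 = k + m - b by ring,
    show L - (m : ℂ) + i - (b - m + i) + 1 = L - b + 1 by ring,
    show b - (m : ℤ) + i - 1 = b - 1 - m + i by ring,
    show (b : ℂ) - m + i - 1 = b - 1 - m + i by ring] at this
  rw [show (k : ℂ) + m - (b - 1) = k + 1 + m - b by ring]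
  linear_combination singCoef η L m lam i * this

/-- With l = k + m - b and s = b - m + i one has l - i = k - s. If k < 0 ≤ s then l < i, and the
q-binomial of l over i vanishes. For l < 0 this fails, and the quasi-polynomial need not vanish. -/
theorem polyCoef_eq_zero (η L : ℂ) (m : ℕ) (lam : ℂ) {k b : ℤ} (hk : k < 0) (hl : 0 ≤ k + m - b) :
    polyCoef η L m lam k b = 0 := by
  refine Finset.sum_eq_zero fun i _ => ?_
  by_cases hs : b - m + i < 0
  · rw [dfall_of_neg _ _ hs]; simp
  · obtain ⟨l, hl'⟩ := Int.eq_ofNat_of_zero_le hl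
    have : (k : ℂ) + m - b = (l : ℂ) := by exact_mod_cast hl'
    rw [this, dfall_eq_zero_of_lt η (by omega)]; simp

theorem polyCoef_of_neg (η L : ℂ) (m : ℕ) (lam : ℂ) {k b : ℤ} (hb : b < 0) :
    polyCoef η L m lam k b = 0 := by
  refine Finset.sum_eq_zero fun i hi => ?_
  rw [dfall_of_neg _ (L - m + i) (by have := Finset.mem_range.mp hi; omega)]; simp

theorem polyCoef_zero_left {η : ℂ} (hη : 0 < η.im) (L : ℂ) (m : ℕ) (lam : ℂ) {i : ℕ} (hi : i ≤ m) :
    polyCoef η L m lam 0 (m - i) = singCoef η L m lam i := by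
  rw [polyCoef, Finset.sum_eq_single i]
  · have : ((0 : ℤ) : ℂ) + m - (((m : ℤ) - i : ℤ) : ℂ) = i := by push_cast; ring
    rw [this, dfall_self hη]
    simp [dfall_zero, qpow_zero]
  · intro j _ hj
    rcases lt_or_gt_of_ne hj with h | h
    · rw [dfall_of_neg _ (L - m + j) (by omega)]; simp
    · have : ((0 : ℤ) : ℂ) + m - (((m : ℤ) - i : ℤ) : ℂ) = i := by push_cast; ring
      rw [this, dfall_eq_zero_of_lt η h]; simp
  · intro h; exact absurd (Finset.mem_range.mpr (by omega)) h

/-- F never lowers the index of v, so only the summand i = 0 of the singular vector reaches v^{(0)}.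
-/
theorem polyCoef_leading (η L : ℂ) (m : ℕ) (lam : ℂ) (k : ℤ) :
    polyCoef η L m lam k (k + m) =
      qpoch η (-lam + L - 2 * m + 1) m * (qfact η m / qfact η m) * dfall η (L - m) k := by
  rw [polyCoef, Finset.sum_eq_single 0]
  · have : (k : ℂ) + m - ((k + m : ℤ) : ℂ) = 0 := by push_cast; ring
    rw [this]
    push_cast
    rw [dfall_zero]
    simp [singCoef, qpow_zero]
  · intro i _ hi
    have : (k : ℂ) + m - ((k + m : ℤ) : ℂ) = ((0 : ℕ) : ℂ) := by push_cast; ring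
    rw [this, dfall_eq_zero_of_lt η (by omega)]; simp
  · simp

/-- The condition that Δ(E) annihilates the given vector: a two-term recursion, since E ⊗ 1 from
index i + 1 and q^h ⊗ E from index i land in the same component. -/
theorem singCoef_succ {η : ℂ} (hη : 0 < η.im) (L : ℂ) (m : ℕ) (lam : ℂ) {i : ℕ} (hi : i < m) :
    qnum η (lam - L + 2 * m - 1 - i) * singCoef η L m lam (i + 1) +
      qpow η (lam - L + 2 * m - 1 - 2 * i) * (qnum η (m - i) * singCoef η L m lam i) = 0 := by
  obtain ⟨d, rfl⟩ : ∃ d, m = i + d + 1 := ⟨m - i - 1, by omega⟩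
  rw [singCoef, singCoef, show i + d + 1 - (i + 1) = d by omega, show i + d + 1 - i = 1 + d by omega,
    qpoch_add, add_comm 1 d, qfact_succ η d]
  push_cast
  set y := lam - L + 2 * ((i : ℂ) + d + 1) with hy
  have hf := qfact_ne_zero hη d
  have hd := qnum_natCast_succ_ne_zero hη d
  have e1 : qpow η (y - 1 - 2 * i) * qpow η (i * (y - i)) = qpow η ((i + 1) * (y - (i + 1))) := by
    rw [← qpow_add]; ring_nf
  have e2 : qpoch η (-lam + L - 2 * ((i : ℂ) + d + 1) + i + 1) 1 = - qnum η (y - 1 - i) := by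
    rw [← qnum_neg]; simp [qpoch, hy]; ring_nf
  rw [show -lam + L - 2 * ((i : ℂ) + d + 1) + i + 1 + 1 = -lam + L - 2 * ((i : ℂ) + d + 1) + (i + 1) + 1
    by ring, e2, show (i : ℂ) + d + 1 - i = d + 1 by ring]
  rw [← e1]
  field_simp
  linear_combination 0 * (qnum η (y - 1 - i) * qpoch η (-lam + L - 2 * ((i : ℂ) + d + 1) + (i + 1) + 1) d) * qfact η (i + d + 1) * e1

/-- The highest weight component of the `E`-relation: the vector `Φ v^{(0)}` is singular. -/
theorem polyCoef_singular {η : ℂ} (hη : 0 < η.im) (L : ℂ) (m : ℕ) (lam : ℂ) (b : ℤ)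
    (hl : 0 ≤ (m : ℤ) - 1 - b) :
    qnum η (lam - L + 2 * m - 1 - (m - 1 - b)) * polyCoef η L m lam 0 b +
      qpow η (lam - L + 2 * m - 1 - 2 * (m - 1 - b)) *
        (qnum η (b + 1) * polyCoef η L m lam 0 (b + 1)) = 0 := by
  obtain ⟨i, hi⟩ := Int.eq_ofNat_of_zero_le hl
  have hic : (m : ℂ) - 1 - b = i := by exact_mod_cast hi
  rcases le_or_gt 0 b with hb | hb
  · have him : i < m := by omega
    rw [show b + 1 = m - (i : ℤ) by omega, polyCoef_zero_left hη L m lam him.le,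
      show b = m - ((i + 1 : ℕ) : ℤ) by omega, polyCoef_zero_left hη L m lam (i := i + 1) him]
    have := singCoef_succ hη L m lam him
    push_cast
    ring_nf at this ⊢
    exact this
  · rw [polyCoef_of_neg _ _ _ _ hb]
    rcases eq_or_lt_of_le (show b + 1 ≤ 0 by omega) with h | h
    · have : (b : ℂ) + 1 = 0 := by exact_mod_cast h
      simp [this, qnum_zero]
    · rw [polyCoef_of_neg _ _ _ _ h]; simp

/-- Induction on k: E F^{k+1} is rewritten by [E, F] = [h] in the source, in the target Verma module
and in the dual module, starting from a singular vector at k = 0. -/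
theorem polyCoef_E {η : ℂ} (hη : 0 < η.im) (L : ℂ) (m : ℕ) (lam : ℂ) (k b : ℤ)
    (hl : 0 ≤ k - 1 + m - b) :
    qnum η (lam - k) * polyCoef η L m lam (k - 1) b =
      qnum η (lam - L + 2 * m - 1 - (k - 1 + m - b)) * polyCoef η L m lam k b +
      qpow η (lam - L + 2 * m - 1 - 2 * (k - 1 + m - b)) *
        (qnum η (b + 1) * polyCoef η L m lam k (b + 1)) := by
  rcases lt_or_ge k 0 with hk | hk
  · rw [polyCoef_eq_zero _ _ _ _ (k := k - 1) (by omega) (by omega),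
      polyCoef_eq_zero _ _ _ _ hk (by omega), polyCoef_eq_zero _ _ _ _ hk (by omega)]
    simp
  obtain ⟨n, rfl⟩ := Int.eq_ofNat_of_zero_le hk
  clear hk
  induction n generalizing b with
  | zero =>
    have := polyCoef_singular hη L m lam b (by push_cast at hl; omega)
    rw [polyCoef_eq_zero _ _ _ _ (k := ((0 : ℕ) : ℤ) - 1) (by simp) (by omega)]
    push_cast
    refine (mul_zero _).trans (this.symm.trans ?_)
    rw [zero_sub, neg_add_eq_sub]
  | succ n ih =>
    have hn : qnum η ((n : ℂ) + 1) ≠ 0 := qnum_natCast_succ_ne_zero hη n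
    have F1 := polyCoef_F hη L m lam n b
    have F2 := polyCoef_F hη L m lam n (b + 1)
    have F0 := polyCoef_F hη L m lam (n - 1) b
    have E1 := ih (b - 1) (by push_cast at hl; omega)
    -- The inductive E-relation at (n, b) is not available when n + m - b = 0, but it is only needed
    -- multiplied by [n + m - b], which is then zero.
    have E0 : qnum η (n + m - b) * (qnum η (lam - n) * polyCoef η L m lam (n - 1) b) =
        qnum η (n + m - b) * (qnum η (lam - L + 2 * m - 1 - (n - 1 + m - b)) * polyCoef η L m lam n b +
        qpow η (lam - L + 2 * m - 1 - 2 * (n - 1 + m - b)) *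
        (qnum η (b + 1) * polyCoef η L m lam n (b + 1))) := by
      rcases eq_or_lt_of_le (show 0 ≤ (n : ℤ) + m - b by push_cast at hl; omega) with h | h
      · have : (n : ℂ) + m - b = 0 := by exact_mod_cast h.symm
        rw [this, qnum_zero]; simp
      · have := ih b (by omega)
        push_cast at this
        rw [this]
    push_cast at F0 F1 F2 E0 E1 ⊢
    rw [sub_add_cancel] at F0 E1
    rw [sub_add_cancel] at E1 F0
    rw [add_sub_cancel_right] at F2
    rw [show (n : ℤ) + 1 - 1 = n by ring]
    apply mul_left_cancel₀ hn
    set A := polyCoef η L m lam n b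
    set A' := polyCoef η L m lam n (b - 1)
    set A'' := polyCoef η L m lam n (b + 1)
    set B := polyCoef η L m lam (n - 1) b
    set B' := polyCoef η L m lam (n - 1) (b - 1)
    set C := polyCoef η L m lam (n + 1) b
    set C' := polyCoef η L m lam (n + 1) (b + 1)
    clear_value A A' A'' B B' C C'
    set ν := lam - L + 2 * (m : ℂ) - 1 with hν
    set l := (n : ℂ) + m - b with hl'
    rw [show (n : ℂ) + 1 + m - b = l + 1 by rw [hl']; ring] at F1
    rw [show (n : ℂ) + 1 + m - (b + 1) = l by rw [hl']; ring,
      show L - ((b : ℂ) + 1) + 1 = L - b by ring] at F2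
    rw [show (n : ℂ) - 1 + m - (b - 1) = l by rw [hl']; ring] at E1
    rw [show (n : ℂ) - 1 + m - b = l - 1 by rw [hl']; ring, ← sub_add] at E0
    rw [show (n : ℂ) + 1 - 1 + m - b = l by rw [hl']; ring, show lam - ((n : ℂ) + 1) = lam - n - 1 by ring]
    -- The commutator [E, F] in the source, in the target Verma module and in the dual module,
    -- followed by the splitting of Δ([h]) that relates the three.
    have s1 := qnum_commutator hη n (lam - n - 1)
    have s2 := qnum_commutator hη l (ν - l)
    have s3 := qnum_commutator hη b (L - b)
    have s4 := qnum_add' η (ν - 2 * l) (L - 2 * b)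
    rw [sub_add_cancel, show lam - n - 1 - n = ν - 2 * l + (L - 2 * b) by rw [hν, hl']; ring,
      s4] at s1
    rw [show ν - l - l = ν - 2 * l by ring] at s2
    rw [show L - (b : ℂ) - b = L - 2 * b by ring] at s3
    have q1 : qpow η (-(L - 2 * b)) * qpow η (ν - 2 * (l - 1)) =
        qpow η (ν - 2 * l) * qpow η (-(L - 2 * (b + 1))) := by
      rw [← qpow_add, ← qpow_add]; ring_nf
    linear_combination (-qnum η (ν - l)) * F1 - qpow η (ν - 2 * l) * qnum η (b + 1) * F2 +
      A * s1 - A * qpow η (-(L - 2 * b)) * s2 - A * qpow η (ν - 2 * l) * s3 +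
      qnum η (lam - n) * F0 + qpow η (-(L - 2 * b)) * E0 + qnum η (L - b + 1) * E1 +
      qnum η l * qnum η (b + 1) * A'' * q1

/-! ### Summation identities -/

theorem qpoch_succ' (η x : ℂ) (k : ℕ) : qpoch η x (k + 1) = qnum η x * qpoch η (x + 1) k := by
  rw [add_comm, qpoch_add]; simp [qpoch]

/-- Multiplying by [b + 1] = [i + j] and splitting it as q^{-i}[j] + q^j [i] turns a sum of degree b
+ 1 into one of degree b. The boundary terms i = 0 and j = 0 drop out because [0] = 0. This is the
inductive step for the q-binomial identities below. -/
theorem sum_antidiagonal_qnum (η : ℂ) (b : ℕ) (A : ℕ → ℕ → ℂ) :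
    ∑ p ∈ Finset.HasAntidiagonal.antidiagonal b,
      (qpow η (-p.1) * qnum η (p.2 + 1) * A p.1 (p.2 + 1) +
        qpow η p.2 * qnum η (p.1 + 1) * A (p.1 + 1) p.2) =
      qnum η (b + 1) * ∑ p ∈ Finset.HasAntidiagonal.antidiagonal (b + 1), A p.1 p.2 := by
  have h : ∀ p ∈ Finset.HasAntidiagonal.antidiagonal (b + 1), qnum η (b + 1) * A p.1 p.2 =
      qpow η (-p.1) * qnum η p.2 * A p.1 p.2 + qpow η p.2 * qnum η p.1 * A p.1 p.2 := by
    intro p hp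
    have : (b : ℂ) + 1 = p.1 + p.2 := by
      exact_mod_cast (Finset.HasAntidiagonal.mem_antidiagonal.mp hp).symm
    rw [this, qnum_add]; ring
  rw [Finset.mul_sum, Finset.sum_congr rfl h, Finset.sum_add_distrib, Finset.sum_add_distrib,
    Finset.Nat.sum_antidiagonal_succ', Finset.Nat.sum_antidiagonal_succ]
  simp [qnum_zero]

/-- The `q`-Vandermonde convolution. -/
theorem dfall_add {η : ℂ} (hη : 0 < η.im) (t z : ℂ) (b : ℕ) :
    dfall η (t + z) b = ∑ p ∈ Finset.HasAntidiagonal.antidiagonal b,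
      qpow η (p.2 * (z - p.1) - p.1 * (t - p.2)) * dfall η t p.2 * dfall η z p.1 := by
  induction b with
  | zero => simp [dfall_zero, qpow_zero]
  | succ b ih =>
    apply mul_left_cancel₀ (qnum_natCast_succ_ne_zero hη b)
    have h1 := dfall_succ hη (t + z) b
    push_cast at h1 ⊢
    rw [h1, ih, Finset.mul_sum, ← sum_antidiagonal_qnum η b fun i j =>
      qpow η (j * (z - i) - i * (t - j)) * dfall η t j * dfall η z i]
    refine Finset.sum_congr rfl fun p hp => ?_
    obtain ⟨i, j⟩ := p
    have hb : (b : ℂ) = i + j := by exact_mod_cast (Finset.HasAntidiagonal.mem_antidiagonal.mp hp).symm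
    have h2 := dfall_succ hη t j
    have h3 := dfall_succ hη z i
    push_cast at h2 h3 ⊢
    rw [show t + z - b = (t - j) + (z - i) by rw [hb]; ring, qnum_add]
    have e1 : qpow η (-i) * qpow η ((j + 1) * (z - i) - i * (t - (j + 1))) =
        qpow η (z - i) * qpow η (j * (z - i) - i * (t - j)) := by
      rw [← qpow_add, ← qpow_add]; ring_nf
    have e2 : qpow η j * qpow η (j * (z - (i + 1)) - (i + 1) * (t - j)) =
        qpow η (-(t - j)) * qpow η (j * (z - i) - i * (t - j)) := by
      rw [← qpow_add, ← qpow_add]; ring_nf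
    linear_combination (-(qnum η (j + 1) * dfall η t (j + 1) * dfall η z i)) * e1 -
      (qnum η (i + 1) * dfall η t j * dfall η z (i + 1)) * e2 -
      qpow η (z - i) * qpow η (j * (z - i) - i * (t - j)) * dfall η z i * h2 -
      qpow η (-(t - j)) * qpow η (j * (z - i) - i * (t - j)) * dfall η t j * h3

/-- The expansion of a power in `q`-shifted factorials. -/
theorem pow_eq_sum_shifted {η : ℂ} (hη : 0 < η.im) (X : ℂ) (r : ℕ) :
    X ^ r / qfact η r = ∑ p ∈ Finset.HasAntidiagonal.antidiagonal r,
      qpow η (p.1 * p.2) * (∏ s ∈ Finset.range p.2, (X - qpow η (2 * s))) /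
        (qfact η p.1 * qfact η p.2) := by
  induction r with
  | zero => simp [qpow_zero, qfact_zero]
  | succ r ih =>
    have hr := qnum_natCast_succ_ne_zero hη r
    have hr' := qfact_ne_zero hη r
    apply mul_left_cancel₀ hr
    rw [← sum_antidiagonal_qnum η r fun i k => qpow η (i * k) *
      (∏ s ∈ Finset.range k, (X - qpow η (2 * s))) / (qfact η i * qfact η k)]
    have : qnum η (r + 1) * (X ^ (r + 1) / qfact η (r + 1)) = X * (X ^ r / qfact η r) := by
      rw [qfact_succ, pow_succ]; field_simp
    rw [this, ih, Finset.mul_sum]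
    refine Finset.sum_congr rfl fun p _ => ?_
    obtain ⟨i, k⟩ := p
    have e1 : qpow η (-i) * qpow η (i * (k + 1)) = qpow η (i * k) := by
      rw [← qpow_add]; ring_nf
    have e2 : qpow η k * qpow η ((i + 1) * k) = qpow η (i * k) * qpow η (2 * k) := by
      rw [← qpow_add, ← qpow_add]; ring_nf
    rw [qfact_succ, qfact_succ, Finset.prod_range_succ]
    push_cast
    have := qfact_ne_zero hη i
    have := qfact_ne_zero hη k
    have := qnum_natCast_succ_ne_zero hη i
    have := qnum_natCast_succ_ne_zero hη k
    generalize qpow η (-i) = u₁, qpow η (i * (k + 1)) = u₂, qpow η k = u₃,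
      qpow η ((i + 1) * k) = u₄, qpow η (2 * k) = u₅, qpow η (i * k) = u₆ at *
    field_simp
    linear_combination (-(X - u₅) * ∏ x ∈ Finset.range k, (X - qpow η (2 * x))) * e1 -
      (∏ x ∈ Finset.range k, (X - qpow η (2 * x))) * e2

/-- The three-term relation for sines. It accounts for the telescoping of the very-well-poised sum
and for the intertwining property of the quantum R-matrix. -/
theorem qnum_ptolemy {η : ℂ} (hη : 0 < η.im) (a b c : ℂ) :
    qnum η (a + c) * qnum η b - qnum η (b + c) * qnum η a = qnum η c * qnum η (b - a) := by
  have hd : qpow η 1 - (qpow η 1)⁻¹ ≠ 0 := by rw [← qpow_neg]; exact qden_ne_zero hη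
  have ha := qpow_ne_zero η a
  have hb := qpow_ne_zero η b
  have hc := qpow_ne_zero η c
  have key : ∀ x y z w u v d : ℂ, x * y - z * w = u * v →
      x / d * (y / d) - z / d * (w / d) = u / d * (v / d) := by
    intro x y z w u v d h
    rw [div_mul_div_comm, div_mul_div_comm, ← sub_div, h, div_mul_div_comm]
  simp only [qnum, qpow_sub, qpow_add, qpow_neg]
  refine key _ _ _ _ _ _ _ ?_
  field_simp
  ring

/-- The sum telescopes: its partial sums have a closed product form, verified by induction on the
upper limit. -/
theorem very_well_poised_partial_sum {η : ℂ} (hη : 0 < η.im) (Y : ℂ) (M j : ℕ) (hj : j ≤ M)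
    (hY : ∀ s ∈ Finset.range (2 * M + 3), qnum η (Y + s) ≠ 0) :
    ∑ i ∈ Finset.range (j + 1), (-1) ^ i * qnum η (Y + 2 * i) /
      (qfact η i * qfact η (M + 1 - i) * qpoch η (Y + i) (M + 2)) =
      (-1) ^ j / (qnum η (M + 1) * (qfact η j * qfact η (M - j)) * qpoch η (Y + j + 1) (M + 1)) := by
  have hp : ∀ i k : ℕ, i + k ≤ 2 * M + 3 → qpoch η (Y + i) k ≠ 0 := by
    intro i k h
    refine Finset.prod_ne_zero_iff.mpr fun s hs => ?_
    have := hY (i + s) (Finset.mem_range.mpr (by have := Finset.mem_range.mp hs; omega))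
    push_cast at this
    rwa [add_assoc]
  have hM := qnum_natCast_succ_ne_zero hη M
  induction j with
  | zero =>
    have h1 := hp 1 (M + 1) (by omega)
    have h0 := hY 0 (by simp)
    rw [Finset.sum_range_one, show M + 2 = 1 + (M + 1) by ring, qpoch_add]
    simp only [Nat.cast_zero, Nat.cast_one, add_zero, qfact_zero, pow_zero, Nat.sub_zero, mul_zero] at *
    rw [qfact_succ, show qpoch η Y 1 = qnum η Y by simp [qpoch]]
    have := qfact_ne_zero hη M
    field_simp
  | succ j ih =>
    rw [Finset.sum_range_succ, ih (by omega)]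
    obtain ⟨d, rfl⟩ : ∃ d, M = j + 1 + d := ⟨M - (j + 1), by omega⟩
    have hY1 := hY (j + 1) (Finset.mem_range.mpr (by omega))
    have hY2 := hY (j + 1 + (j + 1 + d + 1)) (Finset.mem_range.mpr (by omega))
    have h1 := hp (j + 2) (j + 1 + d) (by omega)
    push_cast at hY1 hY2 h1 hM ⊢
    have p1 : qpoch η (Y + j + 1) (j + 1 + d + 1) =
        qnum η (Y + (j + 1)) * qpoch η (Y + (j + 2)) (j + 1 + d) := by
      rw [qpoch_succ', show Y + (j : ℂ) + 1 + 1 = Y + (j + 2) by ring, add_assoc]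
    have p2 : qpoch η (Y + (j + 1) + 1) (j + 1 + d + 1) =
        qpoch η (Y + (j + 2)) (j + 1 + d) * qnum η (Y + (j + 1 + (j + 1 + d + 1))) := by
      rw [qpoch_succ]; push_cast; ring_nf
    have p3 : qpoch η (Y + (j + 1)) (j + 1 + d + 2) =
        qnum η (Y + (j + 1)) * (qpoch η (Y + (j + 2)) (j + 1 + d) *
          qnum η (Y + (j + 1 + (j + 1 + d + 1)))) := by
      rw [← p2, show j + 1 + d + 2 = 1 + (j + 1 + d + 1) by ring, qpoch_add]; simp [qpoch]
    rw [show j + 1 + d - j = d + 1 by omega,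
      show j + 1 + d - (j + 1) = d by omega, qfact_succ, qfact_succ, p1, p2, p3]
    have i1 := qfact_ne_zero hη j
    have i2 := qfact_ne_zero hη d
    have i3 := qnum_natCast_succ_ne_zero hη j
    have i4 := qnum_natCast_succ_ne_zero hη d
    -- With M = j + 1 + d this is the relation between numerators that remains over the common
    -- denominator.
    have e := qnum_ptolemy hη (j + 1) (Y + 2 * (j + 1)) (d + 1)
    rw [show (j : ℂ) + 1 + (d + 1) = j + 1 + d + 1 by ring,
      show Y + 2 * ((j : ℂ) + 1) + (d + 1) = Y + (j + 1 + (j + 1 + d + 1)) by ring,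
      show Y + 2 * ((j : ℂ) + 1) - (j + 1) = Y + (j + 1) by ring] at e
    rw [pow_succ]
    generalize qnum η (Y + 2 * (j + 1)) = u at *
    field_simp
    linear_combination (-1 : ℂ) * e

/-- An inversion relation for `q`-shifted factorials. -/
theorem very_well_poised_sum {η : ℂ} (hη : 0 < η.im) (Y : ℂ) (M : ℕ)
    (hY : ∀ s ∈ Finset.range (2 * M + 1), qnum η (Y + s) ≠ 0) :
    ∑ i ∈ Finset.range (M + 1), (-1) ^ i * qnum η (Y + 2 * i) /
      (qfact η i * qfact η (M - i) * qpoch η (Y + i) (M + 1)) = if M = 0 then 1 else 0 := by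
  rcases M with _ | M
  · have := hY 0 (by simp)
    simp only [Nat.cast_zero, add_zero] at this
    simp [qfact_zero, qpoch, this]
  -- All terms but the last are summed by the closed form of the partial sum, and the last one, of
  -- index M + 1, is its negative.
  rw [Finset.sum_range_succ, very_well_poised_partial_sum hη Y M M le_rfl (fun s hs => hY s hs),
    if_neg (by omega)]
  have h1 : qpoch η (Y + M + 1) (M + 1) ≠ 0 := by
    refine Finset.prod_ne_zero_iff.mpr fun s hs => ?_
    have := hY (M + 1 + s) (Finset.mem_range.mpr (by have := Finset.mem_range.mp hs; omega))
    push_cast at this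
    rwa [show Y + M + 1 + s = Y + (M + 1 + s) by ring]
  have h2 := hY (M + 1 + (M + 1)) (Finset.mem_range.mpr (by omega))
  have i1 := qfact_ne_zero hη M
  have i3 := qnum_natCast_succ_ne_zero hη M
  have p : qpoch η (Y + (M + 1)) (M + 1 + 1) =
      qpoch η (Y + M + 1) (M + 1) * qnum η (Y + 2 * (M + 1)) := by
    rw [qpoch_succ]; push_cast; ring_nf
  push_cast at h2 ⊢
  rw [show Y + ((M : ℂ) + 1 + (M + 1)) = Y + 2 * (M + 1) by ring] at h2
  rw [show M - M = 0 by omega, qfact_succ, qfact_zero, p, pow_succ]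
  generalize qnum η (Y + 2 * (M + 1)) = u at *
  field_simp
  ring

/-! ### Matrix elements of intertwining operators and of their compositions -/

/-- The matrix element of `Φ_m^Λ(λ)` from `v^{(k)}` to `v^{(k+m-b)} ⊗ u_b`. -/
def tcoef (η L : ℂ) (m : ℕ) (lam : ℂ) (k b : ℤ) : ℂ :=
  if 0 ≤ k + m - b then polyCoef η L m lam k b else 0

theorem tcoef_of_nonneg (η L : ℂ) (m : ℕ) (lam : ℂ) {k b : ℤ} (h : 0 ≤ k + m - b) :
    tcoef η L m lam k b = polyCoef η L m lam k b := if_pos h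

theorem tcoef_of_neg_out (η L : ℂ) (m : ℕ) (lam : ℂ) {k b : ℤ} (h : k + m - b < 0) :
    tcoef η L m lam k b = 0 := if_neg (by omega)

theorem tcoef_of_neg_left (η L : ℂ) (m : ℕ) (lam : ℂ) {k : ℤ} (b : ℤ) (h : k < 0) :
    tcoef η L m lam k b = 0 := by
  rw [tcoef]; split_ifs with h1
  · exact polyCoef_eq_zero _ _ _ _ h h1
  · rfl

theorem tcoef_of_neg_right (η L : ℂ) (m : ℕ) (lam : ℂ) (k : ℤ) {b : ℤ} (h : b < 0) :
    tcoef η L m lam k b = 0 := by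
  rw [tcoef, polyCoef_of_neg _ _ _ _ h, ite_self]

/-- Truncation at negative outgoing index is harmless: the only relation that crosses the boundary
has k + 1 + m - b = 0, where the coefficient [0] removes the truncated term. -/
theorem tcoef_F {η : ℂ} (hη : 0 < η.im) (L : ℂ) (m : ℕ) (lam : ℂ) (k b : ℤ) :
    qnum η (k + 1) * tcoef η L m lam (k + 1) b =
      qpow η (-(L - 2 * b)) * qnum η (k + 1 + m - b) * tcoef η L m lam k b +
        qnum η (L - b + 1) * tcoef η L m lam k (b - 1) := by
  rcases lt_trichotomy (k + 1 + m - b) 0 with h | h | h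
  · rw [tcoef_of_neg_out _ _ _ _ h, tcoef_of_neg_out _ _ _ _ (by omega),
      tcoef_of_neg_out _ _ _ _ (by omega)]
    simp
  · have hc : (k : ℂ) + 1 + m - b = 0 := by exact_mod_cast h
    have := polyCoef_F hη L m lam k b
    rw [hc, qnum_zero] at this ⊢
    rw [tcoef_of_nonneg _ _ _ _ (by omega), tcoef_of_nonneg _ _ _ _ (b := b - 1) (by omega), this]
    ring
  · rw [tcoef_of_nonneg _ _ _ _ (by omega), tcoef_of_nonneg _ _ _ _ (by omega),
      tcoef_of_nonneg _ _ _ _ (by omega), polyCoef_F hη]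

theorem tcoef_E {η : ℂ} (hη : 0 < η.im) (L : ℂ) (m : ℕ) (lam : ℂ) (k b : ℤ)
    (hl : 0 ≤ k - 1 + m - b) :
    qnum η (lam - k) * tcoef η L m lam (k - 1) b =
      qnum η (lam - L + 2 * m - 1 - (k - 1 + m - b)) * tcoef η L m lam k b +
      qpow η (lam - L + 2 * m - 1 - 2 * (k - 1 + m - b)) *
        (qnum η (b + 1) * tcoef η L m lam k (b + 1)) := by
  rw [tcoef_of_nonneg _ _ _ _ hl, tcoef_of_nonneg _ _ _ _ (by omega),
    tcoef_of_nonneg _ _ _ _ (by omega), polyCoef_E hη _ _ _ _ _ hl]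

theorem tcoef_zero_left {η : ℂ} (hη : 0 < η.im) (L : ℂ) (m : ℕ) (lam : ℂ) {i : ℕ} (hi : i ≤ m) :
    tcoef η L m lam 0 (m - i) = singCoef η L m lam i := by
  rw [tcoef_of_nonneg _ _ _ _ (by omega), polyCoef_zero_left hη _ _ _ hi]

theorem tcoef_leading {η : ℂ} (hη : 0 < η.im) (L : ℂ) (m : ℕ) (lam : ℂ) (k : ℤ) :
    tcoef η L m lam k (k + m) = qpoch η (-lam + L - 2 * m + 1) m * dfall η (L - m) k := by
  rw [tcoef_of_nonneg _ _ _ _ (by omega), polyCoef_leading, div_self (qfact_ne_zero hη m), mul_one]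

/-- The relations between the matrix elements `D k b₁ b₂`, from `v^{(k)}` to
`v^{(l)} ⊗ u_{b₁} ⊗ u_{b₂}` with `l = k + N - b₁ - b₂`, of an intertwining operator
`M_{λ-1} → M_{λ-Λ₁-Λ₂+2N-1} ⊗ M_{Λ₁}^* ⊗ M_{Λ₂}^*`. -/
structure PairRel (η L₁ L₂ : ℂ) (N : ℕ) (lam : ℂ) (D : ℤ → ℤ → ℤ → ℂ) : Prop where
  eq_zero : ∀ k b₁ b₂ : ℤ, k < 0 ∨ b₁ < 0 ∨ b₂ < 0 ∨ k + N - b₁ - b₂ < 0 → D k b₁ b₂ = 0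
  F : ∀ k b₁ b₂ : ℤ, qnum η (k + 1) * D (k + 1) b₁ b₂ =
    qpow η (-((L₁ - 2 * b₁) + (L₂ - 2 * b₂))) * qnum η (k + 1 + N - b₁ - b₂) * D k b₁ b₂ +
    (qpow η (-(L₂ - 2 * b₂)) * qnum η (L₁ - b₁ + 1) * D k (b₁ - 1) b₂ +
    qnum η (L₂ - b₂ + 1) * D k b₁ (b₂ - 1))
  E : ∀ k b₁ b₂ : ℤ, 0 ≤ k - 1 + N - b₁ - b₂ → qnum η (lam - k) * D (k - 1) b₁ b₂ =
    qnum η (lam - L₁ - L₂ + 2 * N - 1 - (k - 1 + N - b₁ - b₂)) * D k b₁ b₂ +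
    qpow η (lam - L₁ - L₂ + 2 * N - 1 - 2 * (k - 1 + N - b₁ - b₂)) *
      (qnum η (b₁ + 1) * D k (b₁ + 1) b₂ +
        qpow η (L₁ - 2 * b₁) * qnum η (b₂ + 1) * D k b₁ (b₂ + 1))

/-- The matrix elements of `(Φ_{m₁}^{Λ₁}(λ-Λ₂+2m₂) ⊗ 1) Φ_{m₂}^{Λ₂}(λ)`. -/
def pairCoef (η L₁ L₂ : ℂ) (m₁ m₂ : ℕ) (lam : ℂ) (k b₁ b₂ : ℤ) : ℂ :=
  tcoef η L₂ m₂ lam k b₂ * tcoef η L₁ m₁ (lam - L₂ + 2 * m₂) (k + m₂ - b₂) b₁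

theorem pairRel_pairCoef {η : ℂ} (hη : 0 < η.im) (L₁ L₂ : ℂ) (m₁ m₂ : ℕ) (lam : ℂ) :
    PairRel η L₁ L₂ (m₁ + m₂) lam (pairCoef η L₁ L₂ m₁ m₂ lam) where
  eq_zero k b₁ b₂ h := by
    rw [pairCoef]
    rcases h with h | h | h | h
    · rw [tcoef_of_neg_left _ _ _ _ _ h, zero_mul]
    · rw [tcoef_of_neg_right _ _ _ _ _ h, mul_zero]
    · rw [tcoef_of_neg_right _ _ _ _ _ h, zero_mul]
    · rw [tcoef_of_neg_out _ _ _ _ (b := b₁) (by push_cast at h; omega), mul_zero]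
  F k b₁ b₂ := by
    have h2 := tcoef_F hη L₂ m₂ lam k b₂
    have h1 := tcoef_F hη L₁ m₁ (lam - L₂ + 2 * m₂) (k + m₂ - b₂) b₁
    simp only [pairCoef]
    rw [show k + 1 + m₂ - b₂ = k + m₂ - b₂ + 1 by ring,
      show k + m₂ - (b₂ - 1) = k + m₂ - b₂ + 1 by ring]
    push_cast at h1 ⊢
    rw [neg_add, qpow_add]
    rw [show (k : ℂ) + m₂ - b₂ + 1 + m₁ - b₁ = k + 1 + (m₁ + m₂) - b₁ - b₂ by ring] at h1
    rw [show (k : ℂ) + 1 + m₂ - b₂ = k + m₂ - b₂ + 1 by ring] at h2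
    linear_combination tcoef η L₁ m₁ (lam - L₂ + 2 * m₂) (k + m₂ - b₂ + 1) b₁ * h2 +
      qpow η (-(L₂ - 2 * b₂)) * tcoef η L₂ m₂ lam k b₂ * h1
  E k b₁ b₂ hl := by
    push_cast at hl
    simp only [pairCoef]
    rw [show k - 1 + m₂ - b₂ = k + m₂ - b₂ - 1 by ring,
      show k + m₂ - (b₂ + 1) = k + m₂ - b₂ - 1 by ring]
    have h1 := tcoef_E hη L₁ m₁ (lam - L₂ + 2 * m₂) (k + m₂ - b₂) b₁ (by omega)
    -- The E-relation of the operator applied first needs a nonnegative intermediate index. The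
    -- element of the other operator multiplying it vanishes when that index is negative, so the
    -- product relation always holds.
    have h2 : tcoef η L₁ m₁ (lam - L₂ + 2 * m₂) (k + m₂ - b₂ - 1) b₁ *
          (qnum η (lam - k) * tcoef η L₂ m₂ lam (k - 1) b₂) =
        tcoef η L₁ m₁ (lam - L₂ + 2 * m₂) (k + m₂ - b₂ - 1) b₁ *
          (qnum η (lam - L₂ + 2 * m₂ - 1 - (k - 1 + m₂ - b₂)) * tcoef η L₂ m₂ lam k b₂ +
            qpow η (lam - L₂ + 2 * m₂ - 1 - 2 * (k - 1 + m₂ - b₂)) *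
              (qnum η (b₂ + 1) * tcoef η L₂ m₂ lam k (b₂ + 1))) := by
      rcases lt_or_ge (k + m₂ - b₂ - 1) 0 with h | h
      · rw [tcoef_of_neg_left _ _ _ _ _ h, zero_mul, zero_mul]
      · exact congrArg _ (tcoef_E hη L₂ m₂ lam k b₂ (by omega))
    push_cast at h1 h2 ⊢
    set l := (k : ℂ) - 1 + (m₁ + m₂) - b₁ - b₂ with hl'
    set ν := lam - L₁ - L₂ + 2 * ((m₁ : ℂ) + m₂) - 1 with hν
    rw [show lam - L₂ + 2 * (m₂ : ℂ) - L₁ + 2 * m₁ - 1 = ν by rw [hν]; ring,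
      show (k : ℂ) + m₂ - b₂ - 1 + m₁ - b₁ = l by rw [hl']; ring] at h1
    rw [show lam - L₂ + 2 * (m₂ : ℂ) - 1 - (k - 1 + m₂ - b₂) = lam - L₂ + 2 * m₂ - (k + m₂ - b₂)
      by ring, show lam - L₂ + 2 * (m₂ : ℂ) - 1 - 2 * (k - 1 + m₂ - b₂) = ν - 2 * l + (L₁ - 2 * b₁) by
        rw [hν, hl']; ring, qpow_add] at h2
    linear_combination tcoef η L₂ m₂ lam k b₂ * h1 + h2

theorem PairRel.sum {η L₁ L₂ : ℂ} {N : ℕ} {lam : ℂ} {ι : Type*} (s : Finset ι) (c : ι → ℂ)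
    {D : ι → ℤ → ℤ → ℤ → ℂ} (h : ∀ i ∈ s, PairRel η L₁ L₂ N lam (D i)) :
    PairRel η L₁ L₂ N lam fun k b₁ b₂ => ∑ i ∈ s, c i * D i k b₁ b₂ where
  eq_zero k b₁ b₂ hk := Finset.sum_eq_zero fun i hi => by rw [(h i hi).eq_zero k b₁ b₂ hk, mul_zero]
  F k b₁ b₂ := by
    simp only [Finset.mul_sum, ← Finset.sum_add_distrib]
    refine Finset.sum_congr rfl fun i hi => ?_
    linear_combination c i * (h i hi).F k b₁ b₂
  E k b₁ b₂ hl := by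
    simp only [Finset.mul_sum, ← Finset.sum_add_distrib]
    refine Finset.sum_congr rfl fun i hi => ?_
    linear_combination c i * (h i hi).E k b₁ b₂ hl

theorem PairRel.sub {η L₁ L₂ : ℂ} {N : ℕ} {lam : ℂ} {D D' : ℤ → ℤ → ℤ → ℂ}
    (h : PairRel η L₁ L₂ N lam D) (h' : PairRel η L₁ L₂ N lam D') :
    PairRel η L₁ L₂ N lam fun k b₁ b₂ => D k b₁ b₂ - D' k b₁ b₂ where
  eq_zero k b₁ b₂ hk := by rw [h.eq_zero k b₁ b₂ hk, h'.eq_zero k b₁ b₂ hk, sub_zero]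
  F k b₁ b₂ := by linear_combination h.F k b₁ b₂ - h'.F k b₁ b₂
  E k b₁ b₂ hl := by linear_combination h.E k b₁ b₂ hl - h'.E k b₁ b₂ hl

/-- An intertwining operator from a Verma module is determined by the highest weight component of
the image of the highest weight vector, if the target Verma module is generic. -/
theorem PairRel.eq_zero_of_leading {η : ℂ} (hη : 0 < η.im) {L₁ L₂ : ℂ} {N : ℕ} {lam : ℂ}
    {D : ℤ → ℤ → ℤ → ℂ} (h : PairRel η L₁ L₂ N lam D)
    (hgen : ∀ l < N, qnum η (lam - L₁ - L₂ + 2 * N - 1 - l) ≠ 0)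
    (h0 : ∀ b₁ b₂ : ℤ, b₁ + b₂ = N → D 0 b₁ b₂ = 0) (k b₁ b₂ : ℤ) : D k b₁ b₂ = 0 := by
  -- The image of the highest weight vector is singular. The E-relation at k = 0 expresses its
  -- component at v^{(l+1)} through components at v^{(l)}, with a coefficient that is invertible for
  -- a generic target; the F-relation then gives all k.
  have hz : ∀ (l : ℕ) (b₁ b₂ : ℤ), N - b₁ - b₂ = l → D 0 b₁ b₂ = 0 := by
    intro l
    induction l with
    | zero => intro b₁ b₂ hb; exact h0 b₁ b₂ (by push_cast at hb; omega)
    | succ l ih =>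
      intro b₁ b₂ hb
      by_cases hneg : b₁ < 0 ∨ b₂ < 0
      · exact h.eq_zero _ _ _ (by tauto)
      have hE := h.E 0 b₁ b₂ (by push_cast at hb; omega)
      rw [h.eq_zero (0 - 1) b₁ b₂ (by omega), ih (b₁ + 1) b₂ (by push_cast at hb; omega),
        ih b₁ (b₂ + 1) (by push_cast at hb; omega)] at hE
      have hl : ((0 : ℤ) : ℂ) - 1 + N - b₁ - b₂ = l := by
        have : (N : ℂ) - b₁ - b₂ = (l : ℂ) + 1 := by exact_mod_cast hb
        push_cast; linear_combination this
      rw [hl] at hE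
      have := hgen l (by push_cast at hb; omega)
      simpa [this] using hE
  rcases lt_or_ge k 0 with hk | hk
  · exact h.eq_zero _ _ _ (Or.inl hk)
  obtain ⟨n, rfl⟩ := Int.eq_ofNat_of_zero_le hk
  clear hk
  induction n generalizing b₁ b₂ with
  | zero =>
    by_cases hl : N - b₁ - b₂ < 0
    · exact h.eq_zero _ _ _ (by right; right; right; push_cast; omega)
    · exact hz (N - b₁ - b₂).toNat b₁ b₂ (by omega)
  | succ n ih =>
    have hF := h.F n b₁ b₂
    rw [ih, ih, ih] at hF
    have := qnum_natCast_succ_ne_zero hη n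
    push_cast at hF ⊢
    simpa [this] using hF

/-! ### Composition with the quantum R-matrix -/

/-- The matrix element of the quantum R-matrix from `v^{(m₁)} ⊗ v^{(m₂)}` to
`v^{(m₁-κ)} ⊗ v^{(m₂+κ)}`. -/
def rCoef (η La Lb : ℂ) (m₁ m₂ : ℤ) (κ : ℕ) : ℂ :=
  qpow η (-(m₁ * Lb) - m₂ * La + 2 * m₁ * m₂) *
    (qpow η (κ * (κ - 1) / 2) * (qpow η 1 - qpow η (-1)) ^ κ / qfact η κ) *
    (qpoch η (La - m₁ + 1) κ * qpoch η (m₂ + 1) κ)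

theorem rCoef_factor_succ {η : ℂ} (hη : 0 < η.im) (κ : ℕ) :
    qpow η ((κ + 1 : ℕ) * ((κ + 1 : ℕ) - 1) / 2) * (qpow η 1 - qpow η (-1)) ^ (κ + 1) /
      qfact η (κ + 1) = qpow η (κ * (κ - 1) / 2) * (qpow η 1 - qpow η (-1)) ^ κ / qfact η κ *
        (qpow η κ * (qpow η 1 - qpow η (-1)) / qnum η (κ + 1)) := by
  have h1 := qfact_ne_zero hη κ
  have h2 := qnum_natCast_succ_ne_zero hη κ
  have : qpow η ((κ + 1 : ℕ) * ((κ + 1 : ℕ) - 1) / 2) = qpow η (κ * (κ - 1) / 2) * qpow η κ := by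
    rw [← qpow_add]; push_cast; ring_nf
  rw [this, qfact_succ]
  field_simp
  ring

theorem qnum_mul_qden {η : ℂ} (hη : 0 < η.im) (x : ℂ) :
    qnum η x * (qpow η 1 - qpow η (-1)) = qpow η x - qpow η (-x) :=
  div_mul_cancel₀ _ (qden_ne_zero hη)

theorem rCoef_E_zero {η : ℂ} (L₁ L₂ : ℂ) (b₁ b₂ : ℤ) :
    qpow η (L₁ - 2 * b₁) * qnum η (b₂ + 1) * rCoef η L₂ L₁ (b₂ + 1) b₁ 0 =
      rCoef η L₂ L₁ b₂ b₁ 0 * qnum η (b₂ + 1) := by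
  simp only [rCoef, qpoch_zero]
  have : qpow η (L₁ - 2 * b₁) * qpow η (-((b₂ + 1 : ℤ) * L₁) - b₁ * L₂ + 2 * (b₂ + 1 : ℤ) * b₁) =
      qpow η (-(b₂ * L₁) - b₁ * L₂ + 2 * b₂ * b₁) := by
    rw [← qpow_add]; push_cast; ring_nf
  rw [← this]; ring

/-- A component of the intertwining property of the quantum R-matrix with respect to E;
`rCoef_E_zero` is the boundary component. All four terms multiply the same entry of the array to
which R is applied, which fixes the shifts of κ. -/
theorem rCoef_E_succ {η : ℂ} (hη : 0 < η.im) (L₁ L₂ : ℂ) (b₁ b₂ : ℤ) (κ : ℕ) :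
    qnum η (b₁ + 1) * rCoef η L₂ L₁ b₂ (b₁ + 1) κ +
      qpow η (L₁ - 2 * b₁) * qnum η (b₂ + 1) * rCoef η L₂ L₁ (b₂ + 1) b₁ (κ + 1) =
    rCoef η L₂ L₁ b₂ b₁ (κ + 1) * qnum η (b₂ - κ) +
      rCoef η L₂ L₁ b₂ b₁ κ * (qpow η (L₂ - 2 * (b₂ - κ)) * qnum η (b₁ + κ + 1)) := by
  simp only [rCoef]
  rw [rCoef_factor_succ hη]
  push_cast
  set c₀ := qpow η (-(b₂ * L₁) - b₁ * L₂ + 2 * b₂ * b₁) with hc₀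
  have c1 : qpow η (-(b₂ * L₁) - (b₁ + 1) * L₂ + 2 * b₂ * (b₁ + 1)) =
      c₀ * qpow η (-(L₂ - 2 * b₂)) := by rw [hc₀, ← qpow_add]; ring_nf
  have c2 : qpow η (L₁ - 2 * b₁) * qpow η (-((b₂ + 1) * L₁) - b₁ * L₂ + 2 * (b₂ + 1) * b₁) = c₀ := by
    rw [hc₀, ← qpow_add]; ring_nf
  have y1 : qnum η (b₁ + 1) * qpoch η ((b₁ : ℂ) + 1 + 1) κ = qpoch η (b₁ + 1) (κ + 1) :=
    (qpoch_succ' _ _ _).symm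
  have y2 : qpoch η ((b₁ : ℂ) + 1) κ * qnum η (b₁ + κ + 1) = qpoch η (b₁ + 1) (κ + 1) := by
    rw [qpoch_succ]; ring_nf
  have x1 : qpoch η (L₂ - (b₂ + 1) + 1) (κ + 1) = qnum η (L₂ - b₂) * qpoch η (L₂ - b₂ + 1) κ := by
    rw [qpoch_succ', show L₂ - ((b₂ : ℂ) + 1) + 1 = L₂ - b₂ by ring]
  have x2 : qpoch η (L₂ - b₂ + 1) (κ + 1) = qpoch η (L₂ - b₂ + 1) κ * qnum η (L₂ - b₂ + (κ + 1)) := by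
    rw [qpoch_succ]; ring_nf
  have pt := qnum_ptolemy hη (b₂ - κ) (L₂ - b₂) (κ + 1)
  rw [show (b₂ : ℂ) - κ + (κ + 1) = b₂ + 1 by ring] at pt
  have qd := qnum_mul_qden hη (L₂ - b₂ - (b₂ - κ))
  have e1 : qpow η κ * qpow η (L₂ - b₂ - (b₂ - κ)) = qpow η (L₂ - 2 * (b₂ - κ)) := by
    rw [← qpow_add]; ring_nf
  have e2 : qpow η κ * qpow η (-(L₂ - b₂ - (b₂ - κ))) = qpow η (-(L₂ - 2 * b₂)) := by
    rw [← qpow_add]; ring_nf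
  have h2 := qnum_natCast_succ_ne_zero hη κ
  rw [c1, x1, x2]
  generalize qpow η (κ * (κ - 1) / 2) * (qpow η 1 - qpow η (-1)) ^ κ / qfact η κ = r
  generalize qpow η 1 - qpow η (-1) = d at *
  rw [← e1, ← e2]
  -- What is left after removing the common q-shifted factorials; it combines `qnum_ptolemy` with
  -- the definition of a q-number.
  have main : qpow η κ * qpow η (-(L₂ - b₂ - (b₂ - κ))) + qnum η (b₂ + 1) *
      (qpow η κ * d / qnum η (κ + 1)) * qnum η (L₂ - b₂) =
      (qpow η κ * d / qnum η (κ + 1)) * qnum η (L₂ - b₂ + (κ + 1)) * qnum η (b₂ - κ) +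
      qpow η κ * qpow η (L₂ - b₂ - (b₂ - κ)) := by
    field_simp
    linear_combination qpow η κ * (d * pt + qnum η (κ + 1) * qd)
  linear_combination (c₀ * r * qpoch η (L₂ - b₂ + 1) κ * qpoch η (b₁ + 1) (κ + 1)) * main +
    c₀ * r * qpoch η (L₂ - b₂ + 1) κ * (qpow η κ * qpow η (-(L₂ - b₂ - (b₂ - κ)))) * y1 -
    c₀ * r * qpoch η (L₂ - b₂ + 1) κ * (qpow η κ * qpow η (L₂ - b₂ - (b₂ - κ))) * y2 +
    r * (qpow η κ * d / qnum η (κ + 1)) * qnum η (b₂ + 1) * qnum η (L₂ - b₂) *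
      qpoch η (L₂ - b₂ + 1) κ * qpoch η (b₁ + 1) (κ + 1) * c2

theorem rCoef_F_zero {η : ℂ} (L₁ L₂ : ℂ) (b₁ b₂ : ℤ) :
    qpow η (-(L₂ - 2 * b₂)) * qnum η (L₁ - b₁ + 1) * rCoef η L₂ L₁ b₂ (b₁ - 1) 0 =
      rCoef η L₂ L₁ b₂ b₁ 0 * qnum η (L₁ - b₁ + 1) := by
  simp only [rCoef, qpoch_zero]
  have : qpow η (-(L₂ - 2 * b₂)) * qpow η (-(b₂ * L₁) - (b₁ - 1 : ℤ) * L₂ + 2 * b₂ * (b₁ - 1 : ℤ)) =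
      qpow η (-(b₂ * L₁) - b₁ * L₂ + 2 * b₂ * b₁) := by
    rw [← qpow_add]; push_cast; ring_nf
  rw [← this]; ring

/-- The counterpart of `rCoef_E_succ` for F, again reducing to the three-term relation. -/
theorem rCoef_F_succ {η : ℂ} (hη : 0 < η.im) (L₁ L₂ : ℂ) (b₁ b₂ : ℤ) (κ : ℕ) :
    qpow η (-(L₂ - 2 * b₂)) * qnum η (L₁ - b₁ + 1) * rCoef η L₂ L₁ b₂ (b₁ - 1) (κ + 1) +
      qnum η (L₂ - b₂ + 1) * rCoef η L₂ L₁ (b₂ - 1) b₁ κ =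
    rCoef η L₂ L₁ b₂ b₁ (κ + 1) * qnum η (L₁ - (b₁ + κ)) +
      rCoef η L₂ L₁ b₂ b₁ κ * (qpow η (-(L₁ - 2 * (b₁ + κ))) * qnum η (L₂ - (b₂ - κ) + 1)) := by
  simp only [rCoef]
  rw [rCoef_factor_succ hη]
  push_cast
  set c₀ := qpow η (-(b₂ * L₁) - b₁ * L₂ + 2 * b₂ * b₁) with hc₀
  have c1 : qpow η (-(L₂ - 2 * b₂)) * qpow η (-(b₂ * L₁) - (b₁ - 1) * L₂ + 2 * b₂ * (b₁ - 1)) =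
      c₀ := by rw [hc₀, ← qpow_add]; ring_nf
  have c2 : qpow η (-((b₂ - 1) * L₁) - b₁ * L₂ + 2 * (b₂ - 1) * b₁) = c₀ * qpow η (L₁ - 2 * b₁) := by
    rw [hc₀, ← qpow_add]; ring_nf
  have y1 : qnum η (L₂ - b₂ + 1) * qpoch η (L₂ - (b₂ - 1) + 1) κ = qpoch η (L₂ - b₂ + 1) (κ + 1) := by
    rw [qpoch_succ', show L₂ - ((b₂ : ℂ) - 1) + 1 = L₂ - b₂ + 1 + 1 by ring]
  have y2 : qpoch η (L₂ - b₂ + 1) κ * qnum η (L₂ - (b₂ - κ) + 1) = qpoch η (L₂ - b₂ + 1) (κ + 1) := by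
    rw [qpoch_succ]; ring_nf
  have x1 : qpoch η ((b₁ : ℂ) - 1 + 1) (κ + 1) = qnum η b₁ * qpoch η (b₁ + 1) κ := by
    rw [qpoch_succ', sub_add_cancel]
  have x2 : qpoch η ((b₁ : ℂ) + 1) (κ + 1) = qpoch η (b₁ + 1) κ * qnum η (b₁ + (κ + 1)) := by
    rw [qpoch_succ]; ring_nf
  have pt := qnum_ptolemy hη b₁ (L₁ - (b₁ + κ)) (κ + 1)
  rw [show L₁ - ((b₁ : ℂ) + κ) + (κ + 1) = L₁ - b₁ + 1 by ring] at pt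
  have qd := qnum_mul_qden hη (L₁ - (b₁ + κ) - b₁)
  have e1 : qpow η κ * qpow η (L₁ - (b₁ + κ) - b₁) = qpow η (L₁ - 2 * b₁) := by
    rw [← qpow_add]; ring_nf
  have e2 : qpow η κ * qpow η (-(L₁ - (b₁ + κ) - b₁)) = qpow η (-(L₁ - 2 * (b₁ + κ))) := by
    rw [← qpow_add]; ring_nf
  have h2 := qnum_natCast_succ_ne_zero hη κ
  rw [c2, x1, x2]
  generalize qpow η (κ * (κ - 1) / 2) * (qpow η 1 - qpow η (-1)) ^ κ / qfact η κ = r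
  generalize qpow η 1 - qpow η (-1) = d at *
  rw [← e1, ← e2]
  have main : qpow η κ * qpow η (L₁ - (b₁ + κ) - b₁) + qnum η (L₁ - b₁ + 1) *
      (qpow η κ * d / qnum η (κ + 1)) * qnum η b₁ =
      (qpow η κ * d / qnum η (κ + 1)) * qnum η (b₁ + (κ + 1)) * qnum η (L₁ - (b₁ + κ)) +
      qpow η κ * qpow η (-(L₁ - (b₁ + κ) - b₁)) := by
    field_simp
    linear_combination (-qpow η κ) * (d * pt + qnum η (κ + 1) * qd)
  linear_combination (c₀ * r * qpoch η (b₁ + 1) κ * qpoch η (L₂ - b₂ + 1) (κ + 1)) * main +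
    c₀ * r * qpoch η (b₁ + 1) κ * (qpow η κ * qpow η (L₁ - (b₁ + κ) - b₁)) * y1 -
    c₀ * r * qpoch η (b₁ + 1) κ * (qpow η κ * qpow η (-(L₁ - (b₁ + κ) - b₁))) * y2 +
    r * (qpow η κ * d / qnum η (κ + 1)) * qnum η (L₁ - b₁ + 1) * qnum η b₁ *
      qpoch η (b₁ + 1) κ * qpoch η (L₂ - b₂ + 1) (κ + 1) * c1

/-- Summation by parts: the hypotheses make the sum telescope and kill both ends. -/
theorem sum_shift_eq_zero (α β c : ℕ → ℂ) (M : ℕ) (h0 : α 0 = 0) (h : ∀ κ, α (κ + 1) + β κ = 0)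
    (hc : c M = 0) : ∑ κ ∈ Finset.range M, (α κ * c κ + β κ * c (κ + 1)) = 0 := by
  have : ∀ κ ∈ Finset.range M, α κ * c κ + β κ * c (κ + 1) = α κ * c κ - α (κ + 1) * c (κ + 1) := by
    intro κ _
    linear_combination c (κ + 1) * h κ
  rw [Finset.sum_congr rfl this, Finset.sum_range_sub' fun κ => α κ * c κ, h0, hc]
  simp

/-- The composition of the matrix elements `C` with values in `M_{Λ₂}^* ⊗ M_{Λ₁}^*` with the
transpose of `Ř_{Λ₁,Λ₂}`. -/
def rContract (η L₁ L₂ : ℂ) (C : ℤ → ℤ → ℤ → ℂ) (k b₁ b₂ : ℤ) : ℂ :=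
  ∑ κ ∈ Finset.range (b₂ + 1).toNat, rCoef η L₂ L₁ b₂ b₁ κ * C k (b₂ - κ) (b₁ + κ)

/-- For κ > b₂ the array is evaluated at a negative index and vanishes, so one range M can serve all
terms of a recursion, whose values of b₂ differ. -/
theorem rContract_eq_sum {η L₁ L₂ : ℂ} {N : ℕ} {lam : ℂ} {C : ℤ → ℤ → ℤ → ℂ}
    (h : PairRel η L₂ L₁ N lam C) (k b₁ b₂ : ℤ) {M : ℕ} (hM : b₂ < M) :
    rContract η L₁ L₂ C k b₁ b₂ =
      ∑ κ ∈ Finset.range M, rCoef η L₂ L₁ b₂ b₁ κ * C k (b₂ - κ) (b₁ + κ) := by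
  refine Finset.sum_subset (fun κ hκ => ?_) fun κ _ hκ => ?_
  · rw [Finset.mem_range] at hκ ⊢; omega
  · rw [Finset.mem_range] at hκ
    rw [h.eq_zero _ _ _ (by omega), mul_zero]

/-- The R-matrix composed with the flip commutes with the quantum group, so contracting with its
transpose sends an intertwining operator to an intertwining operator with the two dual factors
interchanged. -/
theorem PairRel.rContract {η : ℂ} (hη : 0 < η.im) {L₁ L₂ : ℂ} {N : ℕ} {lam : ℂ}
    {C : ℤ → ℤ → ℤ → ℂ} (h : PairRel η L₂ L₁ N lam C) :
    PairRel η L₁ L₂ N lam (rContract η L₁ L₂ C) where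
  eq_zero k b₁ b₂ hk := by
    refine Finset.sum_eq_zero fun κ hκ => ?_
    by_cases hC : k < 0 ∨ b₂ - κ < 0 ∨ b₁ + κ < 0 ∨ k + N - (b₂ - κ) - (b₁ + κ) < 0
    · rw [h.eq_zero _ _ _ hC, mul_zero]
    · have h1 : 0 ≤ -b₁ - 1 := by
        rw [Finset.mem_range] at hκ; omega
      obtain ⟨s, hs⟩ := Int.eq_ofNat_of_zero_le h1
      -- Here b₁ < 0 ≤ b₁ + κ, so the product [b₁ + 1]_κ passes through [0].
      have : qpoch η ((b₁ : ℂ) + 1) κ = 0 := by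
        refine Finset.prod_eq_zero (i := s) (Finset.mem_range.mpr (by omega)) ?_
        have : (b₁ : ℂ) + 1 + s = 0 := by
          have : (-b₁ - 1 : ℂ) = s := by exact_mod_cast hs
          rw [← this]; ring
        rw [this, qnum_zero]
      rw [rCoef, this]; simp
  F k b₁ b₂ := by
    obtain ⟨M, hM⟩ : ∃ M : ℕ, b₂ < M := ⟨(b₂ + 1).toNat, by omega⟩
    rw [rContract_eq_sum h _ _ _ hM, rContract_eq_sum h _ _ _ hM, rContract_eq_sum h _ _ _ hM,
      rContract_eq_sum h _ _ (b₂ - 1) (M := M) (by omega)]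
    -- The terms are grouped by the entry of C that they contain. The term of index κ involves the
    -- entries numbered κ and κ + 1, and regrouping by entry leaves the R-matrix identities
    -- `rCoef_F_zero` and `rCoef_F_succ`.
    have key := sum_shift_eq_zero
      (fun κ => qpow η (-(L₂ - 2 * b₂)) * qnum η (L₁ - b₁ + 1) * rCoef η L₂ L₁ b₂ (b₁ - 1) κ -
        rCoef η L₂ L₁ b₂ b₁ κ * qnum η (L₁ - (b₁ + κ) + 1))
      (fun κ => qnum η (L₂ - b₂ + 1) * rCoef η L₂ L₁ (b₂ - 1) b₁ κ -
        rCoef η L₂ L₁ b₂ b₁ κ * (qpow η (-(L₁ - 2 * (b₁ + κ))) * qnum η (L₂ - (b₂ - κ) + 1)))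
      (fun κ => C k (b₂ - κ) (b₁ - 1 + κ)) M
      (by
        have := rCoef_F_zero (η := η) L₁ L₂ b₁ b₂
        simp only [Nat.cast_zero, add_zero]
        rw [this, sub_self])
      (fun κ => by
        have := rCoef_F_succ hη L₁ L₂ b₁ b₂ κ
        push_cast
        rw [show L₁ - ((b₁ : ℂ) + (κ + 1)) + 1 = L₁ - (b₁ + κ) by ring]
        linear_combination this)
      (h.eq_zero _ _ _ (by omega))
    rw [← sub_eq_zero, ← neg_eq_zero, ← key]
    simp only [Finset.mul_sum, ← Finset.sum_add_distrib, ← Finset.sum_sub_distrib,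
      ← Finset.sum_neg_distrib]
    refine Finset.sum_congr rfl fun κ _ => ?_
    have hF := h.F k (b₂ - κ) (b₁ + κ)
    push_cast at hF ⊢
    rw [show b₂ - ((κ : ℤ) + 1) = b₂ - κ - 1 by ring, show b₁ - 1 + ((κ : ℤ) + 1) = b₁ + κ by ring,
      show b₁ - 1 + (κ : ℤ) = b₁ + κ - 1 by ring, show b₂ - 1 - (κ : ℤ) = b₂ - κ - 1 by ring]
    rw [show L₂ - 2 * ((b₂ : ℂ) - κ) + (L₁ - 2 * (b₁ + κ)) = L₁ - 2 * b₁ + (L₂ - 2 * b₂) by ring,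
      show (k : ℂ) + 1 + N - (b₂ - κ) - (b₁ + κ) = k + 1 + N - b₁ - b₂ by ring] at hF
    linear_combination (-rCoef η L₂ L₁ b₂ b₁ κ) * hF
  E k b₁ b₂ hl := by
    -- The E-relation also involves b₂ + 1, so the common range must exceed that.
    obtain ⟨M, hM⟩ : ∃ M : ℕ, b₂ + 1 < M := ⟨(b₂ + 2).toNat, by omega⟩
    rw [rContract_eq_sum h _ _ b₂ (M := M) (by omega), rContract_eq_sum h _ _ b₂ (M := M) (by omega),
      rContract_eq_sum h _ _ b₂ (M := M) (by omega), rContract_eq_sum h _ _ _ hM]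
    have key := sum_shift_eq_zero
      (fun κ => qpow η (L₁ - 2 * b₁) * qnum η (b₂ + 1) * rCoef η L₂ L₁ (b₂ + 1) b₁ κ -
        rCoef η L₂ L₁ b₂ b₁ κ * qnum η (b₂ - κ + 1))
      (fun κ => qnum η (b₁ + 1) * rCoef η L₂ L₁ b₂ (b₁ + 1) κ -
        rCoef η L₂ L₁ b₂ b₁ κ * (qpow η (L₂ - 2 * (b₂ - κ)) * qnum η (b₁ + κ + 1)))
      (fun κ => C k (b₂ + 1 - κ) (b₁ + κ)) M
      (by
        have := rCoef_E_zero (η := η) L₁ L₂ b₁ b₂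
        simp only [Nat.cast_zero, sub_zero]
        rw [this, sub_self])
      (fun κ => by
        have := rCoef_E_succ hη L₁ L₂ b₁ b₂ κ
        push_cast
        rw [show (b₂ : ℂ) - (κ + 1) + 1 = b₂ - κ by ring]
        linear_combination this)
      (h.eq_zero _ _ _ (by omega))
    have key' := congrArg
      (fun z => qpow η (lam - L₁ - L₂ + 2 * N - 1 - 2 * (k - 1 + N - b₁ - b₂)) * z) key
    simp only [mul_zero] at key'
    rw [← sub_eq_zero, ← neg_eq_zero, ← key']
    simp only [Finset.mul_sum, ← Finset.sum_add_distrib, ← Finset.sum_sub_distrib,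
      ← Finset.sum_neg_distrib]
    refine Finset.sum_congr rfl fun κ _ => ?_
    have hE := h.E k (b₂ - κ) (b₁ + κ) (by omega)
    push_cast at hE ⊢
    rw [show b₂ + 1 - ((κ : ℤ) + 1) = b₂ - κ by ring, show b₁ + 1 + (κ : ℤ) = b₁ + (κ + 1) by ring,
      show b₂ + 1 - (κ : ℤ) = b₂ - κ + 1 by ring]
    rw [show (k : ℂ) - 1 + N - (b₂ - κ) - (b₁ + κ) = k - 1 + N - b₁ - b₂ by ring,
      show lam - L₂ - L₁ = lam - L₁ - L₂ by ring,
      show b₁ + (κ : ℤ) + 1 = b₁ + (κ + 1) by ring] at hE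
    linear_combination (-rCoef η L₂ L₁ b₂ b₁ κ) * hE

/-! ### Matrix elements of the quantum R-matrix -/

theorem vermaE_pow_single (η L : ℂ) (m k : ℕ) :
    ((vermaE η L) ^ k) (Finsupp.single m 1) =
      if k ≤ m then qpoch η (L - m + 1) k • Finsupp.single (m - k) 1 else 0 := by
  induction k with
  | zero => simp [qpoch_zero]
  | succ k ih =>
    rw [pow_succ', Module.End.mul_apply, ih]
    split_ifs with h1 h2 h2
    · obtain ⟨d, rfl⟩ : ∃ d, m = d + k + 1 := ⟨m - k - 1, by omega⟩
      rw [show d + k + 1 - k = d + 1 by omega, show d + k + 1 - (k + 1) = d by omega, map_smul,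
        vermaE, Finsupp.linearCombination_single, one_smul, qpoch_succ]
      simp only [Finsupp.smul_single, smul_eq_mul, mul_one]
      congr 2
      push_cast; ring_nf
    · rw [show m - k = 0 by omega, map_smul, vermaE, Finsupp.linearCombination_single]
      simp
    · omega
    · simp

theorem vermaF_pow_single (η : ℂ) (m k : ℕ) :
    ((vermaF η) ^ k) (Finsupp.single m 1) = qpoch η (m + 1) k • Finsupp.single (m + k) 1 := by
  induction k with
  | zero => simp [qpoch_zero]
  | succ k ih =>
    rw [pow_succ', Module.End.mul_apply, ih, map_smul, vermaF, Finsupp.linearCombination_single,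
      one_smul, qpoch_succ]
    simp only [Finsupp.smul_single, smul_eq_mul, mul_one]
    rw [← add_assoc m k 1, show (((m + k : ℕ) : ℂ) + 1) = m + 1 + k by push_cast; ring]

theorem quantumR_eq (η La Lb z : ℂ) (m₁ m₂ n₁ n₂ : ℕ) :
    quantumR η La Lb z m₁ m₂ n₁ n₂ =
      if n₁ ≤ m₁ ∧ n₁ + n₂ = m₁ + m₂ then rCoef η La Lb m₁ m₂ (m₁ - n₁) else 0 := by
  rw [quantumR]
  simp only [vermaE_pow_single, vermaF_pow_single]
  have hz : ∀ k : ℕ, ¬ (k ≤ m₁ ∧ n₁ = m₁ - k ∧ n₂ = m₂ + k) →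
      ((if k ≤ m₁ then qpoch η (La - m₁ + 1) k • Finsupp.single (m₁ - k) (1 : ℂ) else 0) n₁ *
        (qpoch η (m₂ + 1) k • Finsupp.single (m₂ + k) (1 : ℂ)) n₂) = 0 := by
    intro k hk
    by_cases h1 : k ≤ m₁
    · by_cases h2 : n₁ = m₁ - k
      · have h3 : m₂ + k ≠ n₂ := fun h => hk ⟨h1, h2, h.symm⟩
        simp [h3]
      · rw [if_pos h1]
        have : m₁ - k ≠ n₁ := fun h => h2 h.symm
        simp [this]
    · simp [h1]
  split_ifs with h
  · rw [Finset.sum_eq_single (m₁ - n₁)]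
    · rw [if_pos (by omega), show m₁ - (m₁ - n₁) = n₁ by omega, show m₂ + (m₁ - n₁) = n₂ by omega]
      simp only [Finsupp.smul_apply, Finsupp.single_eq_same, smul_eq_mul, mul_one]
      rw [rCoef]
      have : qpow η (-((m₁ : ℤ) * Lb) - (m₂ : ℤ) * La + 2 * (m₁ : ℤ) * (m₂ : ℤ)) =
          qpow η (-(La * Lb / 2)) * qpow η ((La - 2 * m₁) * (Lb - 2 * m₂) / 2) := by
        rw [← qpow_add]; push_cast; ring_nf
      rw [this]
      push_cast
      ring
    · intro k hk hne
      rw [hz k (by omega), mul_zero]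
    · intro hk
      exact absurd (Finset.mem_range.mpr (by omega)) hk
  · rw [Finset.sum_eq_zero, mul_zero, zero_mul]
    intro k hk
    rw [hz k (by omega), mul_zero]

theorem sum_quantumR (η La Lb z : ℂ) (b₁ b₂ : ℕ) (f : ℤ → ℤ → ℂ) :
    ∑ c ∈ Finset.HasAntidiagonal.antidiagonal (b₁ + b₂),
      f c.1 c.2 * quantumR η La Lb z b₂ b₁ c.1 c.2 =
    ∑ κ ∈ Finset.range (b₂ + 1), rCoef η La Lb b₂ b₁ κ * f (b₂ - κ) (b₁ + κ) := by
  symm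
  refine Finset.sum_of_injOn (fun κ => (b₂ - κ, b₁ + κ)) ?_ ?_ ?_ ?_
  · intro x _ y _ h
    simp only [Prod.mk.injEq] at h
    omega
  · intro κ hκ
    have := Finset.mem_range.mp hκ
    simp only [Finset.mem_coe, Finset.HasAntidiagonal.mem_antidiagonal]
    omega
  · intro c hc hc'
    rw [quantumR_eq, if_neg, mul_zero]
    intro h
    refine hc' ⟨b₂ - c.1, Finset.mem_coe.mpr (Finset.mem_range.mpr (by omega)), ?_⟩
    ext
    · simp; omega
    · simp; omega
  · intro κ hκ
    have := Finset.mem_range.mp hκ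
    rw [quantumR_eq, if_pos (by omega), show b₂ - (b₂ - κ) = κ by omega, mul_comm]
    push_cast [Nat.cast_sub (show κ ≤ b₂ by omega)]
    rfl

theorem sum_quantumR_eq_rContract (η L₁ L₂ z : ℂ) (C : ℤ → ℤ → ℤ → ℂ) (k : ℤ) (b₁ b₂ : ℕ) :
    ∑ c ∈ Finset.HasAntidiagonal.antidiagonal (b₁ + b₂),
      C k c.1 c.2 * quantumR η L₂ L₁ z b₂ b₁ c.1 c.2 = rContract η L₁ L₂ C k b₁ b₂ := by
  rw [sum_quantumR η L₂ L₁ z b₁ b₂ (C k), rContract]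
  congr 1

/-! ### The exchange relation -/

theorem qfact_add (η : ℂ) (a b : ℕ) : qfact η (a + b) = qfact η a * qpoch η (a + 1) b := by
  rw [qfact, qfact, qpoch, Finset.prod_range_add]
  congr 1
  refine Finset.prod_congr rfl fun s _ => ?_
  push_cast; ring_nf

theorem qpoch_neg_reflect (η x : ℂ) (k : ℕ) :
    qpoch η (-x) k = (-1) ^ k * qpoch η (x - k + 1) k := by
  induction k generalizing x with
  | zero => simp [qpoch_zero]
  | succ k ih =>
    rw [qpoch_succ', qnum_neg, show -x + 1 = -(x - 1) by ring, ih, qpoch_succ, pow_succ]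
    push_cast
    rw [show x - 1 - (k : ℂ) + 1 = x - (k + 1) + 1 by ring, show x - ((k : ℂ) + 1) + 1 + k = x by ring]
    ring

/-- To end in v^{(0)}, the operator applied first sends v^{(0)} to v^{(i)} ⊗ u_{b₂}, which is a
coefficient of its singular vector, and the other contributes its leading coefficient at k = i. -/
theorem pairCoef_leading {η : ℂ} (hη : 0 < η.im) (L₁ L₂ : ℂ) (m₁ i b₂ : ℕ) (lam : ℂ) :
    pairCoef η L₁ L₂ m₁ (b₂ + i) lam 0 (m₁ + i : ℕ) b₂ =
      singCoef η L₂ (b₂ + i) lam i *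
        (qpoch η (-(lam - L₁ - L₂ + 2 * (m₁ + (b₂ + i) : ℕ)) + 1) m₁ * dfall η (L₁ - m₁) i) := by
  rw [pairCoef]
  have h1 := tcoef_zero_left hη L₂ (b₂ + i) lam (i := i) (by omega)
  have h2 := tcoef_leading hη L₁ m₁ (lam - L₂ + 2 * (b₂ + i : ℕ)) i
  rw [show ((b₂ + i : ℕ) : ℤ) - i = b₂ by push_cast; ring] at h1
  rw [show (0 : ℤ) + (b₂ + i : ℕ) - b₂ = i by push_cast; ring,
    show ((m₁ + i : ℕ) : ℤ) = i + m₁ by push_cast; ring, h1, h2]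
  congr 3
  push_cast; ring

/-- Triangularity of the leading matrix: starting from the highest weight vector, the dual index can
only decrease from m₂. -/
theorem pairCoef_leading_eq_zero {η : ℂ} (L₁ L₂ : ℂ) {m₁ m₂ : ℕ} {b₁ b₂ : ℤ} (lam : ℂ)
    (h : m₂ < b₂) : pairCoef η L₁ L₂ m₁ m₂ lam 0 b₁ b₂ = 0 := by
  rw [pairCoef, tcoef_of_neg_out _ _ _ _ (by omega), zero_mul]

/-- Converts the q-numbers in the quantum R-matrix into the factors X - q^{2s} of
`pow_eq_sum_shifted`. -/
theorem shifted_qpoch {η : ℂ} (hη : 0 < η.im) (w : ℂ) (κ : ℕ) :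
    qpow η (κ * (κ - 1) / 2) * (qpow η 1 - qpow η (-1)) ^ κ * qpoch η (-(w + κ) + 1) κ =
      qpow η (κ * w) * ∏ s ∈ Finset.range κ, (qpow η (-(2 * w)) - qpow η (2 * s)) := by
  induction κ with
  | zero => simp [qpow_zero, qpoch_zero]
  | succ κ ih =>
    have h1 : qpow η ((κ + 1 : ℕ) * ((κ + 1 : ℕ) - 1) / 2) = qpow η (κ * (κ - 1) / 2) * qpow η κ := by
      rw [← qpow_add]; push_cast; ring_nf
    have h2 := qnum_mul_qden hη (-(w + κ))
    have h3 : qpow η κ * qpow η (-(w + κ)) = qpow η w * qpow η (-(2 * w)) := by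
      rw [← qpow_add, ← qpow_add]; ring_nf
    have h4 : qpow η κ * qpow η (-(-(w + κ))) = qpow η w * qpow η (2 * κ) := by
      rw [← qpow_add, ← qpow_add]; ring_nf
    have h5 : qpow η ((κ + 1 : ℕ) * w) = qpow η (κ * w) * qpow η w := by
      rw [← qpow_add]; push_cast; ring_nf
    rw [h1, h5, qpoch_succ', Finset.prod_range_succ, pow_succ]
    push_cast
    rw [show -(w + ((κ : ℂ) + 1)) + 1 = -(w + κ) by ring]
    linear_combination qpow η w * (qpow η (-(2 * w)) - qpow η (2 * κ)) * ih +
      qpow η (κ * (κ - 1) / 2) * (qpow η 1 - qpow η (-1)) ^ κ * qpoch η (-(w + κ) + 1) κ *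
        (qpow η κ * h2 + h3 - h4)

/-- The sum over the index of the quantum R-matrix arising in its composition with the leading
coefficients of a product of operators. -/
theorem sum_shifted_qpoch {η : ℂ} (hη : 0 < η.im) (μ : ℂ) (r : ℕ) :
    ∑ p ∈ Finset.HasAntidiagonal.antidiagonal r,
      qpow η (p.2 * (p.2 - 1) / 2) * (qpow η 1 - qpow η (-1)) ^ p.2 / qfact η p.2 *
        qpoch η (-μ + p.1 + 1) p.2 * (qpow η (p.1 * (μ - p.1)) / qfact η p.1) =
      qpow η (-(r * (μ - r))) / qfact η r := by
  -- X is chosen so that the factors X - q^{2s} become the q-shifted factorial of `shifted_qpoch`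
  -- with w = μ - r.
  have h := pow_eq_sum_shifted hη (qpow η (-(2 * (μ - r)))) r
  rw [← qpow_natCast_mul] at h
  have h0 : qpow η (-(r * (μ - r))) = qpow η (r * (μ - r)) * qpow η (r * -(2 * (μ - r))) := by
    rw [← qpow_add]; ring_nf
  rw [h0, mul_div_assoc, h, Finset.mul_sum]
  refine Finset.sum_congr rfl fun p hp => ?_
  obtain ⟨i, κ⟩ := p
  have hr : (r : ℂ) = i + κ := by
    exact_mod_cast (Finset.HasAntidiagonal.mem_antidiagonal.mp hp).symm
  have hs := shifted_qpoch hη (μ - r) κ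
  simp only
  rw [show -(μ - (r : ℂ) + κ) + 1 = -μ + i + 1 by rw [hr]; ring] at hs
  have e : qpow η (i * (μ - i)) * qpow η (κ * (μ - r)) = qpow η (r * (μ - r)) * qpow η (i * κ) := by
    rw [← qpow_add, ← qpow_add, hr]; ring_nf
  generalize qpow η (κ * (κ - 1) / 2) * (qpow η 1 - qpow η (-1)) ^ κ = u at *
  have := qfact_ne_zero hη i
  have := qfact_ne_zero hη κ
  generalize qpow η (i * (μ - i)) = u₁, qpow η (κ * (μ - r)) = u₂, qpow η (r * (μ - r)) = u₃,
    qpow η (i * κ) = u₄, qpoch η (-μ + i + 1) κ = u₅ at *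
  generalize ∏ s ∈ Finset.range κ, (qpow η (-(2 * (μ - r))) - qpow η (2 * s)) = u₆ at *
  field_simp
  linear_combination u₁ * hs + u₆ * e

theorem qfact_mul_dfall {η : ℂ} (hη : 0 < η.im) (x : ℂ) (i : ℕ) :
    qfact η i * dfall η x i = ∏ t ∈ Finset.range i, qnum η (x - t) := by
  rw [dfall_natCast, mul_div_cancel₀ _ (qfact_ne_zero hη i)]

theorem prod_Ioc_mul_prod_range (f : ℕ → ℂ) (b i p : ℕ) (h : b + i ≤ p) :
    (∏ s ∈ Finset.Ioc (b + i) p, f s) * ∏ t ∈ Finset.range i, f (b + i - t) =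
      ∏ s ∈ Finset.Ioc b p, f s := by
  have : ∏ t ∈ Finset.range i, f (b + i - t) = ∏ s ∈ Finset.Ioc b (b + i), f s := by
    clear h
    induction i with
    | zero => simp
    | succ i ih =>
      rw [Finset.prod_range_succ', ← add_assoc, Finset.prod_Ioc_succ_top (by omega), ← ih]
      congr 1
      refine Finset.prod_congr rfl fun t _ => ?_
      congr 1; omega
  rw [this, mul_comm, Finset.prod_Ioc_consecutive f (by omega) h]

theorem qpoch_mul_prod_range (η L : ℂ) (n i κ : ℕ) :
    qpoch η (L - (n + i + κ : ℕ) + 1) κ * ∏ t ∈ Finset.range i, qnum η (L - n - t) =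
      ∏ s ∈ Finset.Ico n (n + i + κ), qnum η (L - s) := by
  rw [Finset.prod_Ico_eq_prod_range, show n + i + κ - n = i + κ by omega, Finset.prod_range_add,
    mul_comm, qpoch]
  congr 1
  · refine Finset.prod_congr rfl fun t _ => ?_
    push_cast; ring_nf
  · rw [← Finset.prod_range_reflect]
    refine Finset.prod_congr rfl fun t ht => ?_
    have := Finset.mem_range.mp ht
    congr 1
    rw [show κ - 1 - t = κ - (t + 1) by omega, Nat.cast_sub (by omega)]
    push_cast; ring

/-- The first triangular factor of the dynamical R-matrix. -/
def upperTerm (η La Lb lam : ℂ) (N n₁ n₂ p : ℕ) : ℂ :=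
  (qpow η (-((p - n₁ : ℕ) * (lam - Lb + 2 * n₂ - (p - n₁ : ℕ)))) *
    qpoch η (-(lam - Lb + 2 * n₂) + (p - n₁ : ℕ) + 1) (N - p) / qfact η (p - n₁)) *
  (qfact η n₂ / qfact η (N - p) * ∏ s ∈ Finset.Ico n₁ p, qnum η (La - s)) *
  qpow η (-(p * Lb) - (N - p : ℕ) * La + 2 * p * (N - p : ℕ))

/-- The second triangular factor of the dynamical R-matrix. -/
def lowerTerm (η La Lb lam : ℂ) (N m₁ p : ℕ) : ℂ :=
  (qfact η p / qfact η m₁ * ∏ s ∈ Finset.Ioc m₁ p, qnum η (Lb - N + s)) *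
  (qpow η ((p - m₁ : ℕ) * (lam - La + p + m₁)) * qnum η (lam - La + 2 * m₁) /
    (qfact η (p - m₁) * qpoch η (lam - La + m₁) (p + 1)))

/-- Running p over the full range, with an indicator, allows the sums over p and over the incoming
index to be interchanged. -/
theorem dynamicalR_eq (η La Lb lam : ℂ) {m₁ m₂ n₁ n₂ N : ℕ} (hm : m₁ + m₂ = N) (hn : n₁ + n₂ = N) :
    dynamicalR η La Lb lam m₁ m₂ n₁ n₂ = ∑ p ∈ Finset.range (N + 1), if m₁ ≤ p ∧ n₁ ≤ p then
      (-1) ^ m₁ * (qpoch η (-(lam - La - Lb + 2 * N) + 1) n₁ /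
        qpoch η (-(lam - La - Lb + 2 * N) + 1) m₂) * upperTerm η La Lb lam N n₁ n₂ p *
        lowerTerm η La Lb lam N m₁ p else 0 := by
  subst hm
  rw [dynamicalR, if_pos hn.symm, ← Finset.sum_filter]
  refine Finset.sum_congr ?_ fun p _ => ?_
  · ext p
    simp only [Finset.mem_Icc, Finset.mem_filter, Finset.mem_range, max_le_iff]
    omega
  · rw [upperTerm, lowerTerm]; ring

/-- Separates the product into a factor independent of i and the i-th term of the very-well-poised
sum with Y = λ - Λ_a + 2b. -/
theorem lowerTerm_mul_leading {η : ℂ} (hη : 0 < η.im) (La Lb lam : ℂ) {N b i M : ℕ} (hi : i ≤ M)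
    (hN : b + M ≤ N) (h0 : ∀ s ≤ 2 * N, qnum η (lam - La + s) ≠ 0) :
    (-1) ^ (b + i) * lowerTerm η La Lb lam N (b + i) (b + M) *
      (singCoef η La (b + i) lam i * dfall η (Lb - (N - (b + i) : ℕ)) i) =
    qpow η (M * (lam - La + 2 * b + M)) * (qfact η (b + M) / qfact η b *
      ∏ s ∈ Finset.Ioc b (b + M), qnum η (Lb - N + s)) *
      ((-1) ^ i * qnum η (lam - La + 2 * b + 2 * i) /
        (qfact η i * qfact η (M - i) * qpoch η (lam - La + 2 * b + i) (M + 1))) := by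
  have f1 := qfact_ne_zero hη b
  have f2 := qfact_ne_zero hη (b + i)
  have f3 := qfact_ne_zero hη i
  have f4 := qfact_ne_zero hη (M - i)
  have p1 : qpoch η (lam - La + (b + i : ℕ)) b ≠ 0 := by
    refine Finset.prod_ne_zero_iff.mpr fun s hs => ?_
    have := h0 (b + i + s) (by have := Finset.mem_range.mp hs; omega)
    push_cast at this ⊢
    rwa [add_assoc]
  have p2 : qpoch η (lam - La + 2 * b + i) (M + 1) ≠ 0 := by
    refine Finset.prod_ne_zero_iff.mpr fun s hs => ?_
    have := h0 (2 * b + i + s) (by have := Finset.mem_range.mp hs; omega)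
    push_cast at this ⊢
    rwa [show lam - La + 2 * (b : ℂ) + i + s = lam - La + (2 * b + i + s) by ring]
  have s1 : singCoef η La (b + i) lam i = qpow η (i * (lam - La + 2 * b + i)) *
      ((-1) ^ b * qpoch η (lam - La + (b + i : ℕ)) b) * (qfact η (b + i) / qfact η b) := by
    have := qpoch_neg_reflect η (lam - La + 2 * b + i - 1) b
    rw [singCoef, show b + i - i = b by omega]
    push_cast
    rw [show -lam + La - 2 * ((b : ℂ) + i) + i + 1 = -(lam - La + 2 * b + i - 1) by ring, this,
      show lam - La + 2 * ((b : ℂ) + i) - i = lam - La + 2 * b + i by ring,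
      show lam - La + 2 * (b : ℂ) + i - 1 - b + 1 = lam - La + (b + i) by ring]
  have s2 : qpoch η (lam - La + (b + i : ℕ)) (b + M + 1) =
      qpoch η (lam - La + (b + i : ℕ)) b * qpoch η (lam - La + 2 * b + i) (M + 1) := by
    rw [add_assoc, qpoch_add]
    congr 2
    push_cast; ring
  have s3 := prod_Ioc_mul_prod_range (fun s => qnum η (Lb - N + s)) b i (b + M) (by omega)
  have s4 := qfact_mul_dfall hη (Lb - (N - (b + i) : ℕ)) i
  have s5 : ∏ t ∈ Finset.range i, qnum η (Lb - (N - (b + i) : ℕ) - t) =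
      ∏ t ∈ Finset.range i, qnum η (Lb - N + (b + i - t : ℕ)) := by
    refine Finset.prod_congr rfl fun t ht => ?_
    have := Finset.mem_range.mp ht
    rw [Nat.cast_sub (by omega), Nat.cast_sub (by omega)]
    ring_nf
  have e : qpow η ((M - i : ℕ) * (lam - La + (b + M : ℕ) + (b + i : ℕ))) *
      qpow η (i * (lam - La + 2 * b + i)) = qpow η (M * (lam - La + 2 * b + M)) := by
    rw [← qpow_add, Nat.cast_sub hi]; push_cast; ring_nf
  rw [lowerTerm, s1, s2, ← s3, ← s5, ← s4, ← e, show b + M - (b + i) = M - i by omega, pow_add,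
    show lam - La + 2 * ((b + i : ℕ) : ℂ) = lam - La + 2 * b + 2 * i by push_cast; ring]
  have hb : ((-1 : ℂ)) ^ b * (-1) ^ b = 1 := by rw [← mul_pow]; simp
  generalize qpoch η (lam - La + (b + i : ℕ)) b = u₁ at *
  generalize qpoch η (lam - La + 2 * b + i) (M + 1) = u₂ at *
  generalize dfall η (Lb - (N - (b + i) : ℕ)) i = u₃ at *
  generalize ∏ s ∈ Finset.Ioc (b + i) (b + M), qnum η (Lb - N + s) = u₄ at *
  generalize qpow η ((M - i : ℕ) * (lam - La + (b + M : ℕ) + (b + i : ℕ))) = u₅ at *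
  generalize qpow η (i * (lam - La + 2 * b + i)) = u₆ at *
  generalize qnum η (lam - La + 2 * b + 2 * i) = u₇ at *
  generalize (-1 : ℂ) ^ b = u₈ at *
  field_simp
  linear_combination (qfact η (b + M) * u₄ * u₅ * u₇ * u₆ * u₃) * hb

/-- The genericity condition on `λ` under which the exchange relation holds. -/
structure Generic (η L₁ L₂ : ℂ) (N : ℕ) (lam : ℂ) : Prop where
  left : ∀ s ≤ 2 * N, qnum η (lam - L₂ + s) ≠ 0
  right : ∀ l < N, qnum η (lam - L₁ - L₂ + 2 * N - 1 - l) ≠ 0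

theorem Generic.qpoch_ne_zero {η La Lb : ℂ} {N : ℕ} {lam : ℂ} (h : Generic η Lb La N lam) {k : ℕ}
    (hk : k ≤ N) : qpoch η (-(lam - La - Lb + 2 * N) + 1) k ≠ 0 := by
  refine Finset.prod_ne_zero_iff.mpr fun s hs => ?_
  have := h.right s (by have := Finset.mem_range.mp hs; omega)
  rw [← neg_ne_zero, ← qnum_neg] at this
  rwa [show -(lam - La - Lb + 2 * (N : ℂ)) + 1 + s = -(lam - Lb - La + 2 * N - 1 - s) by ring]

/-- The lower triangular factor, with its sign and scalar, inverts the matrix of leading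
coefficients. -/
theorem lowerTerm_sum {η : ℂ} (hη : 0 < η.im) (La Lb lam : ℂ) {N b p : ℕ} (hb : b ≤ N) (hp : p ≤ N)
    (h : Generic η Lb La N lam) :
    ∑ m ∈ Finset.range (N + 1), (if m ≤ p then
      (-1) ^ m * lowerTerm η La Lb lam N m p / qpoch η (-(lam - La - Lb + 2 * N) + 1) (N - m) *
        pairCoef η Lb La (N - m) m lam 0 (N - b : ℕ) b else 0) = if p = b then 1 else 0 := by
  by_cases hbp : p < b
  · rw [if_neg (by omega)]
    refine Finset.sum_eq_zero fun m _ => ?_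
    split_ifs with hm
    · rw [pairCoef_leading_eq_zero _ _ _ (by omega), mul_zero]
    · rfl
  -- Triangularity restricts m to b + i with 0 ≤ i ≤ M, and the sum over i is the very-well-poised
  -- one, equal to zero unless M = 0.
  obtain ⟨M, rfl⟩ : ∃ M, p = b + M := ⟨p - b, by omega⟩
  have hs := very_well_poised_sum hη (lam - La + 2 * b) M (fun s hs => by
    have := h.left (2 * b + s) (by have := Finset.mem_range.mp hs; omega)
    push_cast at this
    rwa [show lam - La + 2 * (b : ℂ) + s = lam - La + (2 * b + s) by ring])
  have hs' := congrArg (fun z => qpow η (M * (lam - La + 2 * b + M)) * (qfact η (b + M) / qfact η b *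
      ∏ s ∈ Finset.Ioc b (b + M), qnum η (Lb - N + s)) * z) hs
  simp only [Finset.mul_sum] at hs'
  have hr : qpow η (M * (lam - La + 2 * b + M)) * (qfact η (b + M) / qfact η b *
      ∏ s ∈ Finset.Ioc b (b + M), qnum η (Lb - N + s)) * (if M = 0 then 1 else 0) =
      if b + M = b then 1 else 0 := by
    split_ifs with h1 h2 h2
    · subst h1; simp [qpow_zero, div_self (qfact_ne_zero hη b)]
    · omega
    · omega
    · rw [mul_zero]
  rw [hr] at hs'
  rw [← hs']
  symm
  refine Finset.sum_of_injOn (fun i => b + i) ?_ ?_ ?_ ?_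
  · intro x _ y _ hxy
    simpa using hxy
  · intro i hi
    have := Finset.mem_range.mp hi
    exact Finset.mem_coe.mpr (Finset.mem_range.mpr (show b + i < N + 1 by omega))
  · intro m _ hm
    split_ifs with hmp
    · have : m < b := by
        by_contra hmb
        exact hm ⟨m - b, Finset.mem_coe.mpr (Finset.mem_range.mpr (by omega)), by simp; omega⟩
      rw [pairCoef_leading_eq_zero _ _ _ (by omega), mul_zero]
    · rfl
  · intro i hi
    have hi' := Finset.mem_range.mp hi
    rw [if_pos (by omega), ← lowerTerm_mul_leading hη La Lb lam (by omega) hp h.left]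
    have hl := pairCoef_leading hη Lb La (N - (b + i)) i b lam
    rw [show N - (b + i) + i = N - b by omega, show N - (b + i) + (b + i) = N by omega] at hl
    have hq := h.qpoch_ne_zero (k := N - (b + i)) (by omega)
    rw [show lam - Lb - La + 2 * (N : ℂ) = lam - La - Lb + 2 * N by ring] at hl
    rw [hl]
    field_simp

/-- Interchanging the sums, the lower factor cancels against the leading matrix and only p = b
survives, leaving the upper factor. -/
theorem dynamicalR_leading {η : ℂ} (hη : 0 < η.im) (La Lb lam : ℂ) {N n₁ n₂ b : ℕ} (hb : b ≤ N)
    (hn : n₁ + n₂ = N) (h : Generic η Lb La N lam) :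
    ∑ a ∈ Finset.HasAntidiagonal.antidiagonal N, dynamicalR η La Lb lam a.2 a.1 n₁ n₂ *
      pairCoef η Lb La a.1 a.2 lam 0 (N - b : ℕ) b =
    if n₁ ≤ b then qpoch η (-(lam - La - Lb + 2 * N) + 1) n₁ * upperTerm η La Lb lam N n₁ n₂ b
      else 0 := by
  rw [← Finset.Nat.sum_antidiagonal_swap, Finset.Nat.sum_antidiagonal_eq_sum_range_succ_mk]
  have h1 : ∀ m ∈ Finset.range (N + 1), dynamicalR η La Lb lam m (N - m) n₁ n₂ *
      pairCoef η Lb La (N - m) m lam 0 (N - b : ℕ) b =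
      ∑ p ∈ Finset.range (N + 1), (if n₁ ≤ p then
        qpoch η (-(lam - La - Lb + 2 * N) + 1) n₁ * upperTerm η La Lb lam N n₁ n₂ p else 0) *
        (if m ≤ p then (-1) ^ m * lowerTerm η La Lb lam N m p /
          qpoch η (-(lam - La - Lb + 2 * N) + 1) (N - m) *
          pairCoef η Lb La (N - m) m lam 0 (N - b : ℕ) b else 0) := by
    intro m hm
    have := Finset.mem_range.mp hm
    rw [dynamicalR_eq η La Lb lam (show m + (N - m) = N by omega) hn, Finset.sum_mul]
    refine Finset.sum_congr rfl fun p _ => ?_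
    by_cases c1 : m ≤ p <;> by_cases c2 : n₁ ≤ p <;> simp only [c1, c2, if_true, if_false, and_self,
      and_false, false_and, zero_mul, mul_zero]
    ring
  simp only [Prod.swap_prod_mk]
  rw [Finset.sum_congr rfl h1, Finset.sum_comm, Finset.sum_eq_single b]
  · rw [← Finset.mul_sum, lowerTerm_sum hη La Lb lam hb hb h, if_pos rfl, mul_one]
  · intro p hp hpb
    rw [← Finset.mul_sum, lowerTerm_sum hη La Lb lam hb
      (show p ≤ N by have := Finset.mem_range.mp hp; omega) h, if_neg hpb, mul_zero]
  · intro hb'; exact absurd (Finset.mem_range.mpr (by omega)) hb'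

/-- The other half of the exchange relation at leading order: the upper factor of the dynamical
R-matrix is the leading matrix of the reversed product contracted with the quantum R-matrix. -/
theorem rContract_leading {η : ℂ} (hη : 0 < η.im) (La Lb lam : ℂ) {N n₁ n₂ b : ℕ} (hb : b ≤ N)
    (hn : n₁ + n₂ = N) :
    rContract η Lb La (pairCoef η La Lb n₁ n₂ lam) 0 (N - b : ℕ) b =
    if n₁ ≤ b then qpoch η (-(lam - La - Lb + 2 * N) + 1) n₁ * upperTerm η La Lb lam N n₁ n₂ b
      else 0 := by
  split_ifs with hnb
  swap
  · refine Finset.sum_eq_zero fun κ _ => ?_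
    rw [pairCoef_leading_eq_zero _ _ _ (by push_cast [Nat.cast_sub hb]; omega), mul_zero]
  obtain ⟨r, rfl⟩ : ∃ r, b = n₁ + r := ⟨b - n₁, by omega⟩
  obtain ⟨T, rfl⟩ : ∃ T, n₂ = r + T := ⟨n₂ - r, by omega⟩
  subst hn
  have hs := sum_shifted_qpoch hη (lam - Lb + 2 * (r + T : ℕ)) r
  -- By triangularity only κ ≤ r contributes, and writing κ as part of a pair with sum r brings the
  -- sum to the form of `sum_shifted_qpoch`.
  have lhs : rContract η Lb La (pairCoef η La Lb n₁ (r + T) lam) 0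
      (n₁ + (r + T) - (n₁ + r) : ℕ) (n₁ + r : ℕ) =
      ∑ p ∈ Finset.HasAntidiagonal.antidiagonal r, rCoef η La Lb (n₁ + r : ℕ) (T : ℕ) p.2 *
        pairCoef η La Lb n₁ (r + T) lam 0 (n₁ + p.1 : ℕ) (T + p.2 : ℕ) := by
    rw [rContract, show n₁ + (r + T) - (n₁ + r) = T by omega]
    symm
    refine Finset.sum_of_injOn (fun p => p.2) ?_ ?_ ?_ ?_
    · intro x hx y hy hxy
      have hx' := Finset.HasAntidiagonal.mem_antidiagonal.mp hx
      have hy' := Finset.HasAntidiagonal.mem_antidiagonal.mp hy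
      simp only at hxy
      ext <;> omega
    · intro x hx
      have hx' := Finset.HasAntidiagonal.mem_antidiagonal.mp hx
      exact Finset.mem_coe.mpr (Finset.mem_range.mpr (show x.2 < _ by omega))
    · intro κ hκ hκ'
      rw [pairCoef_leading_eq_zero, mul_zero]
      by_contra hlt
      refine hκ' ⟨(r - κ, κ), Finset.mem_coe.mpr
        (Finset.HasAntidiagonal.mem_antidiagonal.mpr ?_), rfl⟩
      push_cast at hlt ⊢; omega
    · intro p hp
      have hp' := Finset.HasAntidiagonal.mem_antidiagonal.mp hp
      congr 2
      push_cast; omega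
  rw [lhs, upperTerm, show n₁ + r - n₁ = r by omega, show n₁ + (r + T) - (n₁ + r) = T by omega]
  have hr : qpoch η (-(lam - La - Lb + 2 * (n₁ + (r + T) : ℕ)) + 1) n₁ *
      (qpow η (-(r * (lam - Lb + 2 * (r + T : ℕ) - r))) *
      qpoch η (-(lam - Lb + 2 * (r + T : ℕ)) + r + 1) T / qfact η r *
      (qfact η (r + T) / qfact η T * ∏ s ∈ Finset.Ico n₁ (n₁ + r), qnum η (La - s)) *
      qpow η (-((n₁ + r : ℕ) * Lb) - T * La + 2 * (n₁ + r : ℕ) * T)) =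
      (qpoch η (-(lam - La - Lb + 2 * (n₁ + (r + T) : ℕ)) + 1) n₁ *
        (qpoch η (-(lam - Lb + 2 * (r + T : ℕ)) + r + 1) T *
      (qfact η (r + T) / qfact η T * ∏ s ∈ Finset.Ico n₁ (n₁ + r), qnum η (La - s)) *
      qpow η (-((n₁ + r : ℕ) * Lb) - T * La + 2 * (n₁ + r : ℕ) * T))) *
      (qpow η (-(r * (lam - Lb + 2 * (r + T : ℕ) - r))) / qfact η r) := by ring
  rw [hr, ← hs, Finset.mul_sum]
  clear lhs hs hr
  refine Finset.sum_congr rfl fun p hp => ?_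
  obtain ⟨i, κ⟩ := p
  obtain rfl : i + κ = r := Finset.HasAntidiagonal.mem_antidiagonal.mp hp
  have hl := pairCoef_leading hη La Lb n₁ i (T + κ) lam
  simp only
  rw [show T + κ + i = i + κ + T by ring] at hl
  rw [hl, rCoef, singCoef, show i + κ + T - i = T + κ by omega]
  have q1 : qpoch η (-lam + Lb - 2 * ((i + κ + T : ℕ) : ℂ) + i + 1) (T + κ) =
      qpoch η (-(lam - Lb + 2 * (i + κ + T : ℕ)) + i + 1) κ *
      qpoch η (-(lam - Lb + 2 * (i + κ + T : ℕ)) + (i + κ : ℕ) + 1) T := by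
    rw [add_comm T κ, qpoch_add]
    congr 2 <;> push_cast <;> ring
  have q2 := qpoch_mul_prod_range η La n₁ i κ
  have q3 := qfact_add η T κ
  have q4 := qfact_mul_dfall hη (La - n₁) i
  rw [← q4, add_assoc n₁ i κ] at q2
  rw [q1, ← q2, q3]
  have := qfact_ne_zero hη T
  have := qfact_ne_zero hη κ
  have := qfact_ne_zero hη i
  have h3 : qpoch η ((T : ℂ) + 1) κ ≠ 0 := by
    have := qfact_ne_zero hη (T + κ)
    rw [q3] at this
    exact right_ne_zero_of_mul this
  rw [show lam - Lb + 2 * ((i + κ + T : ℕ) : ℂ) - i = (lam - Lb + 2 * (i + κ + T : ℕ)) - i by ring]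
  simp only [Int.cast_natCast]
  generalize qpow η (i * (lam - Lb + 2 * (i + κ + T : ℕ) - i)) = u₁
  generalize qpoch η ((T : ℂ) + 1) κ = u₂ at *
  generalize qpoch η (-(lam - Lb + 2 * (i + κ + T : ℕ)) + i + 1) κ = u₃
  generalize qpoch η (-(lam - Lb + 2 * (i + κ + T : ℕ)) + (i + κ : ℕ) + 1) T = u₄
  generalize qpoch η (La - (n₁ + (i + κ) : ℕ) + 1) κ = u₅
  generalize dfall η (La - n₁) i = u₆
  generalize qpoch η (-(lam - La - Lb + 2 * (n₁ + (i + κ + T) : ℕ)) + 1) n₁ = u₇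
  generalize qpow η (κ * (κ - 1) / 2) = u₈
  generalize (qpow η 1 - qpow η (-1)) ^ κ = u₉
  generalize qpow η (-((n₁ + (i + κ) : ℕ) * Lb) - T * La + 2 * (n₁ + (i + κ) : ℕ) * T) = u₀
  field_simp

/-- The exchange relation between the products of two intertwining operators. -/
theorem exchange {η : ℂ} (hη : 0 < η.im) {L₁ L₂ lam : ℂ} {N n₁ n₂ : ℕ} (hn : n₁ + n₂ = N)
    (h : Generic η L₁ L₂ N lam) (k b₁ b₂ : ℤ) :
    ∑ a ∈ Finset.HasAntidiagonal.antidiagonal N, dynamicalR η L₂ L₁ lam a.2 a.1 n₁ n₂ *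
      pairCoef η L₁ L₂ a.1 a.2 lam k b₁ b₂ =
    rContract η L₁ L₂ (pairCoef η L₂ L₁ n₁ n₂ lam) k b₁ b₂ := by
  have r1 : PairRel η L₁ L₂ N lam _ := PairRel.sum (Finset.HasAntidiagonal.antidiagonal N)
    (fun a => dynamicalR η L₂ L₁ lam a.2 a.1 n₁ n₂)
    (D := fun a => pairCoef η L₁ L₂ a.1 a.2 lam) (fun a ha => by
      rw [← Finset.HasAntidiagonal.mem_antidiagonal.mp ha]
      exact pairRel_pairCoef hη L₁ L₂ a.1 a.2 lam)
  have r2 : PairRel η L₁ L₂ N lam (rContract η L₁ L₂ (pairCoef η L₂ L₁ n₁ n₂ lam)) := by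
    refine PairRel.rContract hη ?_
    rw [← hn]
    exact pairRel_pairCoef hη L₂ L₁ n₁ n₂ lam
  rw [← sub_eq_zero]
  -- Both sides are intertwining operators between the same modules, so it suffices to compare
  -- leading components.
  refine (r1.sub r2).eq_zero_of_leading hη h.right (fun b₁ b₂ hb => ?_) k b₁ b₂
  by_cases hneg : b₁ < 0 ∨ b₂ < 0
  · exact (r1.sub r2).eq_zero _ _ _ (by tauto)
  obtain ⟨b, rfl⟩ := Int.eq_ofNat_of_zero_le (show 0 ≤ b₂ by omega)
  have hb' : b₁ = ((N - b : ℕ) : ℤ) := by omega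
  rw [hb', dynamicalR_leading hη L₂ L₁ lam (by omega) hn h,
    rContract_leading hη L₂ L₁ lam (by omega) hn, sub_self]

/-! ### Fusion of intertwining operators -/

theorem Generic.singCoef_zero_ne_zero {η : ℂ} (hη : 0 < η.im) {L₁ L₂ : ℂ} {N : ℕ} {lam : ℂ}
    (h : Generic η L₁ L₂ N lam) {m : ℕ} (hm : m ≤ N) : singCoef η L₂ m lam 0 ≠ 0 := by
  rw [singCoef]
  refine mul_ne_zero (mul_ne_zero (qpow_ne_zero _ _) ?_)
    (div_ne_zero (qfact_ne_zero hη _) (qfact_ne_zero hη _))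
  refine Finset.prod_ne_zero_iff.mpr fun s hs => ?_
  have hs' := Finset.mem_range.mp hs
  have := h.left (2 * m - 1 - s) (by omega)
  rw [← neg_ne_zero, ← qnum_neg, show 2 * m - 1 - s = 2 * m - (1 + s) by omega,
    Nat.cast_sub (by omega)] at this
  push_cast at this ⊢
  rwa [show -lam + L₂ - 2 * (m : ℂ) + 0 + 1 + s = -(lam - L₂ + (2 * m - (1 + s))) by ring]

/-- For generic `λ` the products of two intertwining operators are linearly independent. -/
theorem pairCoef_linearIndependent {η : ℂ} (hη : 0 < η.im) {L₁ L₂ : ℂ} {N : ℕ} {lam : ℂ}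
    (h : Generic η L₁ L₂ N lam) (X : ℕ × ℕ → ℂ)
    (hX : ∀ b ≤ N, ∑ a ∈ Finset.HasAntidiagonal.antidiagonal N,
      X a * pairCoef η L₁ L₂ a.1 a.2 lam 0 (N - b : ℕ) b = 0) (a : ℕ × ℕ) (ha : a.1 + a.2 = N) :
    X a = 0 := by
  obtain ⟨a₁, a₂⟩ := a
  simp only at ha
  -- The leading matrix is triangular: in the equation for b = a₂, terms with larger first index
  -- vanish and those with smaller first index are zero by induction. The diagonal entry is nonzero
  -- by genericity.
  induction a₁ using Nat.strong_induction_on generalizing a₂ with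
  | _ a₁ ih =>
    have := hX a₂ (by omega)
    rw [Finset.sum_eq_single (a₁, a₂)] at this
    · have hl := pairCoef_leading hη L₁ L₂ a₁ 0 a₂ lam
      simp only [add_zero] at hl
      simp only at this
      rw [show N - a₂ = a₁ by omega, hl] at this
      refine (mul_eq_zero.mp this).resolve_right (mul_ne_zero
        (h.singCoef_zero_ne_zero hη (by omega)) (mul_ne_zero ?_ ?_))
      · have := Generic.qpoch_ne_zero h (k := a₁) (by omega)
        rwa [ha, show lam - L₁ - L₂ + 2 * (N : ℂ) = lam - L₂ - L₁ + 2 * N by ring]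
      · rw [Nat.cast_zero, dfall_zero]; exact one_ne_zero
    · rintro ⟨c₁, c₂⟩ hc hne
      have hc' : c₁ + c₂ = N := Finset.HasAntidiagonal.mem_antidiagonal.mp hc
      rcases lt_trichotomy c₁ a₁ with hlt | heq | hgt
      · rw [ih c₁ hlt c₂ hc', zero_mul]
      · exact absurd (by ext <;> simp <;> omega) hne
      · simp only
        rw [pairCoef_leading_eq_zero _ _ _ (by omega), mul_zero]
    · intro hn
      exact absurd (Finset.HasAntidiagonal.mem_antidiagonal.mpr ha) hn

theorem qfact_mul_dfall_eq_qpoch {η : ℂ} (hη : 0 < η.im) (x : ℂ) (k : ℕ) :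
    qfact η k * dfall η x k = qpoch η (x - k + 1) k := by
  rw [qfact_mul_dfall hη, ← Finset.prod_range_reflect, qpoch]
  refine Finset.prod_congr rfl fun t ht => ?_
  have := Finset.mem_range.mp ht
  rw [show k - 1 - t = k - (t + 1) by omega, Nat.cast_sub (by omega)]
  push_cast; ring_nf

/-- The relations between the matrix elements of an intertwining operator
`M_{λ-1} → M_{λ-Λ+2N-1} ⊗ M_Λ^*`. -/
structure SingleRel (η L : ℂ) (N : ℕ) (lam : ℂ) (D : ℤ → ℤ → ℂ) : Prop where
  eq_zero : ∀ k b : ℤ, k < 0 ∨ b < 0 ∨ k + N - b < 0 → D k b = 0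
  F : ∀ k b : ℤ, qnum η (k + 1) * D (k + 1) b =
    qpow η (-(L - 2 * b)) * qnum η (k + 1 + N - b) * D k b + qnum η (L - b + 1) * D k (b - 1)
  E : ∀ k b : ℤ, 0 ≤ k - 1 + N - b → qnum η (lam - k) * D (k - 1) b =
    qnum η (lam - L + 2 * N - 1 - (k - 1 + N - b)) * D k b +
    qpow η (lam - L + 2 * N - 1 - 2 * (k - 1 + N - b)) * (qnum η (b + 1) * D k (b + 1))

theorem singleRel_tcoef {η : ℂ} (hη : 0 < η.im) (L : ℂ) (m : ℕ) (lam : ℂ) :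
    SingleRel η L m lam (tcoef η L m lam) where
  eq_zero k b h := by
    rcases h with h | h | h
    · exact tcoef_of_neg_left _ _ _ _ _ h
    · exact tcoef_of_neg_right _ _ _ _ _ h
    · exact tcoef_of_neg_out _ _ _ _ h
  F k b := tcoef_F hη L m lam k b
  E k b h := tcoef_E hη L m lam k b h

theorem SingleRel.sub {η L : ℂ} {N : ℕ} {lam : ℂ} {D D' : ℤ → ℤ → ℂ}
    (h : SingleRel η L N lam D) (h' : SingleRel η L N lam D') :
    SingleRel η L N lam fun k b => D k b - D' k b where
  eq_zero k b hk := by rw [h.eq_zero k b hk, h'.eq_zero k b hk, sub_zero]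
  F k b := by linear_combination h.F k b - h'.F k b
  E k b hl := by linear_combination h.E k b hl - h'.E k b hl

/-- The argument of `PairRel.eq_zero_of_leading` with one dual factor. -/
theorem SingleRel.eq_zero_of_leading {η : ℂ} (hη : 0 < η.im) {L : ℂ} {N : ℕ} {lam : ℂ}
    {D : ℤ → ℤ → ℂ} (h : SingleRel η L N lam D)
    (hgen : ∀ l < N, qnum η (lam - L + 2 * N - 1 - l) ≠ 0) (h0 : D 0 N = 0) (k b : ℤ) :
    D k b = 0 := by
  have hz : ∀ (l : ℕ) (b : ℤ), N - b = l → D 0 b = 0 := by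
    intro l
    induction l with
    | zero =>
      intro b hb
      rwa [show b = N by push_cast at hb; omega]
    | succ l ih =>
      intro b hb
      by_cases hneg : b < 0
      · exact h.eq_zero _ _ (by tauto)
      have hE := h.E 0 b (by push_cast at hb; omega)
      rw [h.eq_zero (0 - 1) b (by omega), ih (b + 1) (by push_cast at hb; omega)] at hE
      have hl : ((0 : ℤ) : ℂ) - 1 + N - b = l := by
        have : (N : ℂ) - b = (l : ℂ) + 1 := by exact_mod_cast hb
        push_cast; linear_combination this
      rw [hl] at hE
      have := hgen l (by push_cast at hb; omega)
      simpa [this] using hE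
  rcases lt_or_ge k 0 with hk | hk
  · exact h.eq_zero _ _ (Or.inl hk)
  obtain ⟨n, rfl⟩ := Int.eq_ofNat_of_zero_le hk
  clear hk
  induction n generalizing b with
  | zero =>
    by_cases hl : N - b < 0
    · exact h.eq_zero _ _ (by right; right; push_cast; omega)
    · exact hz (N - b).toNat b (by omega)
  | succ n ih =>
    have hF := h.F n b
    rw [ih, ih] at hF
    have := qnum_natCast_succ_ne_zero hη n
    push_cast at hF ⊢
    simpa [this] using hF

/-- The composition of matrix elements with values in `M_{Λ₁}^* ⊗ M_{Λ₂}^*` with the homomorphism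
`u_a ⊗ u_b ↦ q^{b(Λ₁-a)} u_{a+b}` to `M_{Λ₁+Λ₂}^*`. -/
def mulContract (η L₁ : ℂ) (C : ℤ → ℤ → ℤ → ℂ) (k b : ℤ) : ℂ :=
  if 0 ≤ b then ∑ p ∈ Finset.HasAntidiagonal.antidiagonal b.toNat,
    qpow η (p.2 * (L₁ - p.1)) * C k p.1 p.2 else 0

theorem mulContract_natCast (η L₁ : ℂ) (C : ℤ → ℤ → ℤ → ℂ) (k : ℤ) (b : ℕ) :
    mulContract η L₁ C k b = ∑ p ∈ Finset.HasAntidiagonal.antidiagonal b,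
      qpow η (p.2 * (L₁ - p.1)) * C k p.1 p.2 := by
  simp [mulContract]

/-- The map u_a ⊗ u_b ↦ q^{b(Λ₁-a)} u_{a+b} commutes with F by the splitting of [Λ₁ + Λ₂ - a - b],
and with E by the splitting of [a + b + 1] summed in `sum_antidiagonal_qnum`. -/
theorem PairRel.mulContract {η L₁ L₂ : ℂ} {N : ℕ} {lam : ℂ}
    {C : ℤ → ℤ → ℤ → ℂ} (h : PairRel η L₁ L₂ N lam C) :
    SingleRel η (L₁ + L₂) N lam (mulContract η L₁ C) where
  eq_zero k b hk := by
    rw [QKZB.mulContract]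
    split_ifs with hb
    · refine Finset.sum_eq_zero fun p hp => ?_
      have hp' := Finset.HasAntidiagonal.mem_antidiagonal.mp hp
      rw [h.eq_zero _ _ _ (by omega), mul_zero]
    · rfl
  F k b := by
    rcases lt_or_ge b 0 with hb | hb
    · simp only [QKZB.mulContract, if_neg (show ¬ 0 ≤ b by omega),
        if_neg (show ¬ 0 ≤ b - 1 by omega), mul_zero, add_zero]
    obtain ⟨b, rfl⟩ := Int.eq_ofNat_of_zero_le hb
    clear hb
    have h1 : qnum η (k + 1) * QKZB.mulContract η L₁ C (k + 1) b =
        qpow η (-(L₁ + L₂ - 2 * b)) * qnum η (k + 1 + N - b) * QKZB.mulContract η L₁ C k b +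
        (∑ p ∈ Finset.HasAntidiagonal.antidiagonal b, qpow η (p.2 * (L₁ - p.1)) *
            (qpow η (-(L₂ - 2 * p.2)) * qnum η (L₁ - p.1 + 1) * C k (p.1 - 1) p.2) +
          ∑ p ∈ Finset.HasAntidiagonal.antidiagonal b, qpow η (p.2 * (L₁ - p.1)) *
            (qnum η (L₂ - p.2 + 1) * C k p.1 (p.2 - 1))) := by
      rw [mulContract_natCast, mulContract_natCast, Finset.mul_sum, Finset.mul_sum,
        ← Finset.sum_add_distrib, ← Finset.sum_add_distrib]
      refine Finset.sum_congr rfl fun p hp => ?_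
      have hF := h.F k p.1 p.2
      have hb : (b : ℂ) = p.1 + p.2 := by
        exact_mod_cast (Finset.HasAntidiagonal.mem_antidiagonal.mp hp).symm
      push_cast at hF ⊢
      rw [show L₁ - 2 * (p.1 : ℂ) + (L₂ - 2 * p.2) = L₁ + L₂ - 2 * b by rw [hb]; ring,
        show (k : ℂ) + 1 + N - p.1 - p.2 = k + 1 + N - b by rw [hb]; ring] at hF
      linear_combination qpow η (p.2 * (L₁ - p.1)) * hF
    refine h1.trans ?_
    push_cast
    congr 1
    rcases b with _ | b
    · simp [QKZB.mulContract, h.eq_zero k (-1) 0, h.eq_zero k 0 (-1)]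
    · rw [Finset.Nat.sum_antidiagonal_succ, Finset.Nat.sum_antidiagonal_succ',
        show ((b + 1 : ℕ) : ℤ) - 1 = b by push_cast; ring, mulContract_natCast, Finset.mul_sum,
        h.eq_zero k (((0 : ℕ) : ℤ) - 1) _ (by simp), h.eq_zero k _ (((0 : ℕ) : ℤ) - 1) (by simp)]
      simp only [mul_zero, zero_add]
      rw [← Finset.sum_add_distrib]
      refine Finset.sum_congr rfl fun p hp => ?_
      have hb : (b : ℂ) = p.1 + p.2 := by
        exact_mod_cast (Finset.HasAntidiagonal.mem_antidiagonal.mp hp).symm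
      push_cast
      have ha := qnum_add' η (L₁ - p.1) (L₂ - p.2)
      rw [show L₁ - (p.1 : ℂ) + (L₂ - p.2) = L₁ + L₂ - (b + 1) + 1 by rw [hb]; ring] at ha
      rw [ha, show L₁ - ((p.1 : ℂ) + 1) + 1 = L₁ - p.1 by ring,
        show L₂ - ((p.2 : ℂ) + 1) + 1 = L₂ - p.2 by ring, add_sub_cancel_right,
        add_sub_cancel_right]
      have e1 : qpow η (p.2 * (L₁ - (p.1 + 1))) * qpow η (-(L₂ - 2 * p.2)) =
          qpow η (-(L₂ - p.2)) * qpow η (p.2 * (L₁ - p.1)) := by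
        rw [← qpow_add, ← qpow_add]; ring_nf
      have e2 : qpow η ((p.2 + 1) * (L₁ - p.1)) =
          qpow η (L₁ - p.1) * qpow η (p.2 * (L₁ - p.1)) := by
        rw [← qpow_add]; ring_nf
      linear_combination (qnum η (L₁ - p.1) * C k p.1 p.2) * e1 +
        (qnum η (L₂ - p.2) * C k p.1 p.2) * e2
  E k b hl := by
    rcases lt_or_ge b 0 with hb | hb
    · simp only [QKZB.mulContract, if_neg (show ¬ 0 ≤ b by omega), mul_zero, zero_add]
      split_ifs with hb'
      · have : (b : ℂ) + 1 = 0 := by exact_mod_cast (show b + 1 = 0 by omega)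
        rw [this, qnum_zero]; simp
      · simp
    obtain ⟨b, rfl⟩ := Int.eq_ofNat_of_zero_le hb
    clear hb
    have hs := sum_antidiagonal_qnum η b fun i j => qpow η (j * (L₁ - i)) * C k i j
    rw [show (b : ℤ) + 1 = (b + 1 : ℕ) by push_cast; ring, mulContract_natCast, mulContract_natCast,
      mulContract_natCast]
    push_cast
    rw [← hs, Finset.mul_sum, Finset.mul_sum, Finset.mul_sum, ← Finset.sum_add_distrib]
    refine Finset.sum_congr rfl fun p hp => ?_
    have hp' := Finset.HasAntidiagonal.mem_antidiagonal.mp hp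
    have hE := h.E k p.1 p.2 (by omega)
    have hb : (b : ℂ) = p.1 + p.2 := by exact_mod_cast hp'.symm
    have e1 : qpow η (-p.1) * qpow η ((p.2 + 1) * (L₁ - p.1)) =
        qpow η (L₁ - 2 * p.1) * qpow η (p.2 * (L₁ - p.1)) := by
      rw [← qpow_add, ← qpow_add]; ring_nf
    have e2 : qpow η p.2 * qpow η (p.2 * (L₁ - (p.1 + 1))) = qpow η (p.2 * (L₁ - p.1)) := by
      rw [← qpow_add]; ring_nf
    push_cast at hE ⊢
    rw [sub_sub (_ : ℂ) (p.1 : ℂ), ← hb, sub_sub (lam : ℂ)] at hE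
    generalize qpow η (lam - (L₁ + L₂) + 2 * N - 1 - 2 * (k - 1 + N - b)) = u at *
    linear_combination qpow η (p.2 * (L₁ - p.1)) * hE -
      u * qnum η (p.2 + 1) * C k p.1 (p.2 + 1) * e1 - u * qnum η (p.1 + 1) * C k (p.1 + 1) p.2 * e2

/-- The fusion of two intertwining operators. -/
theorem fusion {η : ℂ} (hη : 0 < η.im) {L₁ L₂ lam : ℂ} {m₁ m₂ : ℕ}
    (hgen : ∀ l < m₁ + m₂, qnum η (lam - (L₁ + L₂) + 2 * (m₁ + m₂ : ℕ) - 1 - l) ≠ 0) (k : ℤ) (b : ℕ) :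
    tcoef η (L₁ + L₂) (m₁ + m₂) lam k b = ∑ p ∈ Finset.HasAntidiagonal.antidiagonal b,
      qpow η (p.2 * (L₁ - p.1)) * pairCoef η L₁ L₂ m₁ m₂ lam k p.1 p.2 := by
  rw [← mulContract_natCast, ← sub_eq_zero]
  refine ((singleRel_tcoef hη (L₁ + L₂) (m₁ + m₂) lam).sub
    (pairRel_pairCoef hη L₁ L₂ m₁ m₂ lam).mulContract).eq_zero_of_leading hη hgen ?_ k b
  rw [sub_eq_zero, mulContract_natCast]
  have h1 := tcoef_leading hη (L₁ + L₂) (m₁ + m₂) lam 0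
  rw [zero_add, dfall_zero, mul_one] at h1
  rw [h1, qpoch_add]
  -- The argument is written as a part depending on the second operator plus Λ₁ - m₁, so that the
  -- q-Vandermonde identity splits the leading coefficient into products of those of the two
  -- operators.
  have h2 := qfact_mul_dfall_eq_qpoch hη (-(lam - L₂ + 2 * m₂) + m₂ + (L₁ - m₁)) m₂
  rw [show -lam + (L₁ + L₂) - 2 * ((m₁ + m₂ : ℕ) : ℂ) + 1 + m₁ =
    -(lam - L₂ + 2 * m₂) + m₂ + (L₁ - m₁) - m₂ + 1 by push_cast; ring, ← h2, dfall_add hη,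
    Finset.mul_sum, Finset.mul_sum]
  -- Only dual indices (m₁ + i, j) with i + j = m₂ occur at leading order; all others vanish by
  -- triangularity.
  refine Finset.sum_of_injOn (fun p => (m₁ + p.1, p.2)) ?_ ?_ ?_ ?_
  · rintro ⟨x₁, x₂⟩ _ ⟨y₁, y₂⟩ _ hxy
    simp only [Prod.mk.injEq] at hxy ⊢
    omega
  · intro p hp
    have hp' := Finset.HasAntidiagonal.mem_antidiagonal.mp hp
    exact Finset.mem_coe.mpr (Finset.HasAntidiagonal.mem_antidiagonal.mpr (by simp only; omega))
  · intro p hp hp'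
    have h3 := Finset.HasAntidiagonal.mem_antidiagonal.mp hp
    rw [pairCoef_leading_eq_zero, mul_zero]
    by_contra hlt
    exact hp' ⟨(p.1 - m₁, p.2), Finset.mem_coe.mpr
      (Finset.HasAntidiagonal.mem_antidiagonal.mpr (by simp only; omega)), by ext <;> simp; omega⟩
  · rintro ⟨i, j⟩ hp
    obtain rfl : i + j = m₂ := Finset.HasAntidiagonal.mem_antidiagonal.mp hp
    have hl := pairCoef_leading hη L₁ L₂ m₁ i j lam
    have h4 := qfact_mul_dfall_eq_qpoch hη (-(lam - L₂ + 2 * (i + j : ℕ)) + (i + j : ℕ)) j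
    simp only
    rw [add_comm i j] at *
    rw [hl, singCoef, show j + i - i = j by omega, show lam - L₁ - L₂ + 2 * ((m₁ + (j + i) : ℕ) : ℂ) =
      -(-lam + (L₁ + L₂) - 2 * (m₁ + (j + i) : ℕ)) by ring, neg_neg,
      show -lam + L₂ - 2 * ((j + i : ℕ) : ℂ) + i + 1 =
      -(lam - L₂ + 2 * (j + i : ℕ)) + (j + i : ℕ) - j + 1 by push_cast; ring, ← h4]
    have e : qpow η (j * (L₁ - (m₁ + i : ℕ))) * qpow η (i * (lam - L₂ + 2 * (j + i : ℕ) - i)) =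
        qpow η (j * (L₁ - m₁ - i) - i * (-(lam - L₂ + 2 * (j + i : ℕ)) + (j + i : ℕ) - j)) := by
      rw [← qpow_add]; push_cast; ring_nf
    rw [← e]
    have := qfact_ne_zero hη j
    generalize qpow η (j * (L₁ - (m₁ + i : ℕ))) = u₁
    generalize qpow η (i * (lam - L₂ + 2 * (j + i : ℕ) - i)) = u₂
    generalize qpoch η (-lam + (L₁ + L₂) - 2 * (m₁ + (j + i) : ℕ) + 1) m₁ = u₃
    generalize dfall η (-(lam - L₂ + 2 * (j + i : ℕ)) + (j + i : ℕ)) j = u₄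
    generalize dfall η (L₁ - m₁) i = u₅
    field_simp

/-! ### Hexagon relations for the quantum R-matrix -/

open Finset.HasAntidiagonal in
-- Both sides run over the 2 × 2 arrays of natural numbers with total n, grouped by rows or by
-- columns.
theorem sum_antidiagonal_shuffle (n : ℕ) (f : ℕ → ℕ → ℕ → ℕ → ℂ) :
    ∑ p ∈ antidiagonal n, ∑ x ∈ antidiagonal p.1, ∑ y ∈ antidiagonal p.2, f x.1 x.2 y.1 y.2 =
      ∑ p ∈ antidiagonal n, ∑ x ∈ antidiagonal p.1, ∑ y ∈ antidiagonal p.2, f x.1 y.1 x.2 y.2 := by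
  simp only [← Finset.sum_product', Finset.sum_sigma']
  refine Finset.sum_nbij'
    (fun s => ⟨(s.2.1.1 + s.2.2.1, s.2.1.2 + s.2.2.2), (s.2.1.1, s.2.2.1), (s.2.1.2, s.2.2.2)⟩)
    (fun s => ⟨(s.2.1.1 + s.2.2.1, s.2.1.2 + s.2.2.2), (s.2.1.1, s.2.2.1), (s.2.1.2, s.2.2.2)⟩)
    ?_ ?_ ?_ ?_ ?_
  · rintro ⟨⟨a, b⟩, ⟨c, d⟩, ⟨e, f⟩⟩
    simp only [Finset.mem_sigma, Finset.mem_product, mem_antidiagonal, and_self, and_true]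
    omega
  · rintro ⟨⟨a, b⟩, ⟨c, d⟩, ⟨e, f⟩⟩
    simp only [Finset.mem_sigma, Finset.mem_product, mem_antidiagonal, and_self, and_true]
    omega
  · rintro ⟨⟨a, b⟩, ⟨c, d⟩, ⟨e, f⟩⟩
    simp only [Finset.mem_sigma, Finset.mem_product, mem_antidiagonal]
    rintro ⟨_, rfl, rfl⟩
    rfl
  · rintro ⟨⟨a, b⟩, ⟨c, d⟩, ⟨e, f⟩⟩
    simp only [Finset.mem_sigma, Finset.mem_product, mem_antidiagonal]
    rintro ⟨_, rfl, rfl⟩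
    rfl
  · intros; rfl

open Finset.HasAntidiagonal in
theorem sum_antidiagonal_assoc (n : ℕ) (f : ℕ → ℕ → ℕ → ℂ) :
    ∑ p ∈ antidiagonal n, ∑ x ∈ antidiagonal p.1, f x.1 x.2 p.2 =
      ∑ p ∈ antidiagonal n, ∑ x ∈ antidiagonal p.2, f p.1 x.1 x.2 := by
  simp only [Finset.sum_sigma']
  refine Finset.sum_nbij' (fun s => ⟨(s.2.1, s.2.2 + s.1.2), (s.2.2, s.1.2)⟩)
    (fun s => ⟨(s.1.1 + s.2.1, s.2.2), (s.1.1, s.2.1)⟩) ?_ ?_ ?_ ?_ ?_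
  · rintro ⟨⟨a, b⟩, ⟨c, d⟩⟩
    simp only [Finset.mem_sigma, mem_antidiagonal, and_true]
    omega
  · rintro ⟨⟨a, b⟩, ⟨c, d⟩⟩
    simp only [Finset.mem_sigma, mem_antidiagonal, and_true]
    omega
  · rintro ⟨⟨a, b⟩, ⟨c, d⟩⟩
    simp only [Finset.mem_sigma, mem_antidiagonal]
    rintro ⟨_, rfl⟩
    rfl
  · rintro ⟨⟨a, b⟩, ⟨c, d⟩⟩
    simp only [Finset.mem_sigma, mem_antidiagonal]
    rintro ⟨_, rfl⟩
    rfl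
  · intros; rfl

open Finset.HasAntidiagonal in
theorem sum_antidiagonal_shift (n i j : ℕ) (f : ℕ → ℕ → ℂ)
    (h : ∀ w₁ w₂, w₁ < i ∨ w₂ < j → f w₁ w₂ = 0) :
    ∑ p ∈ antidiagonal n, f (p.1 + i) (p.2 + j) = ∑ w ∈ antidiagonal (n + (i + j)), f w.1 w.2 := by
  refine Finset.sum_of_injOn (fun p => (p.1 + i, p.2 + j)) ?_ ?_ ?_ ?_
  · rintro ⟨a, b⟩ _ ⟨c, d⟩ _ h
    simp only [Prod.mk.injEq] at h ⊢
    omega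
  · intro p hp
    have := mem_antidiagonal.mp hp
    exact Finset.mem_coe.mpr (mem_antidiagonal.mpr (by simp only; omega))
  · intro w hw hw'
    have := mem_antidiagonal.mp hw
    apply h
    by_contra hlt
    exact hw' ⟨(w.1 - i, w.2 - j), Finset.mem_coe.mpr (mem_antidiagonal.mpr (by simp only; omega)),
      by ext <;> simp <;> omega⟩
  · intros; rfl

/-- With the outgoing index w fixed, the dependence on Λ_a becomes a q-binomial coefficient, to
which the q-Vandermonde identity applies; `rCoef_eq_dfall_right` does the same for the second index.
-/
theorem rCoef_eq_dfall_left {η : ℂ} (hη : 0 < η.im) (La Lb : ℂ) (w : ℕ) (m₂ : ℤ) (κ : ℕ) :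
    rCoef η La Lb (w + κ : ℕ) m₂ κ = qpow η (-((w + κ) * Lb) - m₂ * La + 2 * (w + κ) * m₂ +
      κ * (κ - 1) / 2) * (qpow η 1 - qpow η (-1)) ^ κ * dfall η (La - w) κ * qpoch η (m₂ + 1) κ := by
  have h := qfact_mul_dfall_eq_qpoch hη (La - w) κ
  have h0 := qfact_ne_zero hη κ
  rw [rCoef, qpow_add η _ (κ * (κ - 1) / 2 : ℂ)]
  push_cast
  rw [show La - ((w : ℂ) + κ) + 1 = La - w - κ + 1 by ring, ← h]
  generalize qpow η (κ * (κ - 1) / 2) = u₁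
  generalize qpow η (-((w + κ) * Lb) - m₂ * La + 2 * (w + κ) * m₂) = u₂
  generalize qpoch η ((m₂ : ℂ) + 1) κ = u₃
  generalize dfall η (La - w) κ = u₄
  field_simp

theorem rCoef_eq_dfall_right {η : ℂ} (hη : 0 < η.im) (La Lb : ℂ) (m₁ m₂ : ℤ) (w κ : ℕ)
    (hw : m₂ + κ = w) :
    rCoef η La Lb m₁ m₂ κ = qpow η (-(m₁ * Lb) - (w - κ) * La + 2 * m₁ * (w - κ) +
      κ * (κ - 1) / 2) * (qpow η 1 - qpow η (-1)) ^ κ * dfall η w κ * qpoch η (La - m₁ + 1) κ := by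
  have h := qfact_mul_dfall_eq_qpoch hη w κ
  have h0 := qfact_ne_zero hη κ
  have hm : (m₂ : ℂ) = w - κ := by
    have : (m₂ : ℂ) + κ = w := by exact_mod_cast hw
    rw [← this]; ring
  rw [rCoef, qpow_add η _ (κ * (κ - 1) / 2 : ℂ), hm, ← h]
  generalize qpow η (κ * (κ - 1) / 2) = u₁
  generalize qpow η (-(m₁ * Lb) - (w - κ) * La + 2 * m₁ * (w - κ)) = u₂
  generalize qpoch η (La - m₁ + 1) κ = u₃
  generalize dfall η w κ = u₄
  field_simp

/-- The q-Vandermonde identity for Λ₁ + Λ₂ - w₁ - w₂ split as (Λ₂ - w₂) + (Λ₁ - w₁): κ is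
distributed over the two factors being fused. -/
theorem rCoef_hexagon_left {η : ℂ} (hη : 0 < η.im) (L₁ L₂ L₃ : ℂ) (w₁ w₂ b κ : ℕ) :
    rCoef η (L₁ + L₂) L₃ (w₁ + w₂ + κ : ℕ) b κ * qpow η (w₂ * (L₁ - w₁)) =
      ∑ p ∈ Finset.HasAntidiagonal.antidiagonal κ, qpow η ((w₂ + p.2) * (L₁ - w₁ - p.1)) *
        (rCoef η L₁ L₃ (w₁ + p.1 : ℕ) b p.1 * rCoef η L₂ L₃ (w₂ + p.2 : ℕ) (b + p.1 : ℕ) p.2) := by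
  rw [rCoef_eq_dfall_left hη]
  push_cast
  rw [show L₁ + L₂ - ((w₁ : ℂ) + w₂) = L₂ - w₂ + (L₁ - w₁) by ring, dfall_add hη, Finset.mul_sum,
    Finset.sum_mul, Finset.sum_mul]
  refine Finset.sum_congr rfl fun p hp => ?_
  obtain ⟨i, j⟩ := p
  obtain rfl : i + j = κ := Finset.HasAntidiagonal.mem_antidiagonal.mp hp
  have h1 := rCoef_eq_dfall_left hη L₁ L₃ w₁ b i
  have h2 := rCoef_eq_dfall_left hη L₂ L₃ w₂ (b + i : ℕ) j
  push_cast at h1 h2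
  simp only
  rw [h1, h2, qpoch_add, pow_add, show (b : ℂ) + i + 1 = b + 1 + i by ring]
  have e : qpow η (-((w₁ + w₂ + (i + j : ℕ)) * L₃) - b * (L₁ + L₂) +
        2 * (w₁ + w₂ + (i + j : ℕ)) * b + (i + j : ℕ) * ((i + j : ℕ) - 1) / 2) *
      qpow η (j * (L₁ - w₁ - i) - i * (L₂ - w₂ - j)) * qpow η (w₂ * (L₁ - w₁)) =
      qpow η ((w₂ + j) * (L₁ - w₁ - i)) * qpow η (-((w₁ + i) * L₃) - b * L₁ + 2 * (w₁ + i) * b +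
        i * (i - 1) / 2) * qpow η (-((w₂ + j) * L₃) - (b + i) * L₂ + 2 * (w₂ + j) * (b + i) +
        j * (j - 1) / 2) := by
    rw [← qpow_add, ← qpow_add, ← qpow_add, ← qpow_add]
    congr 1
    push_cast; ring
  push_cast at e ⊢
  linear_combination (qpow η 1 - qpow η (-1)) ^ i * (qpow η 1 - qpow η (-1)) ^ j *
    dfall η (L₂ - w₂) j * dfall η (L₁ - w₁) i * qpoch η (b + 1) i * qpoch η (b + 1 + i) j * e

/-- Here it is the outgoing index w₂ + w₃ of the fused factor that is split by the q-Vandermonde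
identity. -/
theorem rCoef_hexagon_right {η : ℂ} (hη : 0 < η.im) (L₁ L₂ L₃ : ℂ) (b w₂ w₃ κ : ℕ) :
    rCoef η L₁ (L₂ + L₃) b (w₂ + w₃ - κ : ℤ) κ * qpow η (w₃ * (L₂ - w₂)) =
      ∑ p ∈ Finset.HasAntidiagonal.antidiagonal κ, qpow η ((w₃ - p.1) * (L₂ - w₂ + p.2)) *
        (rCoef η L₁ L₃ b (w₃ - p.1 : ℤ) p.1 * rCoef η L₁ L₂ (b - p.1 : ℤ) (w₂ - p.2 : ℤ) p.2) := by
  rw [rCoef_eq_dfall_right hη _ _ _ _ (w₂ + w₃) _ (by push_cast; ring)]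
  push_cast
  rw [dfall_add hη, Finset.mul_sum, Finset.sum_mul, Finset.sum_mul]
  refine Finset.sum_congr rfl fun p hp => ?_
  obtain ⟨i, j⟩ := p
  obtain rfl : i + j = κ := Finset.HasAntidiagonal.mem_antidiagonal.mp hp
  have h1 := rCoef_eq_dfall_right hη L₁ L₃ b (w₃ - i) w₃ i (by ring)
  have h2 := rCoef_eq_dfall_right hη L₁ L₂ (b - i) (w₂ - j) w₂ j (by ring)
  push_cast at h1 h2
  simp only
  rw [h1, h2, qpoch_add, pow_add, show L₁ - ((b : ℂ) - i) + 1 = L₁ - b + 1 + i by ring]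
  have e : qpow η (-(b * (L₂ + L₃)) - (w₂ + w₃ - (i + j : ℕ)) * L₁ +
        2 * b * (w₂ + w₃ - (i + j : ℕ)) + (i + j : ℕ) * ((i + j : ℕ) - 1) / 2) *
      qpow η (j * (w₃ - i) - i * (w₂ - j)) * qpow η (w₃ * (L₂ - w₂)) =
      qpow η ((w₃ - i) * (L₂ - w₂ + j)) * qpow η (-(b * L₃) - (w₃ - i) * L₁ + 2 * b * (w₃ - i) +
        i * (i - 1) / 2) * qpow η (-((b - i) * L₂) - (w₂ - j) * L₁ + 2 * (b - i) * (w₂ - j) +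
        j * (j - 1) / 2) := by
    rw [← qpow_add, ← qpow_add, ← qpow_add, ← qpow_add]
    congr 1
    push_cast; ring
  push_cast at e ⊢
  linear_combination (qpow η 1 - qpow η (-1)) ^ i * (qpow η 1 - qpow η (-1)) ^ j *
    dfall η w₂ j * dfall η w₃ i * qpoch η (L₁ - b + 1) i * qpoch η (L₁ - b + 1 + i) j * e

open Finset.HasAntidiagonal in
/-- The compatibility of the quantum R-matrix with fusion in the first factor. -/
theorem hexagon_left {η : ℂ} (hη : 0 < η.im) (L₁ L₂ L₃ : ℂ) (b₁ b₂ : ℕ) (C : ℕ → ℕ → ℕ → ℂ) :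
    ∑ p ∈ antidiagonal b₂, rCoef η (L₁ + L₂) L₃ b₂ b₁ p.2 *
      ∑ w ∈ antidiagonal p.1, qpow η (w.2 * (L₁ - w.1)) * C w.1 w.2 (b₁ + p.2) =
    ∑ p ∈ antidiagonal b₂, qpow η (p.2 * (L₁ - p.1)) *
      ∑ x ∈ antidiagonal p.1, rCoef η L₁ L₃ p.1 b₁ x.2 *
        ∑ y ∈ antidiagonal p.2, rCoef η L₂ L₃ p.2 (b₁ + x.2 : ℕ) y.2 *
          C x.1 y.1 (b₁ + x.2 + y.2) := by
  have hR : ∀ p : ℕ × ℕ, qpow η (p.2 * (L₁ - p.1)) *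
      ∑ x ∈ antidiagonal p.1, rCoef η L₁ L₃ p.1 b₁ x.2 *
        ∑ y ∈ antidiagonal p.2, rCoef η L₂ L₃ p.2 (b₁ + x.2 : ℕ) y.2 *
          C x.1 y.1 (b₁ + x.2 + y.2) =
      ∑ x ∈ antidiagonal p.1, ∑ y ∈ antidiagonal p.2,
        qpow η ((y.1 + y.2) * (L₁ - x.1 - x.2)) * (rCoef η L₁ L₃ (x.1 + x.2 : ℕ) b₁ x.2 *
          rCoef η L₂ L₃ (y.1 + y.2 : ℕ) (b₁ + x.2 : ℕ) y.2) * C x.1 y.1 (b₁ + (x.2 + y.2)) := by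
    intro p
    simp only [Finset.mul_sum]
    refine Finset.sum_congr rfl fun x hx => Finset.sum_congr rfl fun y hy => ?_
    rw [← mem_antidiagonal.mp hx, ← mem_antidiagonal.mp hy, add_assoc b₁]
    push_cast
    rw [sub_sub]; ring
  simp only [hR]
  rw [sum_antidiagonal_shuffle b₂ fun x₁ x₂ y₁ y₂ => qpow η ((y₁ + y₂) * (L₁ - x₁ - x₂)) *
    (rCoef η L₁ L₃ (x₁ + x₂ : ℕ) b₁ x₂ * rCoef η L₂ L₃ (y₁ + y₂ : ℕ) (b₁ + x₂ : ℕ) y₂) *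
    C x₁ y₁ (b₁ + (x₂ + y₂))]
  refine Finset.sum_congr rfl fun p hp => ?_
  rw [Finset.mul_sum]
  refine Finset.sum_congr rfl fun x hx => ?_
  rw [← mem_antidiagonal.mp hp, ← mem_antidiagonal.mp hx, ← mul_assoc,
    rCoef_hexagon_left hη, Finset.sum_mul]
  refine Finset.sum_congr rfl fun y hy => ?_
  rw [← mem_antidiagonal.mp hy]

/-- A transition from a negative to a nonnegative second index contains the factor [0]. Sums over
shifted indices may therefore be extended to whole antidiagonals. -/
theorem rCoef_eq_zero {η : ℂ} (La Lb : ℂ) (m₁ m₂ : ℤ) {κ : ℕ} (h₁ : m₂ < 0) (h₂ : 0 ≤ m₂ + κ) :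
    rCoef η La Lb m₁ m₂ κ = 0 := by
  obtain ⟨s, hs⟩ := Int.eq_ofNat_of_zero_le (show 0 ≤ -m₂ - 1 by omega)
  have : qpoch η ((m₂ : ℂ) + 1) κ = 0 := by
    refine Finset.prod_eq_zero (i := s) (Finset.mem_range.mpr (by omega)) ?_
    have h3 : (-m₂ - 1 : ℂ) = s := by exact_mod_cast hs
    rw [← h3, show (m₂ : ℂ) + 1 + (-m₂ - 1) = 0 by ring, qnum_zero]
  rw [rCoef, this, mul_zero, mul_zero]

open Finset.HasAntidiagonal in
/-- The compatibility of the quantum R-matrix with fusion in the second factor. -/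
theorem hexagon_right {η : ℂ} (hη : 0 < η.im) (L₁ L₂ L₃ : ℂ) (b₁ b₂ : ℕ) (C : ℕ → ℕ → ℕ → ℂ) :
    ∑ p ∈ antidiagonal b₂, rCoef η L₁ (L₂ + L₃) b₂ b₁ p.2 *
      ∑ w ∈ antidiagonal (b₁ + p.2), qpow η (w.2 * (L₂ - w.1)) * C p.1 w.1 w.2 =
    ∑ r ∈ antidiagonal b₁, qpow η (r.2 * (L₂ - r.1)) *
      ∑ p ∈ antidiagonal b₂, rCoef η L₁ L₃ b₂ r.2 p.2 *
        ∑ x ∈ antidiagonal p.1, rCoef η L₁ L₂ p.1 r.1 x.2 *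
          C x.1 (r.1 + x.2) (r.2 + p.2) := by
  have hR : ∀ r : ℕ × ℕ, qpow η (r.2 * (L₂ - r.1)) *
      ∑ p ∈ antidiagonal b₂, rCoef η L₁ L₃ b₂ r.2 p.2 *
        ∑ x ∈ antidiagonal p.1, rCoef η L₁ L₂ p.1 r.1 x.2 * C x.1 (r.1 + x.2) (r.2 + p.2) =
      ∑ p ∈ antidiagonal b₂, ∑ x ∈ antidiagonal p.2, qpow η (r.2 * (L₂ - r.1)) *
        (rCoef η L₁ L₃ b₂ r.2 x.2 * rCoef η L₁ L₂ (b₂ - x.2 : ℤ) r.1 x.1) *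
          C p.1 (r.1 + x.1) (r.2 + x.2) := by
    intro r
    rw [← sum_antidiagonal_assoc b₂ fun p x₁ x₂ => qpow η (r.2 * (L₂ - r.1)) *
      (rCoef η L₁ L₃ b₂ r.2 x₂ * rCoef η L₁ L₂ (b₂ - x₂ : ℤ) r.1 x₁) * C p (r.1 + x₁) (r.2 + x₂)]
    simp only [Finset.mul_sum]
    refine Finset.sum_congr rfl fun p hp => Finset.sum_congr rfl fun x hx => ?_
    have : (b₂ : ℤ) - p.2 = p.1 := by have := mem_antidiagonal.mp hp; omega
    rw [this]; ring
  simp only [hR]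
  rw [Finset.sum_comm]
  refine Finset.sum_congr rfl fun p hp => ?_
  rw [Finset.sum_comm, Finset.mul_sum]
  -- The sum is rewritten in terms of the outgoing indices w; the terms added in the extension
  -- vanish by `rCoef_eq_zero`.
  have hS : ∀ x ∈ antidiagonal p.2, ∑ r ∈ antidiagonal b₁, qpow η (r.2 * (L₂ - r.1)) *
        (rCoef η L₁ L₃ b₂ r.2 x.2 * rCoef η L₁ L₂ (b₂ - x.2 : ℤ) r.1 x.1) *
          C p.1 (r.1 + x.1) (r.2 + x.2) =
      ∑ w ∈ antidiagonal (b₁ + p.2), qpow η ((w.2 - x.2) * (L₂ - w.1 + x.1)) *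
        (rCoef η L₁ L₃ b₂ (w.2 - x.2 : ℤ) x.2 * rCoef η L₁ L₂ (b₂ - x.2 : ℤ) (w.1 - x.1 : ℤ) x.1) *
          C p.1 w.1 w.2 := by
    intro x hx
    rw [← mem_antidiagonal.mp hx, ← sum_antidiagonal_shift b₁ x.1 x.2 fun w₁ w₂ =>
      qpow η ((w₂ - x.2) * (L₂ - w₁ + x.1)) * (rCoef η L₁ L₃ b₂ (w₂ - x.2 : ℤ) x.2 *
        rCoef η L₁ L₂ (b₂ - x.2 : ℤ) (w₁ - x.1 : ℤ) x.1) * C p.1 w₁ w₂]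
    · refine Finset.sum_congr rfl fun r _ => ?_
      push_cast
      simp only [add_sub_cancel_right]
      rw [show L₂ - ((r.1 : ℂ) + x.1) + x.1 = L₂ - r.1 by ring]
    · rintro w₁ w₂ (h | h)
      · rw [rCoef_eq_zero L₁ L₂ _ (w₁ - x.1) (by omega) (by omega)]; simp
      · rw [rCoef_eq_zero L₁ L₃ _ (w₂ - x.2) (by omega) (by omega)]; simp
  rw [Finset.sum_congr rfl hS, Finset.sum_comm]
  refine Finset.sum_congr rfl fun w hw => ?_
  have hw' : (b₁ : ℤ) = w.1 + w.2 - p.2 := by have := mem_antidiagonal.mp hw; omega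
  rw [← Finset.sum_mul, ← mul_assoc, hw', rCoef_hexagon_right hη,
    ← Finset.Nat.sum_antidiagonal_swap]
  rfl

/-! ### Generic values of the dynamical parameter -/

theorem analyticAt_qnum (η c x : ℂ) : AnalyticAt ℂ (fun z => qnum η (z + c)) x := by
  unfold qnum qpow; fun_prop

theorem eventually_codiscrete_ne_zero {f : ℂ → ℂ} (hf : ∀ x, AnalyticAt ℂ f x) {z : ℂ} (hz : f z ≠ 0) :
    ∀ᶠ x in codiscrete ℂ, f x ≠ 0 := by
  have h := AnalyticOnNhd.preimage_zero_mem_codiscrete (f := f) (x := z) (fun x _ => hf x) hz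
  filter_upwards [h] with x hx
  simpa using hx

theorem eventually_qnum_ne_zero {η : ℂ} (hη : 0 < η.im) (c : ℂ) :
    ∀ᶠ lam in codiscrete ℂ, qnum η (lam + c) ≠ 0 := by
  refine eventually_codiscrete_ne_zero (analyticAt_qnum η c) (z := 1 - c) ?_
  rw [sub_add_cancel, qnum_one hη]
  exact one_ne_zero

/-- Provides a whole window of integer shifts at once, so that the many genericity conditions of a
calculation follow from a few. -/
theorem eventually_qnum_int_ne_zero {η : ℂ} (hη : 0 < η.im) (c : ℂ) (K : ℤ) :
    ∀ᶠ lam in codiscrete ℂ, ∀ j : ℤ, |j| ≤ K → qnum η (lam + c + j) ≠ 0 := by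
  have : ∀ᶠ lam in codiscrete ℂ, ∀ j ∈ Set.Icc (-K) K, qnum η (lam + c + j) ≠ 0 :=
    ((Set.finite_Icc (-K) K).eventually_all).mpr fun j _ => by
      simpa only [add_assoc] using eventually_qnum_ne_zero hη (c + j)
  filter_upwards [this] with lam h j hj
  exact h j (abs_le.mp hj)

theorem generic_of_int {η L₁ L₂ lam : ℂ} {N : ℕ} (K : ℤ) (hK : 2 * N + 1 ≤ K)
    (h₁ : ∀ j : ℤ, |j| ≤ K → qnum η (lam - L₂ + j) ≠ 0)
    (h₂ : ∀ j : ℤ, |j| ≤ K → qnum η (lam - L₁ - L₂ + j) ≠ 0) : Generic η L₁ L₂ N lam where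
  left s hs := by
    have := h₁ s (abs_le.mpr ⟨by omega, by omega⟩)
    exact_mod_cast this
  right l hl := by
    have := h₂ (2 * N - 1 - l) (abs_le.mpr ⟨by omega, by omega⟩)
    push_cast at this
    rwa [show lam - L₁ - L₂ + (2 * (N : ℂ) - 1 - l) = lam - L₁ - L₂ + 2 * N - 1 - l by ring] at this

theorem eventually_generic {η : ℂ} (hη : 0 < η.im) (L₁ L₂ : ℂ) (N : ℕ) :
    ∀ᶠ lam in codiscrete ℂ, Generic η L₁ L₂ N lam := by
  filter_upwards [eventually_qnum_int_ne_zero hη (-L₂) (2 * N + 1),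
    eventually_qnum_int_ne_zero hη (-L₁ - L₂) (2 * N + 1)] with lam h₁ h₂
  refine generic_of_int (2 * N + 1) le_rfl (fun j hj => ?_) fun j hj => ?_
  · simpa only [sub_eq_add_neg] using h₁ j hj
  · have := h₂ j hj
    rwa [show lam + (-L₁ - L₂) = lam - L₁ - L₂ by ring] at this

/-! ### Compositions of three intertwining operators and the fusion of the dynamical R-matrix -/

/-- The matrix elements of the composition of three intertwining operators. -/
def tripleCoef (η L₁ L₂ L₃ : ℂ) (m₁ m₂ m₃ : ℕ) (lam : ℂ) (k b₁ b₂ b₃ : ℤ) : ℂ :=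
  tcoef η L₃ m₃ lam k b₃ * pairCoef η L₁ L₂ m₁ m₂ (lam - L₃ + 2 * m₃) (k + m₃ - b₃) b₁ b₂

/-- Associativity of the composition: the definition groups the first two tensor factors, this form
the last two. Each grouping gives access to an exchange of the grouped pair. -/
theorem tripleCoef_eq (η L₁ L₂ L₃ : ℂ) (m₁ m₂ m₃ : ℕ) (lam : ℂ) (k b₁ b₂ b₃ : ℤ) :
    tripleCoef η L₁ L₂ L₃ m₁ m₂ m₃ lam k b₁ b₂ b₃ = pairCoef η L₂ L₃ m₂ m₃ lam k b₂ b₃ *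
      tcoef η L₁ m₁ (lam - (L₂ + L₃) + 2 * (m₂ + m₃ : ℕ)) (k + (m₂ + m₃ : ℕ) - (b₂ + b₃)) b₁ := by
  rw [tripleCoef, pairCoef, pairCoef]
  push_cast
  rw [show lam - L₃ + 2 * m₃ - L₂ + 2 * (m₂ : ℂ) = lam - (L₂ + L₃) + 2 * (m₂ + m₃) by ring,
    show k + m₃ - b₃ + m₂ - b₂ = k + (m₂ + m₃) - (b₂ + b₃) by ring]
  ring

theorem rContract_eq_antidiagonal (η L₁ L₂ : ℂ) (C : ℤ → ℤ → ℤ → ℂ) (k b₁ : ℤ) (b₂ : ℕ) :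
    rContract η L₁ L₂ C k b₁ b₂ = ∑ p ∈ Finset.HasAntidiagonal.antidiagonal b₂,
      rCoef η L₂ L₁ b₂ b₁ p.2 * C k p.1 (b₁ + p.2) := by
  rw [← Finset.Nat.sum_antidiagonal_swap, Finset.Nat.sum_antidiagonal_eq_sum_range_succ_mk, rContract,
    show ((b₂ : ℤ) + 1).toNat = b₂.succ by omega]
  refine Finset.sum_congr rfl fun κ hκ => ?_
  have := Finset.mem_range.mp hκ
  simp only [Prod.swap_prod_mk]
  rw [Nat.cast_sub (by omega)]

open Finset.HasAntidiagonal in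
-- The third operator acts first and is unaffected, so the exchange takes place at the shifted
-- parameter λ - Λ₃ + 2m₃.
theorem tripleCoef_exchange_left {η : ℂ} (hη : 0 < η.im) {L₁ L₂ L₃ lam : ℂ} {n₁ n₂ m₃ : ℕ}
    (h : Generic η L₁ L₂ (n₁ + n₂) (lam - L₃ + 2 * m₃)) (k b₁ : ℤ) (b₂ : ℕ) (b₃ : ℤ) :
    ∑ a ∈ antidiagonal (n₁ + n₂), dynamicalR η L₂ L₁ (lam - L₃ + 2 * m₃) a.2 a.1 n₁ n₂ *
      tripleCoef η L₁ L₂ L₃ a.1 a.2 m₃ lam k b₁ b₂ b₃ =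
    ∑ p ∈ antidiagonal b₂, rCoef η L₂ L₁ b₂ b₁ p.2 *
      tripleCoef η L₂ L₁ L₃ n₁ n₂ m₃ lam k p.1 (b₁ + p.2) b₃ := by
  have := exchange hη rfl h (k + m₃ - b₃) b₁ b₂
  rw [rContract_eq_antidiagonal] at this
  simp only [tripleCoef]
  simp only [mul_left_comm _ (tcoef η L₃ m₃ lam k b₃), ← Finset.mul_sum, this]

open Finset.HasAntidiagonal in
-- The remaining operator depends on the exchanged indices only through their sums, which the
-- R-matrices preserve, so it factors out.
theorem tripleCoef_exchange_right {η : ℂ} (hη : 0 < η.im) {L₁ L₂ L₃ lam : ℂ} {m₁ n₂ n₃ : ℕ}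
    (h : Generic η L₂ L₃ (n₂ + n₃) lam) (k b₁ b₂ : ℤ) (b₃ : ℕ) :
    ∑ a ∈ antidiagonal (n₂ + n₃), dynamicalR η L₃ L₂ lam a.2 a.1 n₂ n₃ *
      tripleCoef η L₁ L₂ L₃ m₁ a.1 a.2 lam k b₁ b₂ b₃ =
    ∑ p ∈ antidiagonal b₃, rCoef η L₃ L₂ b₃ b₂ p.2 *
      tripleCoef η L₁ L₃ L₂ m₁ n₂ n₃ lam k b₁ p.1 (b₂ + p.2) := by
  have := exchange hη rfl h k b₂ b₃
  rw [rContract_eq_antidiagonal] at this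
  simp only [tripleCoef_eq]
  have h1 : ∀ p ∈ antidiagonal b₃, ((p.1 : ℤ) + (b₂ + p.2)) = b₂ + b₃ := by
    intro p hp
    have := mem_antidiagonal.mp hp
    omega
  rw [Finset.sum_congr rfl fun a ha => by rw [mem_antidiagonal.mp ha],
    Finset.sum_congr (s₁ := antidiagonal b₃) rfl fun p hp => by rw [h1 p hp, add_comm L₃ L₂]]
  simp only [← mul_assoc, ← Finset.sum_mul, this]

open Finset.HasAntidiagonal in
theorem pairCoef_fusion_left {η : ℂ} (hη : 0 < η.im) {L₁ L₂ L₃ lam : ℂ} {m₁ m₂ m₃ : ℕ}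
    (h : ∀ l < m₁ + m₂, qnum η (lam - L₃ + 2 * m₃ - (L₁ + L₂) + 2 * (m₁ + m₂ : ℕ) - 1 - l) ≠ 0)
    (k : ℤ) (b : ℕ) (b₃ : ℤ) :
    pairCoef η (L₁ + L₂) L₃ (m₁ + m₂) m₃ lam k b b₃ = ∑ p ∈ antidiagonal b,
      qpow η (p.2 * (L₁ - p.1)) * tripleCoef η L₁ L₂ L₃ m₁ m₂ m₃ lam k p.1 p.2 b₃ := by
  rw [pairCoef, fusion hη h, Finset.mul_sum]
  exact Finset.sum_congr rfl fun p _ => by rw [tripleCoef]; ring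

open Finset.HasAntidiagonal in
theorem pairCoef_fusion_right {η : ℂ} (hη : 0 < η.im) {L₁ L₂ L₃ lam : ℂ} {m₁ m₂ m₃ : ℕ}
    (h : ∀ l < m₂ + m₃, qnum η (lam - (L₂ + L₃) + 2 * (m₂ + m₃ : ℕ) - 1 - l) ≠ 0)
    (k b₁ : ℤ) (b : ℕ) :
    pairCoef η L₁ (L₂ + L₃) m₁ (m₂ + m₃) lam k b₁ b = ∑ p ∈ antidiagonal b,
      qpow η (p.2 * (L₂ - p.1)) * tripleCoef η L₁ L₂ L₃ m₁ m₂ m₃ lam k b₁ p.1 p.2 := by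
  rw [pairCoef, fusion hη h, Finset.sum_mul]
  refine Finset.sum_congr rfl fun p hp => ?_
  rw [tripleCoef_eq, show (p.1 : ℤ) + p.2 = b by exact_mod_cast mem_antidiagonal.mp hp]
  ring

theorem dynamicalR_eq_zero (η L₁ L₂ lam : ℂ) {m₁ m₂ n₁ n₂ : ℕ} (h : m₁ + m₂ ≠ n₁ + n₂) :
    dynamicalR η L₁ L₂ lam m₁ m₂ n₁ n₂ = 0 := if_neg h

open Finset.HasAntidiagonal in
-- Weight conservation determines the intermediate index c', which can therefore be used as a
-- summation variable in place of an incoming one.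
theorem sum_antidiagonal_intermediate_left (a b c : ℕ) (F : ℕ → ℕ → ℕ → ℕ → ℂ)
    (hF : ∀ x y z c', x + y ≠ a + c' → F x y z c' = 0) :
    ∑ p ∈ antidiagonal (a + b + c), ∑ x ∈ antidiagonal p.2, ∑ c' ∈ Finset.range (x.1 + p.1 + 1),
      F p.1 x.1 x.2 c' =
    ∑ p ∈ antidiagonal (b + c), ∑ x ∈ antidiagonal (a + p.1), F x.1 x.2 p.2 p.1 := by
  rw [← sum_antidiagonal_assoc (a + b + c) fun x y z => ∑ c' ∈ Finset.range (y + x + 1), F x y z c']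
  symm
  refine Finset.sum_of_injOn (fun p => (a + p.1, p.2)) ?_ ?_ ?_ ?_
  · rintro ⟨a, b⟩ _ ⟨c, d⟩ _ h
    simp only [Prod.mk.injEq] at h ⊢
    omega
  · intro p hp
    have := mem_antidiagonal.mp hp
    exact Finset.mem_coe.mpr (mem_antidiagonal.mpr (by simp only; omega))
  · intro w hw hw'
    have := mem_antidiagonal.mp hw
    refine Finset.sum_eq_zero fun x hx => Finset.sum_eq_zero fun c' _ => hF _ _ _ _ fun h => hw' ?_
    have := mem_antidiagonal.mp hx
    exact ⟨(c', w.2), Finset.mem_coe.mpr (mem_antidiagonal.mpr (by simp only; omega)),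
      by ext <;> simp; omega⟩
  · intro p hp
    refine Finset.sum_congr rfl fun x hx => ?_
    have := mem_antidiagonal.mp hx
    rw [Finset.sum_eq_single p.1]
    · intro c' _ hc
      exact hF _ _ _ _ (by omega)
    · intro h
      exact absurd (Finset.mem_range.mpr (by omega)) h

open Finset.HasAntidiagonal in
theorem sum_antidiagonal_intermediate_right (a b c : ℕ) (F : ℕ → ℕ → ℕ → ℕ → ℂ)
    (hF : ∀ x y z a', y + z ≠ a' + c → F x y z a' = 0) :
    ∑ p ∈ antidiagonal (a + b + c), ∑ x ∈ antidiagonal p.1, ∑ a' ∈ Finset.range (p.2 + x.2 + 1),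
      F x.1 x.2 p.2 a' =
    ∑ p ∈ antidiagonal (a + b), ∑ x ∈ antidiagonal (p.2 + c), F p.1 x.1 x.2 p.2 := by
  rw [sum_antidiagonal_assoc (a + b + c) fun x y z => ∑ a' ∈ Finset.range (z + y + 1), F x y z a']
  symm
  refine Finset.sum_of_injOn (fun p => (p.1, p.2 + c)) ?_ ?_ ?_ ?_
  · rintro ⟨a, b⟩ _ ⟨c, d⟩ _ h
    simp only [Prod.mk.injEq] at h ⊢
    omega
  · intro p hp
    have := mem_antidiagonal.mp hp
    exact Finset.mem_coe.mpr (mem_antidiagonal.mpr (by simp only; omega))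
  · intro w hw hw'
    have := mem_antidiagonal.mp hw
    refine Finset.sum_eq_zero fun x hx => Finset.sum_eq_zero fun a' _ => hF _ _ _ _ fun h => hw' ?_
    have := mem_antidiagonal.mp hx
    exact ⟨(w.1, a'), Finset.mem_coe.mpr (mem_antidiagonal.mpr (by simp only; omega)),
      by ext <;> simp; omega⟩
  · intro p hp
    refine Finset.sum_congr rfl fun x hx => ?_
    have := mem_antidiagonal.mp hx
    rw [Finset.sum_eq_single p.2]
    · intro a' _ ha
      exact hF _ _ _ _ (by omega)
    · intro h
      exact absurd (Finset.mem_range.mpr (by omega)) h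

open Finset.HasAntidiagonal in
-- Both sides are coefficients expressing one composition of operators, with the fused factor moved
-- past the third one, in terms of linearly independent products. Moving the fused factor at once
-- gives one side; splitting it, moving its constituents one at a time and fusing again gives the
-- other.
theorem dynamicalR_fusion_left {η : ℂ} (hη : 0 < η.im) (L₁ L₂ L₃ : ℂ) (m m₃ a b c : ℕ) :
    ∀ᶠ lam in codiscrete ℂ, dynamicalR η (L₁ + L₂) L₃ lam m m₃ (a + b) c =
      ∑ mm ∈ antidiagonal m, ∑ c' ∈ Finset.range (mm.1 + m₃ + 1),
        dynamicalR η L₂ L₃ lam mm.2 c' b c *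
          dynamicalR η L₁ L₃ (lam - (L₂ - 2 * mm.2)) mm.1 m₃ a c' := by
  by_cases hm : m₃ + m = a + b + c
  swap
  · refine Eventually.of_forall fun lam => ?_
    rw [dynamicalR_eq_zero _ _ _ _ (by omega)]
    refine (Finset.sum_eq_zero fun mm hmm => Finset.sum_eq_zero fun c' _ => ?_).symm
    have := mem_antidiagonal.mp hmm
    by_cases h : mm.2 + c' = b + c
    · rw [dynamicalR_eq_zero η L₁ L₃ _ (by omega), mul_zero]
    · rw [dynamicalR_eq_zero η L₂ L₃ _ h, zero_mul]
  -- A crude bound for all integer shifts occurring in the genericity conditions below.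
  obtain ⟨K, hK⟩ : ∃ K : ℤ, K = 10 * (a + b + c) + 10 := ⟨_, rfl⟩
  filter_upwards [eventually_generic hη L₃ (L₁ + L₂) (a + b + c), eventually_generic hη L₃ L₂ (b + c),
    eventually_qnum_int_ne_zero hη (-L₂ - L₁) K, eventually_qnum_int_ne_zero hη (-L₁ - L₂ - L₃) K]
    with lam g₁ g₂ h₁ h₂
  rw [← sub_eq_zero]
  refine pairCoef_linearIndependent hη g₁ (fun p => dynamicalR η (L₁ + L₂) L₃ lam p.2 p.1 (a + b) c -
    ∑ mm ∈ antidiagonal p.2, ∑ c' ∈ Finset.range (mm.1 + p.1 + 1),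
        dynamicalR η L₂ L₃ lam mm.2 c' b c *
          dynamicalR η L₁ L₃ (lam - (L₂ - 2 * mm.2)) mm.1 p.1 a c') ?_ (m₃, m) hm
  intro b₂ hb₂
  generalize a + b + c - b₂ = b₁
  simp only [sub_mul, Finset.sum_sub_distrib]
  rw [sub_eq_zero, exchange hη rfl g₁, rContract_eq_antidiagonal]
  have f₁ : ∀ l < a + b,
      qnum η (lam - L₃ + 2 * c - (L₁ + L₂) + 2 * (a + b : ℕ) - 1 - l) ≠ 0 := fun l hl => by
    have := h₂ (2 * c + 2 * (a + b) - 1 - l) (abs_le.mpr ⟨by omega, by omega⟩)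
    push_cast at this ⊢
    rwa [show lam - L₃ + 2 * (c : ℂ) - (L₁ + L₂) + 2 * (a + b) - 1 - l =
      lam + (-L₁ - L₂ - L₃) + (2 * c + 2 * (a + b) - 1 - l) by ring]
  have f₂ : ∀ x y : ℕ, x + y ≤ a + b + c → ∀ l < x + y,
      qnum η (lam - (L₁ + L₂) + 2 * (x + y : ℕ) - 1 - l) ≠ 0 := fun x y hxy l hl => by
    have := h₁ (2 * (x + y) - 1 - l) (abs_le.mpr ⟨by omega, by omega⟩)
    push_cast at this ⊢
    rwa [show lam - (L₁ + L₂) + 2 * ((x : ℂ) + y) - 1 - l =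
      lam + (-L₂ - L₁) + (2 * (x + y) - 1 - l) by ring]
  have f₃ : ∀ x y : ℕ, x + y = b + c → Generic η L₃ L₁ (a + x) (lam - L₂ + 2 * y) := fun x y hxy => by
    refine generic_of_int (6 * (a + b + c) + 1) (by omega) (fun j hj => ?_) fun j hj => ?_
    · have := h₁ (2 * y + j) (abs_le.mpr ⟨by have := (abs_le.mp hj).1; omega,
        by have := (abs_le.mp hj).2; omega⟩)
      push_cast at this
      rwa [show lam - L₂ + 2 * (y : ℂ) - L₁ + j = lam + (-L₂ - L₁) + (2 * y + j) by ring]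
    · have := h₂ (2 * y + j) (abs_le.mpr ⟨by have := (abs_le.mp hj).1; omega,
        by have := (abs_le.mp hj).2; omega⟩)
      push_cast at this
      rwa [show lam - L₂ + 2 * (y : ℂ) - L₃ - L₁ + j = lam + (-L₁ - L₂ - L₃) + (2 * y + j) by ring]
  -- Split the fused operator, factor the quantum R-matrix by the hexagon relation, exchange the
  -- second and then the first constituent with the third operator, and fuse again.
  calc ∑ p ∈ antidiagonal b₂, rCoef η (L₁ + L₂) L₃ b₂ b₁ p.2 *
        pairCoef η (L₁ + L₂) L₃ (a + b) c lam 0 p.1 (b₁ + p.2)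
      = ∑ p ∈ antidiagonal b₂, rCoef η (L₁ + L₂) L₃ b₂ b₁ p.2 *
          ∑ w ∈ antidiagonal p.1, qpow η (w.2 * (L₁ - w.1)) *
            tripleCoef η L₁ L₂ L₃ a b c lam 0 w.1 w.2 (b₁ + p.2 : ℕ) := by
        refine Finset.sum_congr rfl fun p _ => ?_
        rw [pairCoef_fusion_left hη f₁]
        push_cast; rfl
    _ = ∑ p ∈ antidiagonal b₂, qpow η (p.2 * (L₁ - p.1)) *
          ∑ x ∈ antidiagonal p.1, rCoef η L₁ L₃ p.1 b₁ x.2 *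
            ∑ y ∈ antidiagonal p.2, rCoef η L₂ L₃ p.2 (b₁ + x.2 : ℕ) y.2 *
              tripleCoef η L₁ L₂ L₃ a b c lam 0 x.1 y.1 (b₁ + x.2 + y.2 : ℕ) :=
        hexagon_left hη L₁ L₂ L₃ b₁ b₂ fun x y z => tripleCoef η L₁ L₂ L₃ a b c lam 0 x y z
    _ = ∑ p ∈ antidiagonal b₂, qpow η (p.2 * (L₁ - p.1)) *
          ∑ x ∈ antidiagonal p.1, rCoef η L₁ L₃ p.1 b₁ x.2 *
            ∑ z ∈ antidiagonal (b + c), dynamicalR η L₂ L₃ lam z.2 z.1 b c *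
              tripleCoef η L₁ L₃ L₂ a z.1 z.2 lam 0 x.1 (b₁ + x.2 : ℕ) p.2 := by
        refine Finset.sum_congr rfl fun p _ => ?_
        congr 1
        refine Finset.sum_congr rfl fun x _ => ?_
        rw [tripleCoef_exchange_right hη g₂]
        push_cast; rfl
    _ = ∑ p ∈ antidiagonal b₂, qpow η (p.2 * (L₁ - p.1)) *
          ∑ z ∈ antidiagonal (b + c), dynamicalR η L₂ L₃ lam z.2 z.1 b c *
            ∑ x ∈ antidiagonal p.1, rCoef η L₁ L₃ p.1 b₁ x.2 *
              tripleCoef η L₁ L₃ L₂ a z.1 z.2 lam 0 x.1 (b₁ + x.2) p.2 := by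
        refine Finset.sum_congr rfl fun p _ => ?_
        congr 1
        simp only [Finset.mul_sum]
        rw [Finset.sum_comm]
        refine Finset.sum_congr rfl fun z _ => Finset.sum_congr rfl fun x _ => ?_
        push_cast; ring
    _ = ∑ p ∈ antidiagonal b₂, qpow η (p.2 * (L₁ - p.1)) *
          ∑ z ∈ antidiagonal (b + c), dynamicalR η L₂ L₃ lam z.2 z.1 b c *
            ∑ x ∈ antidiagonal (a + z.1),
              dynamicalR η L₁ L₃ (lam - L₂ + 2 * z.2) x.2 x.1 a z.1 *
              tripleCoef η L₃ L₁ L₂ x.1 x.2 z.2 lam 0 b₁ p.1 p.2 := by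
        refine Finset.sum_congr rfl fun p _ => ?_
        congr 1
        refine Finset.sum_congr rfl fun z hz => ?_
        rw [tripleCoef_exchange_left hη (f₃ _ _ (mem_antidiagonal.mp hz))]
    _ = ∑ p ∈ antidiagonal b₂, qpow η (p.2 * (L₁ - p.1)) *
          ∑ s ∈ antidiagonal (a + b + c), ∑ mm ∈ antidiagonal s.2,
            ∑ c' ∈ Finset.range (mm.1 + s.1 + 1), dynamicalR η L₂ L₃ lam mm.2 c' b c *
              dynamicalR η L₁ L₃ (lam - (L₂ - 2 * mm.2)) mm.1 s.1 a c' *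
              tripleCoef η L₃ L₁ L₂ s.1 mm.1 mm.2 lam 0 b₁ p.1 p.2 := by
        refine Finset.sum_congr rfl fun p _ => ?_
        congr 1
        rw [sum_antidiagonal_intermediate_left a b c fun x y z c' => dynamicalR η L₂ L₃ lam z c' b c *
              dynamicalR η L₁ L₃ (lam - (L₂ - 2 * z)) y x a c' *
              tripleCoef η L₃ L₁ L₂ x y z lam 0 b₁ p.1 p.2]
        · refine Finset.sum_congr rfl fun z _ => ?_
          rw [Finset.mul_sum]
          refine Finset.sum_congr rfl fun x _ => ?_
          rw [sub_sub_eq_add_sub, add_sub_right_comm, mul_assoc]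
        · intro x y z c' h
          rw [dynamicalR_eq_zero η L₁ L₃ _ (by omega), mul_zero, zero_mul]
    _ = ∑ s ∈ antidiagonal (a + b + c), (∑ mm ∈ antidiagonal s.2,
            ∑ c' ∈ Finset.range (mm.1 + s.1 + 1), dynamicalR η L₂ L₃ lam mm.2 c' b c *
              dynamicalR η L₁ L₃ (lam - (L₂ - 2 * mm.2)) mm.1 s.1 a c') *
              pairCoef η L₃ (L₁ + L₂) s.1 s.2 lam 0 b₁ b₂ := by
        simp only [Finset.mul_sum]
        rw [Finset.sum_comm]
        refine Finset.sum_congr rfl fun s hs => ?_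
        rw [Finset.sum_comm, Finset.sum_mul]
        refine Finset.sum_congr rfl fun mm hmm => ?_
        have hs' := mem_antidiagonal.mp hs
        have hmm' := mem_antidiagonal.mp hmm
        rw [Finset.sum_comm, Finset.sum_mul]
        refine Finset.sum_congr rfl fun c' _ => ?_
        rw [← hmm', pairCoef_fusion_right hη (f₂ _ _ (by omega)), Finset.mul_sum]
        refine Finset.sum_congr rfl fun p _ => ?_
        ring

open Finset.HasAntidiagonal in
-- The mirror argument: the fused factor is now the second one, and the first exchange takes place
-- at the shifted parameter.
theorem dynamicalR_fusion_right {η : ℂ} (hη : 0 < η.im) (L₁ L₂ L₃ : ℂ) (m₁ m a b c : ℕ) :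
    ∀ᶠ lam in codiscrete ℂ, dynamicalR η L₁ (L₂ + L₃) lam m₁ m a (b + c) =
      ∑ mm ∈ antidiagonal m, ∑ a' ∈ Finset.range (m₁ + mm.2 + 1),
        dynamicalR η L₁ L₂ (lam - (L₃ - 2 * c)) a' mm.1 a b *
          dynamicalR η L₁ L₃ lam m₁ mm.2 a' c := by
  by_cases hm : m + m₁ = a + b + c
  swap
  · refine Eventually.of_forall fun lam => ?_
    rw [dynamicalR_eq_zero _ _ _ _ (by omega)]
    refine (Finset.sum_eq_zero fun mm hmm => Finset.sum_eq_zero fun a' _ => ?_).symm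
    have := mem_antidiagonal.mp hmm
    by_cases h : a' + mm.1 = a + b
    · rw [dynamicalR_eq_zero η L₁ L₃ _ (by omega), mul_zero]
    · rw [dynamicalR_eq_zero η L₁ L₂ _ h, zero_mul]
  obtain ⟨K, hK⟩ : ∃ K : ℤ, K = 10 * (a + b + c) + 10 := ⟨_, rfl⟩
  filter_upwards [eventually_generic hη (L₂ + L₃) L₁ (a + b + c),
    eventually_qnum_int_ne_zero hη (-L₁) K, eventually_qnum_int_ne_zero hη (-L₂ - L₃) K,
    eventually_qnum_int_ne_zero hη (-L₁ - L₃) K, eventually_qnum_int_ne_zero hη (-L₁ - L₂ - L₃) K]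
    with lam g₁ h₁ h₂ h₃ h₄
  rw [← sub_eq_zero]
  refine pairCoef_linearIndependent hη g₁ (fun p => dynamicalR η L₁ (L₂ + L₃) lam p.2 p.1 a (b + c) -
    ∑ mm ∈ antidiagonal p.1, ∑ a' ∈ Finset.range (p.2 + mm.2 + 1),
        dynamicalR η L₁ L₂ (lam - (L₃ - 2 * c)) a' mm.1 a b *
          dynamicalR η L₁ L₃ lam p.2 mm.2 a' c) ?_ (m, m₁) hm
  intro b₂ hb₂
  generalize a + b + c - b₂ = b₁
  simp only [sub_mul, Finset.sum_sub_distrib]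
  rw [sub_eq_zero, exchange hη (by omega) g₁, rContract_eq_antidiagonal]
  have f₁ : ∀ l < b + c, qnum η (lam - (L₂ + L₃) + 2 * (b + c : ℕ) - 1 - l) ≠ 0 := fun l hl => by
    have := h₂ (2 * (b + c) - 1 - l) (abs_le.mpr ⟨by omega, by omega⟩)
    push_cast at this ⊢
    rwa [show lam - (L₂ + L₃) + 2 * ((b : ℂ) + c) - 1 - l =
      lam + (-L₂ - L₃) + (2 * (b + c) - 1 - l) by ring]
  have f₂ : ∀ x y z : ℕ, x + y + z = a + b + c → ∀ l < x + y,
      qnum η (lam - L₁ + 2 * z - (L₂ + L₃) + 2 * (x + y : ℕ) - 1 - l) ≠ 0 := fun x y z hxy l hl => by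
    have := h₄ (2 * z + 2 * (x + y) - 1 - l) (abs_le.mpr ⟨by omega, by omega⟩)
    push_cast at this ⊢
    rwa [show lam - L₁ + 2 * (z : ℂ) - (L₂ + L₃) + 2 * ((x : ℂ) + y) - 1 - l =
      lam + (-L₁ - L₂ - L₃) + (2 * z + 2 * (x + y) - 1 - l) by ring]
  have f₃ : ∀ x y : ℕ, x + y = a + b → Generic η L₃ L₁ (y + c) lam := fun x y hxy => by
    refine generic_of_int (6 * (a + b + c) + 1) (by omega) (fun j hj => ?_) fun j hj => ?_
    · have := h₁ j (hj.trans (by omega))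
      rwa [← sub_eq_add_neg] at this
    · have := h₃ j (hj.trans (by omega))
      rwa [show lam - L₃ - L₁ = lam + (-L₁ - L₃) by ring]
  have f₄ : Generic η L₂ L₁ (a + b) (lam - L₃ + 2 * c) := by
    refine generic_of_int (6 * (a + b + c) + 1) (by omega) (fun j hj => ?_) fun j hj => ?_
    · have := h₃ (2 * c + j) (abs_le.mpr ⟨by have := (abs_le.mp hj).1; omega,
        by have := (abs_le.mp hj).2; omega⟩)
      push_cast at this
      rwa [show lam - L₃ + 2 * (c : ℂ) - L₁ + j = lam + (-L₁ - L₃) + (2 * c + j) by ring]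
    · have := h₄ (2 * c + j) (abs_le.mpr ⟨by have := (abs_le.mp hj).1; omega,
        by have := (abs_le.mp hj).2; omega⟩)
      push_cast at this
      rwa [show lam - L₃ + 2 * (c : ℂ) - L₂ - L₁ + j = lam + (-L₁ - L₂ - L₃) + (2 * c + j) by ring]
  calc ∑ p ∈ antidiagonal b₂, rCoef η L₁ (L₂ + L₃) b₂ b₁ p.2 *
        pairCoef η L₁ (L₂ + L₃) a (b + c) lam 0 p.1 (b₁ + p.2)
      = ∑ p ∈ antidiagonal b₂, rCoef η L₁ (L₂ + L₃) b₂ b₁ p.2 *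
          ∑ w ∈ antidiagonal (b₁ + p.2), qpow η (w.2 * (L₂ - w.1)) *
            tripleCoef η L₁ L₂ L₃ a b c lam 0 p.1 w.1 w.2 := by
        refine Finset.sum_congr rfl fun p _ => ?_
        rw [← pairCoef_fusion_right hη f₁]
        push_cast; rfl
    _ = ∑ r ∈ antidiagonal b₁, qpow η (r.2 * (L₂ - r.1)) *
          ∑ p ∈ antidiagonal b₂, rCoef η L₁ L₃ b₂ r.2 p.2 *
            ∑ x ∈ antidiagonal p.1, rCoef η L₁ L₂ p.1 r.1 x.2 *
              tripleCoef η L₁ L₂ L₃ a b c lam 0 x.1 (r.1 + x.2 : ℕ) (r.2 + p.2 : ℕ) :=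
        hexagon_right hη L₁ L₂ L₃ b₁ b₂ fun x y z => tripleCoef η L₁ L₂ L₃ a b c lam 0 x y z
    _ = ∑ r ∈ antidiagonal b₁, qpow η (r.2 * (L₂ - r.1)) *
          ∑ p ∈ antidiagonal b₂, rCoef η L₁ L₃ b₂ r.2 p.2 *
            ∑ z ∈ antidiagonal (a + b), dynamicalR η L₁ L₂ (lam - L₃ + 2 * c) z.2 z.1 a b *
              tripleCoef η L₂ L₁ L₃ z.1 z.2 c lam 0 r.1 p.1 (r.2 + p.2 : ℕ) := by
        refine Finset.sum_congr rfl fun r _ => ?_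
        congr 1
        refine Finset.sum_congr rfl fun p _ => ?_
        rw [tripleCoef_exchange_left hη f₄]
        push_cast; rfl
    _ = ∑ r ∈ antidiagonal b₁, qpow η (r.2 * (L₂ - r.1)) *
          ∑ z ∈ antidiagonal (a + b), dynamicalR η L₁ L₂ (lam - L₃ + 2 * c) z.2 z.1 a b *
            ∑ p ∈ antidiagonal b₂, rCoef η L₁ L₃ b₂ r.2 p.2 *
              tripleCoef η L₂ L₁ L₃ z.1 z.2 c lam 0 r.1 p.1 (r.2 + p.2) := by
        refine Finset.sum_congr rfl fun r _ => ?_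
        congr 1
        simp only [Finset.mul_sum]
        rw [Finset.sum_comm]
        refine Finset.sum_congr rfl fun z _ => Finset.sum_congr rfl fun x _ => ?_
        push_cast; ring
    _ = ∑ r ∈ antidiagonal b₁, qpow η (r.2 * (L₂ - r.1)) *
          ∑ z ∈ antidiagonal (a + b), dynamicalR η L₁ L₂ (lam - L₃ + 2 * c) z.2 z.1 a b *
            ∑ x ∈ antidiagonal (z.2 + c), dynamicalR η L₁ L₃ lam x.2 x.1 z.2 c *
              tripleCoef η L₂ L₃ L₁ z.1 x.1 x.2 lam 0 r.1 r.2 b₂ := by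
        refine Finset.sum_congr rfl fun r _ => ?_
        congr 1
        refine Finset.sum_congr rfl fun z hz => ?_
        rw [tripleCoef_exchange_right hη (f₃ _ _ (mem_antidiagonal.mp hz))]
    _ = ∑ r ∈ antidiagonal b₁, qpow η (r.2 * (L₂ - r.1)) *
          ∑ s ∈ antidiagonal (a + b + c), ∑ mm ∈ antidiagonal s.1,
            ∑ a' ∈ Finset.range (s.2 + mm.2 + 1),
              dynamicalR η L₁ L₂ (lam - (L₃ - 2 * c)) a' mm.1 a b *
              dynamicalR η L₁ L₃ lam s.2 mm.2 a' c *
              tripleCoef η L₂ L₃ L₁ mm.1 mm.2 s.2 lam 0 r.1 r.2 b₂ := by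
        refine Finset.sum_congr rfl fun r _ => ?_
        congr 1
        rw [sum_antidiagonal_intermediate_right a b c fun x y z a' =>
              dynamicalR η L₁ L₂ (lam - (L₃ - 2 * c)) a' x a b * dynamicalR η L₁ L₃ lam z y a' c *
              tripleCoef η L₂ L₃ L₁ x y z lam 0 r.1 r.2 b₂]
        · refine Finset.sum_congr rfl fun z _ => ?_
          rw [Finset.mul_sum]
          refine Finset.sum_congr rfl fun x _ => ?_
          rw [sub_sub_eq_add_sub, add_sub_right_comm, mul_assoc]
        · intro x y z c' h
          rw [dynamicalR_eq_zero η L₁ L₃ _ (by omega), mul_zero, zero_mul]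
    _ = ∑ s ∈ antidiagonal (a + b + c), (∑ mm ∈ antidiagonal s.1,
            ∑ a' ∈ Finset.range (s.2 + mm.2 + 1),
              dynamicalR η L₁ L₂ (lam - (L₃ - 2 * c)) a' mm.1 a b *
              dynamicalR η L₁ L₃ lam s.2 mm.2 a' c) *
              pairCoef η (L₂ + L₃) L₁ s.1 s.2 lam 0 b₁ b₂ := by
        simp only [Finset.mul_sum]
        rw [Finset.sum_comm]
        refine Finset.sum_congr rfl fun s hs => ?_
        rw [Finset.sum_comm, Finset.sum_mul]
        refine Finset.sum_congr rfl fun mm hmm => ?_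
        have hs' := mem_antidiagonal.mp hs
        have hmm' := mem_antidiagonal.mp hmm
        rw [Finset.sum_comm, Finset.sum_mul]
        refine Finset.sum_congr rfl fun c' _ => ?_
        rw [← hmm', pairCoef_fusion_left hη (f₂ _ _ _ (by omega)), Finset.mul_sum]
        refine Finset.sum_congr rfl fun p _ => ?_
        ring

/-! ### Rationality of the dynamical R-matrix -/

/-- The function `f` of `Λ₁, Λ₂, λ` is `q ^ (e λ)` times a rational function of
`q ^ Λ₁, q ^ Λ₂, q ^ (2 λ)`. -/
def IsRat (η : ℂ) (e : ℤ) (f : ℂ → ℂ → ℂ → ℂ) : Prop :=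
  ∃ P Q : MvPolynomial (Fin 3) ℂ, ∀ L₁ L₂ : ℂ, ∀ᶠ lam in codiscrete ℂ,
    MvPolynomial.eval ![qpow η L₁, qpow η L₂, qpow η (2 * lam)] Q ≠ 0 ∧
    f L₁ L₂ lam = qpow η (e * lam) *
      (MvPolynomial.eval ![qpow η L₁, qpow η L₂, qpow η (2 * lam)] P /
        MvPolynomial.eval ![qpow η L₁, qpow η L₂, qpow η (2 * lam)] Q)

theorem IsRat.mul {η : ℂ} {e e' : ℤ} {f g : ℂ → ℂ → ℂ → ℂ} (hf : IsRat η e f) (hg : IsRat η e' g) :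
    IsRat η (e + e') fun L₁ L₂ lam => f L₁ L₂ lam * g L₁ L₂ lam := by
  obtain ⟨P, Q, h⟩ := hf
  obtain ⟨P', Q', h'⟩ := hg
  refine ⟨P * P', Q * Q', fun L₁ L₂ => ?_⟩
  filter_upwards [h L₁ L₂, h' L₁ L₂] with lam h h'
  rw [map_mul, map_mul, h.2, h'.2, Int.cast_add, add_mul, qpow_add]
  refine ⟨mul_ne_zero h.1 h'.1, ?_⟩
  rw [mul_div_mul_comm]; ring

theorem IsRat.add {η : ℂ} {e : ℤ} {f g : ℂ → ℂ → ℂ → ℂ} (hf : IsRat η e f) (hg : IsRat η e g) :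
    IsRat η e fun L₁ L₂ lam => f L₁ L₂ lam + g L₁ L₂ lam := by
  obtain ⟨P, Q, h⟩ := hf
  obtain ⟨P', Q', h'⟩ := hg
  refine ⟨P * Q' + Q * P', Q * Q', fun L₁ L₂ => ?_⟩
  filter_upwards [h L₁ L₂, h' L₁ L₂] with lam h h'
  rw [map_add, map_mul, map_mul, map_mul, h.2, h'.2, ← div_add_div _ _ h.1 h'.1]
  exact ⟨mul_ne_zero h.1 h'.1, by ring⟩

theorem IsRat.inv {η : ℂ} {e : ℤ} {f : ℂ → ℂ → ℂ → ℂ} (hf : IsRat η e f)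
    (h0 : ∀ L₁ L₂, ∀ᶠ lam in codiscrete ℂ, f L₁ L₂ lam ≠ 0) :
    IsRat η (-e) fun L₁ L₂ lam => (f L₁ L₂ lam)⁻¹ := by
  obtain ⟨P, Q, h⟩ := hf
  refine ⟨Q, P, fun L₁ L₂ => ?_⟩
  filter_upwards [h L₁ L₂, h0 L₁ L₂] with lam h h0
  rw [h.2] at h0 ⊢
  refine ⟨fun hP => h0 ?_, ?_⟩
  · rw [hP, zero_div, mul_zero]
  · rw [mul_inv, inv_div, Int.cast_neg, neg_mul, qpow_neg]

theorem IsRat.const (η c : ℂ) : IsRat η 0 fun _ _ _ => c :=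
  ⟨MvPolynomial.C c, 1, fun L₁ L₂ => Eventually.of_forall fun lam => by simp [qpow_zero]⟩

theorem qpow_intCast_mul_eq_div (η x : ℂ) (a : ℤ) :
    qpow η (a * x) = qpow η x ^ a.toNat / qpow η x ^ (-a).toNat := by
  rw [← qpow_natCast_mul, ← qpow_natCast_mul, ← qpow_sub, ← sub_mul]
  congr 2
  exact_mod_cast (Int.toNat_sub_toNat_neg a).symm

theorem isRat_qpow {η : ℂ} (a b c : ℤ) (d : ℂ) {g : ℂ → ℂ → ℂ → ℂ}
    (hg : ∀ L₁ L₂ lam, g L₁ L₂ lam = a * L₁ + b * L₂ + c * lam + d) :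
    IsRat η c fun L₁ L₂ lam => qpow η (g L₁ L₂ lam) := by
  refine ⟨MvPolynomial.C (qpow η d) * (MvPolynomial.X 0 ^ a.toNat * MvPolynomial.X 1 ^ b.toNat),
    MvPolynomial.X 0 ^ (-a).toNat * MvPolynomial.X 1 ^ (-b).toNat, fun L₁ L₂ =>
    Eventually.of_forall fun lam => ?_⟩
  simp only [map_mul, map_pow, MvPolynomial.eval_X, MvPolynomial.eval_C, Matrix.cons_val_zero,
    Matrix.cons_val_one]
  refine ⟨mul_ne_zero (pow_ne_zero _ (qpow_ne_zero _ _)) (pow_ne_zero _ (qpow_ne_zero _ _)), ?_⟩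
  rw [hg, qpow_add, qpow_add, qpow_add, qpow_intCast_mul_eq_div η L₁, qpow_intCast_mul_eq_div η L₂,
    mul_div_assoc, mul_div_mul_comm]
  ring

/-- Even powers of q^λ are absorbed into the third variable q^{2λ}, so only the parity of the
exponent matters. -/
theorem IsRat.add_two_mul {η : ℂ} {e : ℤ} {f : ℂ → ℂ → ℂ → ℂ} (hf : IsRat η e f) (k : ℤ) :
    IsRat η (e + 2 * k) f := by
  obtain ⟨P, Q, h⟩ := hf
  refine ⟨P * MvPolynomial.X 2 ^ (-k).toNat, Q * MvPolynomial.X 2 ^ k.toNat, fun L₁ L₂ => ?_⟩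
  filter_upwards [h L₁ L₂] with lam h
  simp only [map_mul, map_pow, MvPolynomial.eval_X, Matrix.cons_val]
  refine ⟨mul_ne_zero h.1 (pow_ne_zero _ (qpow_ne_zero _ _)), ?_⟩
  have := qpow_intCast_mul_eq_div η (2 * lam) (-k)
  rw [neg_neg] at this
  rw [h.2, mul_div_mul_comm, ← this, mul_comm (_ / _) (qpow η _), ← mul_assoc, ← qpow_add]
  congr 2
  push_cast; ring

theorem IsRat.sub {η : ℂ} {e : ℤ} {f g : ℂ → ℂ → ℂ → ℂ} (hf : IsRat η e f) (hg : IsRat η e g) :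
    IsRat η e fun L₁ L₂ lam => f L₁ L₂ lam - g L₁ L₂ lam := by
  have := hf.add ((IsRat.const η (-1)).mul hg |>.add_two_mul 0 |> fun h => by simpa using h)
  simpa only [sub_eq_add_neg] using this

/-- The exponents of q^λ in the two terms of a q-number are c and -c, of equal parity, which is why
they can be added in the class with exponent c. -/
theorem isRat_qnum {η : ℂ} (a b c : ℤ) (d : ℂ) {g : ℂ → ℂ → ℂ → ℂ}
    (hg : ∀ L₁ L₂ lam, g L₁ L₂ lam = a * L₁ + b * L₂ + c * lam + d) :
    IsRat η c fun L₁ L₂ lam => qnum η (g L₁ L₂ lam) := by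
  have h₁ := isRat_qpow (η := η) a b c d hg
  have h₂ := (isRat_qpow (η := η) (-a) (-b) (-c) (-d) (g := fun L₁ L₂ lam => -g L₁ L₂ lam)
    (fun L₁ L₂ lam => by rw [hg]; push_cast; ring)).add_two_mul c
  rw [show -c + 2 * c = c by ring] at h₂
  have := (h₁.sub h₂).mul (IsRat.const η (qpow η 1 - qpow η (-1))⁻¹)
  rw [add_zero] at this
  exact this

theorem isRat_prod_qnum {η : ℂ} (s : Finset ℕ) (a b c : ℤ) (d : ℕ → ℂ) {g : ℕ → ℂ → ℂ → ℂ → ℂ}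
    (hg : ∀ i L₁ L₂ lam, g i L₁ L₂ lam = a * L₁ + b * L₂ + c * lam + d i) :
    IsRat η (s.card * c) fun L₁ L₂ lam => ∏ i ∈ s, qnum η (g i L₁ L₂ lam) := by
  induction s using Finset.induction_on with
  | empty => simpa using IsRat.const η 1
  | insert i s hi ih =>
    have := (isRat_qnum (η := η) a b c (d i) (hg i)).mul ih
    simp only [Finset.prod_insert hi, Finset.card_insert_of_notMem hi]
    rw [show (((s.card + 1 : ℕ) : ℤ)) * c = c + s.card * c by push_cast; ring]
    exact this

theorem isRat_qpoch {η : ℂ} (k : ℕ) (a b c : ℤ) (d : ℂ) {g : ℂ → ℂ → ℂ → ℂ}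
    (hg : ∀ L₁ L₂ lam, g L₁ L₂ lam = a * L₁ + b * L₂ + c * lam + d) :
    IsRat η (k * c) fun L₁ L₂ lam => qpoch η (g L₁ L₂ lam) k := by
  have := isRat_prod_qnum (η := η) (Finset.range k) a b c (fun i => d + i)
    (g := fun i L₁ L₂ lam => g L₁ L₂ lam + i) (fun i L₁ L₂ lam => by rw [hg]; ring)
  rwa [Finset.card_range] at this

theorem eventually_qpoch_ne_zero {η : ℂ} (hη : 0 < η.im) (c : ℂ) (k : ℕ) :
    ∀ᶠ lam in codiscrete ℂ, qpoch η (lam + c) k ≠ 0 := by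
  filter_upwards [eventually_qnum_int_ne_zero hη c k] with lam h
  refine Finset.prod_ne_zero_iff.mpr fun s hs => ?_
  exact_mod_cast h s (by have := Finset.mem_range.mp hs; rw [Nat.abs_cast]; omega)

theorem eventually_qpoch_neg_ne_zero {η : ℂ} (hη : 0 < η.im) (c : ℂ) (k : ℕ) :
    ∀ᶠ lam in codiscrete ℂ, qpoch η (-lam + c) k ≠ 0 := by
  filter_upwards [eventually_qpoch_ne_zero hη (-c - k + 1) k] with lam h
  rw [show -lam + c = -(lam - c) by ring, qpoch_neg_reflect]
  refine mul_ne_zero (pow_ne_zero _ (by norm_num)) ?_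
  rwa [show lam - c - k + 1 = lam + (-c - k + 1) by ring]

theorem IsRat.sum {η : ℂ} {e : ℤ} (s : Finset ℕ) {f : ℕ → ℂ → ℂ → ℂ → ℂ}
    (h : ∀ i ∈ s, IsRat η e (f i)) : IsRat η e fun L₁ L₂ lam => ∑ i ∈ s, f i L₁ L₂ lam := by
  induction s using Finset.induction_on with
  | empty =>
    refine ⟨0, 1, fun L₁ L₂ => Eventually.of_forall fun lam => by simp⟩
  | insert i s hi ih =>
    simp only [Finset.sum_insert hi]
    exact (h i (Finset.mem_insert_self i s)).add (ih fun j hj => h j (Finset.mem_insert_of_mem hj))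

theorem isRat_dynamicalR {η : ℂ} (hη : 0 < η.im) (m₁ m₂ n₁ n₂ : ℕ) :
    IsRat η 0 fun L₁ L₂ lam => dynamicalR η L₁ L₂ lam m₁ m₂ n₁ n₂ := by
  by_cases hm : m₁ + m₂ = n₁ + n₂
  swap
  · simpa only [dynamicalR, if_neg hm] using IsRat.const η 0
  simp only [dynamicalR, if_pos hm]
  refine IsRat.sum _ fun p hp => ?_
  have hp' := Finset.mem_Icc.mp hp
  have r₁ := isRat_qpoch (η := η) n₁ 1 1 (-1) (-(2 * (m₁ + m₂ : ℕ)) + 1)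
    (g := fun L₁ L₂ lam => -(lam - L₁ - L₂ + 2 * (m₁ + m₂ : ℕ)) + 1)
    (fun L₁ L₂ lam => by push_cast; ring)
  have r₂ := (isRat_qpoch (η := η) m₂ 1 1 (-1) (-(2 * (m₁ + m₂ : ℕ)) + 1)
    (g := fun L₁ L₂ lam => -(lam - L₁ - L₂ + 2 * (m₁ + m₂ : ℕ)) + 1)
    (fun L₁ L₂ lam => by push_cast; ring)).inv fun L₁ L₂ => by
      filter_upwards [eventually_qpoch_neg_ne_zero hη (L₁ + L₂ - 2 * (m₁ + m₂ : ℕ) + 1) m₂] with lam h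
      rwa [show -(lam - L₁ - L₂ + 2 * ((m₁ + m₂ : ℕ) : ℂ)) + 1 =
        -lam + (L₁ + L₂ - 2 * (m₁ + m₂ : ℕ) + 1) by ring]
  have r₃ := isRat_qpow (η := η) 0 (p - n₁ : ℕ) (-(p - n₁ : ℕ))
    (-((p - n₁ : ℕ) * (2 * n₂ - (p - n₁ : ℕ))))
    (g := fun L₁ L₂ lam => -((p - n₁ : ℕ) * (lam - L₂ + 2 * n₂ - (p - n₁ : ℕ))))
    (fun L₁ L₂ lam => by push_cast; ring)
  have r₄ := isRat_qpoch (η := η) (m₁ + m₂ - p) 0 1 (-1) (-(2 * n₂) + (p - n₁ : ℕ) + 1)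
    (g := fun L₁ L₂ lam => -(lam - L₂ + 2 * n₂) + (p - n₁ : ℕ) + 1)
    (fun L₁ L₂ lam => by push_cast; ring)
  have r₅ := isRat_prod_qnum (η := η) (Finset.Ico n₁ p) 1 0 0 (fun s => -s)
    (g := fun s L₁ L₂ lam => L₁ - s) (fun s L₁ L₂ lam => by push_cast; ring)
  have r₆ := isRat_qpow (η := η) (-(m₁ + m₂ - p : ℕ)) (-p) 0 (2 * p * (m₁ + m₂ - p : ℕ))
    (g := fun L₁ L₂ lam => -(p * L₂) - (m₁ + m₂ - p : ℕ) * L₁ + 2 * p * (m₁ + m₂ - p : ℕ))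
    (fun L₁ L₂ lam => by push_cast; ring)
  have r₇ := isRat_prod_qnum (η := η) (Finset.Ioc m₁ p) 0 1 0 (fun s => -(m₁ + m₂ : ℕ) + s)
    (g := fun s L₁ L₂ lam => L₂ - (m₁ + m₂ : ℕ) + s) (fun s L₁ L₂ lam => by push_cast; ring)
  have r₈ := isRat_qpow (η := η) (-(p - m₁ : ℕ)) 0 (p - m₁ : ℕ) ((p - m₁ : ℕ) * (p + m₁))
    (g := fun L₁ L₂ lam => (p - m₁ : ℕ) * (lam - L₁ + p + m₁)) (fun L₁ L₂ lam => by push_cast; ring)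
  have r₉ := isRat_qnum (η := η) (-1) 0 1 (2 * m₁) (g := fun L₁ L₂ lam => lam - L₁ + 2 * m₁)
    (fun L₁ L₂ lam => by push_cast; ring)
  have r₀ := (isRat_qpoch (η := η) (p + 1) (-1) 0 1 m₁ (g := fun L₁ L₂ lam => lam - L₁ + m₁)
    (fun L₁ L₂ lam => by push_cast; ring)).inv fun L₁ L₂ => by
      filter_upwards [eventually_qpoch_ne_zero hη (-L₁ + m₁) (p + 1)] with lam h
      rwa [show lam - L₁ + (m₁ : ℂ) = lam + (-L₁ + m₁) by ring]
  -- The exponents of q^λ of the factors add up to -2m₁, independently of p, and the final shift by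
  -- 2m₁ brings the total to zero.
  have := (((((((((((IsRat.const η ((-1) ^ m₁ * (qfact η (p - n₁))⁻¹ *
    (qfact η n₂ / qfact η (m₁ + m₂ - p)) * (qfact η p / qfact η m₁) * (qfact η (p - m₁))⁻¹)).mul
    r₁).mul r₂).mul r₃).mul r₄).mul r₅).mul r₆).mul r₇).mul r₈).mul r₉).mul r₀).add_two_mul m₁
  convert this using 1
  · push_cast [Nat.cast_sub (show p ≤ m₁ + m₂ by omega), Nat.cast_sub (show n₁ ≤ p by omega),
      Nat.cast_sub (show m₁ ≤ p by omega)]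
    ring
  · funext L₁ L₂ lam
    simp only [div_eq_mul_inv, mul_inv]
    ring

/-- Every p in the sum satisfies n₁ ≤ L < m₁ ≤ p, so the product of the [Λ₁ - s] with n₁ ≤ s < p
contains s = L. -/
theorem dynamicalR_vanish_left (η : ℂ) (L : ℕ) (L₂ lam : ℂ) {m₁ m₂ n₁ n₂ : ℕ} (hn : n₁ ≤ L)
    (hm : L < m₁) : dynamicalR η L L₂ lam m₁ m₂ n₁ n₂ = 0 := by
  rw [dynamicalR]
  split_ifs
  · refine Finset.sum_eq_zero fun p hp => ?_
    have := Finset.mem_Icc.mp hp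
    rw [Finset.prod_eq_zero (i := L) (Finset.mem_Ico.mpr (by omega)) (by rw [sub_self, qnum_zero])]
    ring
  · rfl

/-- With N = m₁ + m₂ one has m₁ < N - L ≤ n₁ ≤ p, so the product of the [Λ₂ - N + s] contains the
vanishing factor s = N - L. -/
theorem dynamicalR_vanish_right (η L₁ : ℂ) (L : ℕ) (lam : ℂ) {m₁ m₂ n₁ n₂ : ℕ} (hn : n₂ ≤ L)
    (hm : L < m₂) : dynamicalR η L₁ L lam m₁ m₂ n₁ n₂ = 0 := by
  rw [dynamicalR]
  split_ifs
  · refine Finset.sum_eq_zero fun p hp => ?_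
    have := Finset.mem_Icc.mp hp
    rw [Finset.prod_eq_zero (s := Finset.Ioc m₁ p) (i := m₁ + m₂ - L)
      (Finset.mem_Ioc.mpr (by omega))
      (by rw [Nat.cast_sub (by omega), sub_add_sub_cancel, sub_self, qnum_zero])]
    ring
  · rfl

/-- Only the entry from (0, 1) to (0, 1) receives two nonzero contributions, p = 0 and p = 1; for
(1, 1) the term p = 2 contains [0]. -/
theorem dynamicalR_fundamental {η : ℂ} (hη : 0 < η.im) {lam : ℂ} (h₀ : qnum η lam ≠ 0)
    (h₁ : qnum η (lam - 1) ≠ 0) (h₂ : qnum η (lam + 1) ≠ 0) :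
    dynamicalR η 1 1 lam 0 0 0 0 = 1 ∧ dynamicalR η 1 1 lam 1 1 1 1 = 1 ∧
    dynamicalR η 1 1 lam 0 1 0 1 = qpow η (-1) * qnum η (lam + 1) / qnum η lam ∧
    dynamicalR η 1 1 lam 1 0 0 1 = -(qpow η (-lam - 1) / qnum η lam) ∧
    dynamicalR η 1 1 lam 0 1 1 0 = qpow η (lam - 1) / qnum η lam ∧
    dynamicalR η 1 1 lam 1 0 1 0 = qpow η (-1) * qnum η (lam - 1) / qnum η lam := by
  have q1 := qnum_one hη
  have e₁ : Finset.Icc 0 1 = {0, 1} := rfl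
  have e₂ : Finset.Icc 1 2 = {1, 2} := rfl
  have a₁ : qnum η (-2 + (1 - (lam - 1)) + 1) = -qnum η (lam - 1) := by rw [← qnum_neg]; ring_nf
  have a₃ : qnum η (-(2 * 2) + (1 - (lam - 1)) + 1) = -qnum η (lam + 1) := by
    rw [← qnum_neg]; ring_nf
  have a₄ : lam - 1 + 2 = lam + 1 := by ring
  have a₅ : qpow η (-1 - 1 + 2) = 1 := by norm_num [qpow_zero]
  refine ⟨?_, ?_, ?_, ?_, ?_, ?_⟩
  · simp [dynamicalR, qpoch, qfact, qpow_zero, div_self h₁]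
  · simp only [dynamicalR, if_true]
    simp [qpoch, qfact, e₂, q1, Finset.prod_range_succ, qnum_zero, qnum_neg, qpow_zero, a₃, a₄, a₅]
    field_simp
  · have c := qnum_commutator hη (lam - 1) lam
    rw [sub_add_cancel, sub_sub_cancel, q1] at c
    have e : qpow η (-lam) * qpow η lam = 1 := by
      rw [← qpow_add, ← qpow_zero η]; ring_nf
    simp only [dynamicalR, if_true, zero_add]
    simp [qpoch, qfact, qpow_zero, e₁, q1, qnum_neg, a₁, a₄, Finset.prod_range_succ]
    generalize qpow η (-lam) = u at *
    generalize qpow η lam = v at *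
    generalize qnum η (lam + 1) = x at *
    generalize qnum η (lam - 1) = y at *
    field_simp
    linear_combination qpow η (-1) * (c - e)
  · have e : qpow η (-lam) * qpow η (-1) = qpow η (-lam - 1) := by
      rw [← qpow_add]; ring_nf
    simp [dynamicalR, qpoch, qfact, qpow_zero, q1, Finset.prod_range_succ, a₄, e]
    field_simp
  · have e : qpow η (-1) * qpow η lam = qpow η (lam - 1) := by
      rw [← qpow_add]; ring_nf
    simp [dynamicalR, qpoch, qfact, qpow_zero, q1, Finset.prod_range_succ, a₁, ← e]
    field_simp
  · simp [dynamicalR, qpoch, qfact, qpow_zero, q1, Finset.prod_range_succ, a₁, a₄]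
    field_simp

/-- The explicit dynamical R-matrix has the properties which single out the dynamical R-matrix. -/
theorem isDynamicalRMatrix_dynamicalR {η : ℂ} (hη : 0 < η.im) :
    IsDynamicalRMatrix η (dynamicalR η) where
  weight _ _ _ _ _ _ _ h := dynamicalR_eq_zero _ _ _ _ h
  rational m₁ m₂ n₁ n₂ := by
    obtain ⟨P, Q, h⟩ := isRat_dynamicalR hη m₁ m₂ n₁ n₂
    refine ⟨P, Q, fun L₁ L₂ => ?_⟩
    simpa only [Int.cast_zero, zero_mul, qpow_zero, one_mul] using h L₁ L₂
  fusion_left := dynamicalR_fusion_left hη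
  fusion_right := dynamicalR_fusion_right hη
  vanish_left L L₂ _ _ _ _ hn hm :=
    Eventually.of_forall fun lam => dynamicalR_vanish_left η L L₂ lam hn hm
  vanish_right L₁ L _ _ _ _ hn hm :=
    Eventually.of_forall fun lam => dynamicalR_vanish_right η L₁ L lam hn hm
  fundamental := by
    filter_upwards [eventually_qnum_ne_zero hη 0, eventually_qnum_ne_zero hη (-1),
      eventually_qnum_ne_zero hη 1] with lam h₀ h₁ h₂
    rw [add_zero] at h₀
    exact dynamicalR_fundamental hη h₀ (by rwa [sub_eq_add_neg]) h₂

/-! ### Matrix elements of compositions of intertwining operators -/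

theorem dualE_pow_single {η : ℂ} (hη : 0 < η.im) {m i : ℕ} (hi : i ≤ m) :
    ((dualE η) ^ i) (Finsupp.single m 1) = Finsupp.single (m - i) (qfact η m / qfact η (m - i)) := by
  induction i with
  | zero => simp [div_self (qfact_ne_zero hη m)]
  | succ i ih =>
    obtain ⟨d, rfl⟩ : ∃ d, m = d + 1 + i := ⟨m - (i + 1), by omega⟩
    rw [pow_succ', Module.End.mul_apply, ih (by omega), show d + 1 + i - i = d + 1 by omega,
      show d + 1 + i - (i + 1) = d by omega, dualE, Finsupp.linearCombination_single,
      Finsupp.smul_single, smul_eq_mul, qfact_succ η d]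
    congr 1
    have := qfact_ne_zero hη d
    have := qnum_natCast_succ_ne_zero hη d
    field_simp

theorem singularVec_eq {η : ℂ} (hη : 0 < η.im) (L : ℂ) (m : ℕ) (lam : ℂ) :
    singularVec η L m lam =
      ∑ i ∈ Finset.range (m + 1), Finsupp.single (i, m - i) (singCoef η L m lam i) := by
  refine Finset.sum_congr rfl fun i hi => ?_
  have := Finset.mem_range.mp hi
  rw [dualE_pow_single hη (by omega), Finsupp.mapDomain_single, Finsupp.smul_single, smul_eq_mul,
    singCoef]

theorem singularVec_apply {η : ℂ} (hη : 0 < η.im) (L : ℂ) (m : ℕ) (lam : ℂ) (l b : ℕ) :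
    singularVec η L m lam (l, b) = if l + b = m then polyCoef η L m lam 0 b else 0 := by
  rw [singularVec_eq hη, Finsupp.finsetSum_apply]
  simp only [Finsupp.single_apply, Prod.mk.injEq]
  split_ifs with h
  · subst h
    rw [Finset.sum_eq_single l]
    · have := polyCoef_zero_left hη L (l + b) lam (i := l) (by omega)
      rw [show ((l + b : ℕ) : ℤ) - l = b by push_cast; ring] at this
      rw [if_pos ⟨rfl, by omega⟩, this]
    · intro i _ hi
      rw [if_neg fun h => hi h.1]
    · intro hl
      exact absurd (Finset.mem_range.mpr (by omega)) hl
  · refine Finset.sum_eq_zero fun i hi => if_neg fun h' => h ?_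
    have := Finset.mem_range.mp hi
    omega

/-- At l = 0 the truncated index l - 1 is harmless because [0] = 0. At b = 0 the coefficient [Λ + 1]
need not vanish, so this case is separated. -/
theorem deltaF_apply (η L : ℂ) (f : ℕ × ℕ →₀ ℂ) (l b : ℕ) :
    deltaF η L f (l, b) = qnum η l * qpow η (-(L - 2 * b)) * f (l - 1, b) +
      if b = 0 then 0 else qnum η (L - b + 1) * f (l, b - 1) := by
  induction f using Finsupp.induction_linear with
  | zero => simp
  | add f g hf hg =>
    rw [map_add, Finsupp.add_apply, hf, hg, Finsupp.add_apply, Finsupp.add_apply]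
    split_ifs <;> ring_nf
  | single ac r =>
    obtain ⟨a, c⟩ := ac
    rw [deltaF, Finsupp.linearCombination_single]
    simp only [Finsupp.smul_apply, Finsupp.add_apply, Finsupp.single_apply, Prod.mk.injEq, smul_eq_mul]
    rcases l with _ | l <;> rcases b with _ | b <;>
      simp only [Nat.cast_zero, qnum_zero, Nat.add_sub_cancel, Nat.cast_add, Nat.cast_one,
        add_left_inj, Nat.add_eq_zero_iff, one_ne_zero, and_false, false_and, if_true, if_false]
    · simp
    · by_cases h : a = 0 ∧ c = b
      · obtain ⟨rfl, rfl⟩ := h; simp; ring_nf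
      · simp [h]
    · by_cases h : a = l ∧ c = 0
      · obtain ⟨rfl, rfl⟩ := h; simp; ring_nf
      · simp [h]
    · by_cases h : a = l ∧ c = b + 1
      · obtain ⟨rfl, rfl⟩ := h; simp; ring_nf
      · by_cases h' : a = l + 1 ∧ c = b
        · obtain ⟨rfl, rfl⟩ := h'; simp; ring_nf
        · simp [h, h']

theorem Phi1_single (η L : ℂ) (m : ℕ) (lam : ℂ) (k : ℕ) :
    Phi1 η L m lam (Finsupp.single k 1) =
      (qfact η k)⁻¹ • ((deltaF η L) ^ k) (singularVec η L m lam) := by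
  rw [Phi1, Finsupp.linearCombination_single, one_smul]

theorem Phi1_single_succ {η : ℂ} (hη : 0 < η.im) (L : ℂ) (m : ℕ) (lam : ℂ) (k : ℕ) :
    qnum η (k + 1) • Phi1 η L m lam (Finsupp.single (k + 1) 1) =
      deltaF η L (Phi1 η L m lam (Finsupp.single k 1)) := by
  have h₁ := qfact_ne_zero hη k
  have h₂ := qnum_natCast_succ_ne_zero hη k
  rw [Phi1_single, Phi1_single, map_smul, pow_succ', Module.End.mul_apply, smul_smul, qfact_succ]
  congr 1
  field_simp

/-- The matrix elements of an intertwining operator. -/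
theorem Phi1_apply {η : ℂ} (hη : 0 < η.im) (L : ℂ) (m : ℕ) (lam : ℂ) (k l b : ℕ) :
    Phi1 η L m lam (Finsupp.single k 1) (l, b) =
      if l + b = k + m then tcoef η L m lam k b else 0 := by
  -- The induction on k compares the action of Δ(F) with `polyCoef_F`; the truncation in `tcoef`
  -- plays no role since l is a natural number.
  have key : Phi1 η L m lam (Finsupp.single k 1) (l, b) =
      if l + b = k + m then polyCoef η L m lam k b else 0 := by
    induction k generalizing l b with
    | zero =>
      rw [Phi1_single, pow_zero, Module.End.one_apply, qfact_zero, inv_one, one_smul,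
        singularVec_apply hη, zero_add]
      rfl
    | succ k ih =>
      have h := congrArg (fun f => f (l, b)) (Phi1_single_succ hη L m lam k)
      simp only [Finsupp.smul_apply, smul_eq_mul] at h
      rw [deltaF_apply, ih, ih] at h
      apply mul_left_cancel₀ (qnum_natCast_succ_ne_zero hη k)
      rw [h]
      by_cases c : l + b = k + 1 + m
      · have t₁ : (if l - 1 + b = k + m then polyCoef η L m lam k b else 0) * qnum η l =
            qnum η l * polyCoef η L m lam k b := by
          rcases l with _ | l
          · simp [qnum_zero]
          · rw [if_pos (by omega), mul_comm]
        have t₂ : (if b = 0 then 0 else qnum η (L - b + 1) *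
            if l + (b - 1) = k + m then polyCoef η L m lam k ((b - 1 : ℕ) : ℤ) else 0) =
            qnum η (L - b + 1) * polyCoef η L m lam k ((b : ℤ) - 1) := by
          rcases b with _ | b
          · rw [polyCoef_of_neg (b := ((0 : ℕ) : ℤ) - 1) _ _ _ _ (by norm_num)]; simp
          · rw [if_neg (by omega), if_pos (by omega), Nat.add_sub_cancel,
              show ((b + 1 : ℕ) : ℤ) - 1 = b by push_cast; ring]
        have hF := polyCoef_F hη L m lam k b
        have hl : (k : ℂ) + 1 + m - b = l := by rw [sub_eq_iff_eq_add]; exact_mod_cast c.symm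
        push_cast at hF t₂ ⊢
        rw [if_pos c, hF, t₂, hl]
        linear_combination qpow η (-(L - 2 * b)) * t₁
      · rw [if_neg c]
        rcases l with _ | l <;> rcases b with _ | b
        · simp [qnum_zero]
        · rw [if_neg (show b + 1 ≠ 0 by omega), if_neg (show ¬0 + (b + 1 - 1) = k + m by omega)]
          simp [qnum_zero]
        · rw [if_neg (by omega)]; simp
        · rw [if_neg (by omega), if_neg (by omega), if_neg (by omega)]; simp
  rw [key]
  split_ifs with h
  · rw [tcoef_of_nonneg _ _ _ _ (by omega)]
  · rfl

/-- The matrix element from `v^{(k)}` to `v^{(l)} ⊗ u_{b_1} ⊗ ⋯ ⊗ u_{b_n}` of a composition of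
intertwining operators, where `l = k + ∑ (m_i - b_i)`. -/
def chainCoef (η : ℂ) : (n : ℕ) → (Fin n → ℂ) → (Fin n → ℕ) → ℂ → ℤ → (Fin n → ℕ) → ℂ
  | 0, _, _, _, _, _ => 1
  | n + 1, L, m, lam, k, b =>
    tcoef η (L (Fin.last n)) (m (Fin.last n)) lam k (b (Fin.last n)) *
      chainCoef η n (Fin.init L) (Fin.init m) (lam - L (Fin.last n) + 2 * m (Fin.last n))
        (k + m (Fin.last n) - b (Fin.last n)) (Fin.init b)

theorem Phi_apply {η : ℂ} (hη : 0 < η.im) (n : ℕ) (L : Fin n → ℂ) (m : Fin n → ℕ) (lam : ℂ) (k l : ℕ)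
    (b : Fin n → ℕ) : Phi η n L m lam (Finsupp.single k 1) (l, b) =
      if l + ∑ i, b i = k + ∑ i, m i then chainCoef η n L m lam k b else 0 := by
  induction n generalizing lam k l with
  | zero =>
    rw [Phi, Finsupp.lmapDomain_apply, Finsupp.mapDomain_single, Finsupp.single_apply]
    simp only [Prod.mk.injEq, Finset.univ_eq_empty, Finset.sum_empty, add_zero, chainCoef,
      eq_comm (a := k), and_iff_left (Subsingleton.elim Fin.elim0 b)]
  | succ n ih =>
    rw [Phi, LinearMap.comp_apply, Finsupp.linearCombination_apply, Finsupp.sum,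
      Finsupp.finsetSum_apply]
    have h : ∀ ka : ℕ × ℕ, (Phi1 η (L (Fin.last n)) (m (Fin.last n)) lam (Finsupp.single k 1) ka •
        Finsupp.mapDomain
          (fun lb : ℕ × (Fin n → ℕ) => (lb.1, (Fin.snoc lb.2 ka.2 : Fin (n + 1) → ℕ)))
          (Phi η n (Fin.init L) (Fin.init m) (lam - L (Fin.last n) + 2 * m (Fin.last n))
          (Finsupp.single ka.1 1))) (l, b) =
        if ka.2 = b (Fin.last n) then
          Phi1 η (L (Fin.last n)) (m (Fin.last n)) lam (Finsupp.single k 1) ka *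
          Phi η n (Fin.init L) (Fin.init m) (lam - L (Fin.last n) + 2 * m (Fin.last n))
          (Finsupp.single ka.1 1) (l, Fin.init b) else 0 := by
      intro ka
      rw [Finsupp.smul_apply, smul_eq_mul]
      split_ifs with hc
      · congr 1
        have hb : (l, b) = (fun lb : ℕ × (Fin n → ℕ) =>
            (lb.1, (Fin.snoc lb.2 ka.2 : Fin (n + 1) → ℕ))) (l, Fin.init b) := by
          simp only [hc, Fin.snoc_init_self]
        rw [hb, Finsupp.mapDomain_apply]
        rintro ⟨x, y⟩ ⟨x', y'⟩ hxy
        simp only [Prod.mk.injEq] at hxy ⊢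
        exact ⟨hxy.1, by simpa using congrArg Fin.init hxy.2⟩
      · rw [Finsupp.mapDomain_of_notMem_range, mul_zero]
        rintro ⟨⟨x, y⟩, hxy⟩
        simp only [Prod.mk.injEq] at hxy
        apply hc
        rw [← hxy.2, Fin.snoc_last]
    simp only [h]
    rw [Fin.sum_univ_castSucc, Fin.sum_univ_castSucc, chainCoef]
    by_cases hk : b (Fin.last n) ≤ k + m (Fin.last n)
    · obtain ⟨l', hl'⟩ := Nat.exists_eq_add_of_le hk
      -- The last dual index is prescribed and weight conservation fixes the intermediate index l',
      -- so a single intermediate vector contributes.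
      rw [Finset.sum_eq_single (l', b (Fin.last n)), if_pos rfl, Phi1_apply hη, if_pos (by omega), ih,
        show (k : ℤ) + m (Fin.last n) - b (Fin.last n) = l' by omega]
      · have hb : ∑ i, Fin.init b i = ∑ i : Fin n, b i.castSucc := rfl
        have hm : ∑ i, Fin.init m i = ∑ i : Fin n, m i.castSucc := rfl
        by_cases hs : l + ∑ i, Fin.init b i = l' + ∑ i, Fin.init m i
        · rw [if_pos hs, if_pos (by omega)]
        · rw [if_neg hs, if_neg (by omega), mul_zero]
      · rintro ⟨x, y⟩ _ hne
        split_ifs with hy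
        · simp only at hy
          subst hy
          rw [Phi1_apply hη, if_neg, zero_mul]
          intro hx
          exact hne (by simp; omega)
        · rfl
      · intro hns
        rw [if_pos rfl, Finsupp.notMem_support_iff.mp hns, zero_mul]
    · rw [tcoef_of_neg_out _ _ _ _ (by omega), zero_mul, ite_self]
      refine Finset.sum_eq_zero fun ka _ => ?_
      split_ifs with hc
      · obtain ⟨x, y⟩ := ka
        rw [Phi1_apply hη, if_neg, zero_mul]
        simp only at hc
        omega
      · rfl

/-- The analogue of `chainCoef` with quasi-polynomials in `q ^ k`. -/
def polyChain (η : ℂ) : (n : ℕ) → (Fin n → ℂ) → (Fin n → ℕ) → ℂ → ℤ → (Fin n → ℕ) → ℂ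
  | 0, _, _, _, _, _ => 1
  | n + 1, L, m, lam, k, b =>
    polyCoef η (L (Fin.last n)) (m (Fin.last n)) lam k (b (Fin.last n)) *
      polyChain η n (Fin.init L) (Fin.init m) (lam - L (Fin.last n) + 2 * m (Fin.last n))
        (k + m (Fin.last n) - b (Fin.last n)) (Fin.init b)

/-- A chain of indices that starts negative and ends nonnegative must cross zero upwards at some
operator, and the matrix element of that operator vanishes by `polyCoef_eq_zero`. -/
theorem polyChain_eq_zero (η : ℂ) (n : ℕ) (L : Fin n → ℂ) (m : Fin n → ℕ) (lam : ℂ) (k : ℤ)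
    (b : Fin n → ℕ) (hk : k < 0) (hl : 0 ≤ k + ∑ i, (m i : ℤ) - ∑ i, (b i : ℤ)) :
    polyChain η n L m lam k b = 0 := by
  induction n generalizing lam k with
  | zero => simp at hl; omega
  | succ n ih =>
    rw [polyChain]
    rw [Fin.sum_univ_castSucc, Fin.sum_univ_castSucc] at hl
    rcases lt_or_ge (k + m (Fin.last n) - b (Fin.last n)) 0 with h | h
    · rw [ih _ _ _ _ _ h (by simp only [Fin.init]; omega), mul_zero]
    · rw [polyCoef_eq_zero _ _ _ _ hk h, zero_mul]

/-- Once an intermediate index is negative, the untruncated product also vanishes, because the final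
index is nonnegative. Truncation is thus invisible, and the trace can be summed as a series of
quasi-polynomials. -/
theorem chainCoef_eq_polyChain (η : ℂ) (n : ℕ) (L : Fin n → ℂ) (m : Fin n → ℕ) (lam : ℂ) (k : ℤ)
    (b : Fin n → ℕ) (hl : 0 ≤ k + ∑ i, (m i : ℤ) - ∑ i, (b i : ℤ)) :
    chainCoef η n L m lam k b = polyChain η n L m lam k b := by
  induction n generalizing lam k with
  | zero => rfl
  | succ n ih =>
    rw [polyChain, chainCoef]
    rw [Fin.sum_univ_castSucc, Fin.sum_univ_castSucc] at hl
    have hl' : 0 ≤ k + m (Fin.last n) - b (Fin.last n) +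
        ∑ i, (Fin.init m i : ℤ) - ∑ i, (Fin.init b i : ℤ) := by
      simp only [Fin.init]; omega
    rcases lt_or_ge (k + m (Fin.last n) - b (Fin.last n)) 0 with h | h
    · rw [polyChain_eq_zero _ _ _ _ _ _ _ h hl', tcoef_of_neg_out _ _ _ _ h, zero_mul, mul_zero]
    · rw [tcoef_of_nonneg _ _ _ _ h, ih _ _ _ _ _ hl']

/-- The function `f` of `k` is `q ^ (e k)` times a polynomial of degree at most `d` in `q ^ (-2 k)`. -/
def IsQuasiPoly (η e : ℂ) (d : ℕ) (f : ℤ → ℂ) : Prop :=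
  ∃ p : Polynomial ℂ, p.natDegree ≤ d ∧ ∀ k : ℤ, f k = qpow η (e * k) * p.eval (qpow η (-(2 * k)))

theorem IsQuasiPoly.mul {η e e' : ℂ} {d d' : ℕ} {f g : ℤ → ℂ} (hf : IsQuasiPoly η e d f)
    (hg : IsQuasiPoly η e' d' g) : IsQuasiPoly η (e + e') (d + d') fun k => f k * g k := by
  obtain ⟨p, hp, h⟩ := hf
  obtain ⟨p', hp', h'⟩ := hg
  refine ⟨p * p', Polynomial.natDegree_mul_le.trans (add_le_add hp hp'), fun k => ?_⟩
  beta_reduce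
  rw [h, h', Polynomial.eval_mul, add_mul, qpow_add]; ring

theorem IsQuasiPoly.shift {η e : ℂ} {d : ℕ} {f : ℤ → ℂ} (hf : IsQuasiPoly η e d f) (c : ℤ) :
    IsQuasiPoly η e d fun k => f (k + c) := by
  obtain ⟨p, hp, h⟩ := hf
  refine ⟨Polynomial.C (qpow η (e * c)) * p.comp (Polynomial.C (qpow η (-(2 * c))) * Polynomial.X),
    ?_, fun k => ?_⟩
  · refine (Polynomial.natDegree_C_mul_le _ _).trans (Polynomial.natDegree_comp_le.trans ?_)
    calc p.natDegree * _ ≤ p.natDegree * 1 :=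
          Nat.mul_le_mul_left _ ((Polynomial.natDegree_C_mul_le _ _).trans Polynomial.natDegree_X_le)
      _ ≤ d := by omega
  · beta_reduce
    rw [h, Polynomial.eval_mul, Polynomial.eval_comp, Polynomial.eval_mul, Polynomial.eval_C,
      Polynomial.eval_C, Polynomial.eval_X, ← qpow_add, ← mul_assoc, ← qpow_add]
    push_cast
    congr 2 <;> ring_nf

theorem IsQuasiPoly.mono {η e : ℂ} {d d' : ℕ} {f : ℤ → ℂ} (hf : IsQuasiPoly η e d f) (h : d ≤ d') :
    IsQuasiPoly η e d' f := by
  obtain ⟨p, hp, hf⟩ := hf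
  exact ⟨p, hp.trans h, hf⟩

theorem IsQuasiPoly.sum {η e : ℂ} {d : ℕ} (s : Finset ℕ) {f : ℕ → ℤ → ℂ}
    (h : ∀ i ∈ s, IsQuasiPoly η e d (f i)) : IsQuasiPoly η e d fun k => ∑ i ∈ s, f i k := by
  induction s using Finset.induction_on with
  | empty => exact ⟨0, by simp, fun k => by simp⟩
  | insert i s hi ih =>
    obtain ⟨p, hp, h₁⟩ := h i (Finset.mem_insert_self i s)
    obtain ⟨p', hp', h₂⟩ := ih fun j hj => h j (Finset.mem_insert_of_mem hj)
    refine ⟨p + p', Polynomial.natDegree_add_le_of_degree_le hp hp', fun k => ?_⟩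
    beta_reduce at h₂ ⊢
    rw [Finset.sum_insert hi, h₁, h₂, Polynomial.eval_add, mul_add]

theorem isQuasiPoly_qpow (η a c : ℂ) : IsQuasiPoly η a 0 fun k => qpow η (a * k) * c :=
  ⟨Polynomial.C c, by simp, fun k => by simp⟩

theorem isQuasiPoly_qnum (η : ℂ) (c : ℂ) : IsQuasiPoly η 1 1 fun k => qnum η (k + c) := by
  refine ⟨Polynomial.C (qpow η c / (qpow η 1 - qpow η (-1))) -
    Polynomial.C (qpow η (-c) / (qpow η 1 - qpow η (-1))) * Polynomial.X, ?_, fun k => ?_⟩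
  · refine (Polynomial.natDegree_sub_le _ _).trans (max_le (by simp) ?_)
    exact (Polynomial.natDegree_C_mul_le _ _).trans Polynomial.natDegree_X_le
  · have h₁ : qpow η (-(k + c)) = qpow η (1 * k) * (qpow η (-c) * qpow η (-(2 * k))) := by
      rw [← qpow_add, ← qpow_add]; ring_nf
    beta_reduce
    rw [qnum, h₁, qpow_add, Polynomial.eval_sub, Polynomial.eval_mul, Polynomial.eval_C,
      Polynomial.eval_C, Polynomial.eval_X, one_mul]
    ring

theorem isQuasiPoly_dfall (η : ℂ) (c : ℂ) (i : ℕ) :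
    IsQuasiPoly η i i fun k => dfall η (k + c) i := by
  have h : ∀ s : ℕ, IsQuasiPoly η s s fun k => ∏ t ∈ Finset.range s, qnum η (k + c - t) := by
    intro s
    induction s with
    | zero => exact ⟨1, by simp, fun k => by simp [qpow_zero]⟩
    | succ s ih =>
      have := ih.mul (isQuasiPoly_qnum η (c - s))
      simp only [Finset.prod_range_succ]
      push_cast
      simpa only [add_sub_assoc] using this
  simp only [dfall_natCast]
  have := (h i).mul (isQuasiPoly_qpow η 0 (qfact η i)⁻¹)
  simpa only [add_zero, zero_mul, qpow_zero, one_mul, div_eq_mul_inv] using this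

/-- In the i-th summand the power of q contributes the exponent -Λ + m + b - i and the q-binomial
contributes i. The total does not depend on i, and the degree is at most i ≤ m. -/
theorem isQuasiPoly_polyCoef (η L : ℂ) (m : ℕ) (lam : ℂ) (b : ℕ) :
    IsQuasiPoly η (-L + m + b) m fun k => polyCoef η L m lam k b := by
  refine IsQuasiPoly.sum _ fun i hi => ?_
  have h := (isQuasiPoly_qpow η (-L + m + b - i) (singCoef η L m lam i *
    (qpow η ((b - m + i) * (L - 2 * m + 2 * i) - (b - m + i) ^ 2) *
      dfall η (L - m + i) (b - m + i)))).mul (isQuasiPoly_dfall η (m - b) i)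
  have hi' := Finset.mem_range.mp hi
  rw [sub_add_cancel] at h
  refine IsQuasiPoly.mono ?_ (show 0 + i ≤ m by omega)
  convert h using 2 with k
  have e : qpow η (-((k - (b - m + i)) * (L - 2 * m + 2 * i)) + (b - m + i) * (k - (b - m + i))) =
      qpow η ((-L + m + b - i) * k) *
        qpow η ((b - m + i) * (L - 2 * m + 2 * i) - (b - m + i) ^ 2) := by
    rw [← qpow_add]; ring_nf
  push_cast
  rw [e, add_sub_assoc]
  ring_nf

theorem isQuasiPoly_polyChain (η : ℂ) (n : ℕ) (L : Fin n → ℂ) (m : Fin n → ℕ) (lam : ℂ)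
    (b : Fin n → ℕ) : IsQuasiPoly η (∑ i, (-L i + m i + b i)) (∑ i, m i) fun k =>
      polyChain η n L m lam k b := by
  induction n generalizing lam with
  | zero => exact ⟨1, by simp, fun k => by simp [polyChain, qpow_zero]⟩
  | succ n ih =>
    rw [Fin.sum_univ_castSucc, Fin.sum_univ_castSucc, add_comm, add_comm (∑ i : Fin n, m i.castSucc)]
    have := (isQuasiPoly_polyCoef η (L (Fin.last n)) (m (Fin.last n)) lam (b (Fin.last n))).mul
      ((ih (Fin.init L) (Fin.init m) (lam - L (Fin.last n) + 2 * m (Fin.last n))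
        (Fin.init b)).shift (m (Fin.last n) - b (Fin.last n)))
    simp only [polyChain, add_sub_assoc]
    exact this

/-! ### Convergence of the traces and their continuation -/

theorem Level.sum_eq {n N : ℕ} (m : Level n N) : ∑ i, m.1 i = N :=
  Finset.Nat.mem_antidiagonalTuple.mp m.2

theorem Phi_apply_diagonal {η : ℂ} (hη : 0 < η.im) {n N : ℕ} (L : Fin n → ℂ) (lam : ℂ)
    (m m' : Level n N) (k : ℕ) : Phi η n L m.1 lam (Finsupp.single k 1) (k, m'.1) =
      chainCoef η n L m.1 lam k m'.1 := by
  rw [Phi_apply hη, m.sum_eq, m'.sum_eq, if_pos rfl]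

/-- On the zero weight space the exponents -Λ_i + m_i + m'_i add up to -2N + N + N = 0, so a genuine
polynomial in q^{-2k} remains. -/
theorem exists_chainCoef_polynomial (η : ℂ) {n N : ℕ} (L : Fin n → ℂ) (hL : ∑ i, L i = 2 * (N : ℂ))
    (lam : ℂ) (m m' : Level n N) : ∃ c : ℕ → ℂ, ∀ k : ℕ,
      chainCoef η n L m.1 lam k m'.1 = ∑ i ∈ Finset.range (N + 1), c i * qpow η (-(2 * k)) ^ i := by
  obtain ⟨p, hp, h⟩ := isQuasiPoly_polyChain η n L m.1 lam m'.1
  refine ⟨p.coeff, fun k => ?_⟩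
  have hm : ∑ i, (m.1 i : ℂ) = N := by exact_mod_cast m.sum_eq
  have hm' : ∑ i, (m'.1 i : ℂ) = N := by exact_mod_cast m'.sum_eq
  have hz : ∑ i, (m.1 i : ℤ) = N := by exact_mod_cast m.sum_eq
  have hz' : ∑ i, (m'.1 i : ℤ) = N := by exact_mod_cast m'.sum_eq
  have e : ∑ i, (-L i + m.1 i + m'.1 i) = 0 := by
    rw [Finset.sum_add_distrib, Finset.sum_add_distrib, Finset.sum_neg_distrib, hL, hm, hm']; ring
  have hk : polyChain η n L m.1 lam k m'.1 = _ := h k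
  rw [e, zero_mul, qpow_zero, one_mul,
    Polynomial.eval_eq_sum_range' (n := N + 1) (by rw [m.sum_eq] at hp; omega)] at hk
  rw [chainCoef_eq_polyChain _ _ _ _ _ _ _ (by rw [hz, hz']; omega), hk]
  push_cast; rfl

theorem norm_qpow_neg_lt_one_of_norm {η : ℂ} (hη : 0 < η.im) {N i : ℕ} (hi : i ≤ N) {x : ℂ}
    (hx : ‖qpow η (-(2 * N))‖ < ‖qpow η (2 * x)‖) : ‖qpow η (-(2 * (x + i)))‖ < 1 := by
  have h₁ : ‖qpow η (2 * (N - i : ℕ))‖ ≤ 1 := by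
    rw [qpow_two_mul, norm_pow]
    refine pow_le_one₀ (norm_nonneg _) ?_
    rcases Nat.eq_zero_or_pos (N - i) with h | h
    · rw [h, Nat.cast_zero, qpow_zero, norm_one]
    · exact (norm_qpow_natCast_lt_one hη h.ne').le
  have h₂ : qpow η (-(2 * (x + i))) =
      qpow η (2 * (N - i : ℕ)) * (qpow η (-(2 * N)) * (qpow η (2 * x))⁻¹) := by
    rw [← qpow_neg, ← qpow_add, ← qpow_add, Nat.cast_sub hi]; ring_nf
  rw [h₂, norm_mul, norm_mul, norm_inv]
  have h₃ : ‖qpow η (-(2 * N))‖ * ‖qpow η (2 * x)‖⁻¹ < 1 := by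
    rw [← div_eq_mul_inv, div_lt_one (norm_pos_iff.mpr (qpow_ne_zero _ _))]
    exact hx
  calc _ ≤ 1 * (‖qpow η (-(2 * N))‖ * ‖qpow η (2 * x)‖⁻¹) :=
        mul_le_mul_of_nonneg_right h₁ (by positivity)
    _ < 1 := by rwa [one_mul]

/-- The sum of the trace series for the polynomial with the coefficients `c` in `q ^ (-2 k)`. -/
def traceSum (η : ℂ) (N : ℕ) (c : ℕ → ℂ) (lam x : ℂ) : ℂ :=
  c 0 * qpow η (lam * x) + ∑ i ∈ Finset.range N,
    c (i + 1) * (qpow η x - qpow η (-x)) * qpow η ((lam - 1) * x) /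
      (1 - qpow η (-(2 * (x + (i + 1 : ℕ)))))

/-- Each monomial q^{-2ki} gives a geometric series with ratio q^{-2(x+i)}, and the bound on
|q^{2x}| makes all ratios with i ≤ N smaller than one in absolute value. -/
theorem hasSum_traceSum {η : ℂ} (hη : 0 < η.im) (N : ℕ) (c : ℕ → ℂ) (lam : ℂ) {x : ℂ}
    (hx : ‖qpow η (-(2 * N))‖ < ‖qpow η (2 * x)‖) :
    HasSum (fun k : ℕ => (qpow η x - qpow η (-x)) *
      ((∑ i ∈ Finset.range (N + 1), c i * qpow η (-(2 * k)) ^ i) * qpow η ((lam - 1 - 2 * k) * x)))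
      (traceSum η N c lam x) := by
  have hn : ∀ i ≤ N, ‖qpow η (-(2 * (x + i)))‖ < 1 := fun i hi =>
    norm_qpow_neg_lt_one_of_norm hη hi hx
  have h1 : 1 - qpow η (-(2 * x)) ≠ 0 := by
    intro h
    have := hn 0 (by omega)
    rw [Nat.cast_zero, add_zero, ← sub_eq_zero.mp h, norm_one] at this
    exact lt_irrefl _ this
  -- For i = 0 the prefactor q^x - q^{-x} = q^x (1 - q^{-2x}) cancels the denominator, so there is
  -- no pole at [x] = 0.
  have h2 : traceSum η N c lam x = ∑ i ∈ Finset.range (N + 1),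
      c i * (qpow η x - qpow η (-x)) * qpow η ((lam - 1) * x) * (1 - qpow η (-(2 * (x + i))))⁻¹ := by
    rw [Finset.sum_range_succ', traceSum, add_comm, Nat.cast_zero, add_zero]
    congr 1
    have e₁ : qpow η (lam * x) = qpow η x * qpow η ((lam - 1) * x) := by rw [← qpow_add]; ring_nf
    have e₂ : qpow η x * qpow η (-(2 * x)) = qpow η (-x) := by rw [← qpow_add]; ring_nf
    rw [eq_mul_inv_iff_mul_eq₀ h1, e₁]
    linear_combination (-(c 0) * qpow η ((lam - 1) * x)) * e₂
  rw [h2]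
  have h3 : ∀ k : ℕ, (qpow η x - qpow η (-x)) *
      ((∑ i ∈ Finset.range (N + 1), c i * qpow η (-(2 * k)) ^ i) * qpow η ((lam - 1 - 2 * k) * x)) =
      ∑ i ∈ Finset.range (N + 1), c i * (qpow η x - qpow η (-x)) * qpow η ((lam - 1) * x) *
        qpow η (-(2 * (x + i))) ^ k := by
    intro k
    rw [Finset.sum_mul, Finset.mul_sum]
    refine Finset.sum_congr rfl fun i _ => ?_
    have e : qpow η (-(2 * k)) ^ i * qpow η ((lam - 1 - 2 * k) * x) =
        qpow η ((lam - 1) * x) * qpow η (-(2 * (x + i))) ^ k := by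
      rw [← qpow_natCast_mul, ← qpow_natCast_mul, ← qpow_add, ← qpow_add]; ring_nf
    linear_combination c i * (qpow η x - qpow η (-x)) * e
  simp only [h3]
  exact hasSum_sum fun i hi =>
    (hasSum_geometric_of_norm_lt_one (hn i (by have := Finset.mem_range.mp hi; omega))).mul_left _

theorem analyticAt_traceSum {η : ℂ} (hη : 0 < η.im) (N : ℕ) (c : ℕ → ℂ) (lam : ℂ) {x : ℂ}
    (hx : ∀ k ∈ Finset.Icc 1 N, qnum η (x + k) ≠ 0) : AnalyticAt ℂ (traceSum η N c lam) x := by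
  unfold traceSum
  refine AnalyticAt.add ?_ (Finset.analyticAt_fun_sum _ fun i hi => ?_)
  · unfold qpow; fun_prop
  · have h := hx (i + 1) (Finset.mem_Icc.mpr (by have := Finset.mem_range.mp hi; omega))
    rw [Ne, qnum_eq_zero_iff hη] at h
    refine AnalyticAt.div ?_ ?_ ?_
    · unfold qpow; fun_prop
    · unfold qpow; fun_prop
    · rw [qpow_neg]
      intro h'
      exact h (inv_eq_one.mp (sub_eq_zero.mp h').symm)

theorem meromorphicOn_traceSum (η : ℂ) (N : ℕ) (c : ℕ → ℂ) (lam : ℂ) :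
    MeromorphicOn (traceSum η N c lam) Set.univ := by
  intro x _
  have h : ∀ f : ℂ → ℂ, AnalyticAt ℂ f x → MeromorphicAt f x := fun f hf => hf.meromorphicAt
  unfold traceSum
  refine MeromorphicAt.add (h _ ?_) (MeromorphicAt.fun_sum fun i hi => MeromorphicAt.div (h _ ?_) (h _ ?_))
  all_goals unfold qpow; fun_prop

theorem exists_large_norm_qpow {η : ℂ} (hη : 0 < η.im) (C : ℝ) : ∃ x : ℂ, C < ‖qpow η (2 * x)‖ := by
  have h := norm_qpow_natCast_lt_one hη (k := 2) (by norm_num)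
  obtain ⟨n, hn⟩ := pow_unbounded_of_one_lt C
    ((one_lt_inv₀ (norm_pos_iff.mpr (qpow_ne_zero η (2 : ℕ)))).mpr h)
  refine ⟨-n, ?_⟩
  rwa [show 2 * -(n : ℂ) = -(n * (2 : ℕ)) by push_cast; ring, qpow_neg, qpow_natCast_mul, norm_inv,
    norm_pow, ← inv_pow]

theorem isOpen_large_norm_qpow (η : ℂ) (C : ℝ) : IsOpen {x : ℂ | C < ‖qpow η (2 * x)‖} :=
  isOpen_lt continuous_const (by unfold qpow; fun_prop)

/-- The difference has infinite order at one point, hence everywhere by connectedness; the normal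
form then fixes the values at poles and removable singularities too. -/
theorem meromorphicNFOn_univ_unique {G G' : ℂ → ℂ} (h : MeromorphicNFOn G Set.univ)
    (h' : MeromorphicNFOn G' Set.univ) {x : ℂ} (hx : G =ᶠ[nhds x] G') : G = G' := by
  have hm : MeromorphicOn (G - G') Set.univ := h.meromorphicOn.sub h'.meromorphicOn
  have htop : ∀ y, meromorphicOrderAt (G - G') y = ⊤ := by
    have := hm.exists_meromorphicOrderAt_ne_top_iff_forall_mem isConnected_univ
    by_contra! hy
    obtain ⟨y, hy⟩ := hy
    refine this.mp ⟨y, Set.mem_univ y, hy⟩ x (Set.mem_univ x) ?_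
    rw [meromorphicOrderAt_eq_top_iff]
    filter_upwards [hx.filter_mono nhdsWithin_le_nhds] with z hz
    rw [Pi.sub_apply, hz, sub_self]
  funext y
  refine (((h (Set.mem_univ y)).eventuallyEq_nhdsNE_iff_eventuallyEq_nhds
    (h' (Set.mem_univ y))).mp ?_).eq_of_nhds
  filter_upwards [meromorphicOrderAt_eq_top_iff.mp (htop y)] with z hz
  exact sub_eq_zero.mp hz

theorem isTraceFunction_unique {η : ℂ} (hη : 0 < η.im) {n N : ℕ} {L : Fin n → ℂ} {lam : ℂ}
    {m m' : Level n N} {G G' : ℂ → ℂ} (h : IsTraceFunction η L lam m m' G)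
    (h' : IsTraceFunction η L lam m m' G') : G = G' := by
  obtain ⟨C, hC⟩ := h.2
  obtain ⟨C', hC'⟩ := h'.2
  obtain ⟨x, hx⟩ := exists_large_norm_qpow hη (max C C')
  refine meromorphicNFOn_univ_unique h.1 h'.1 (x := x) ?_
  filter_upwards [(isOpen_large_norm_qpow η (max C C')).mem_nhds hx] with y hy
  exact (hC y ((le_max_left _ _).trans_lt hy)).unique (hC' y ((le_max_right _ _).trans_lt hy))

theorem exists_isTraceFunction {η : ℂ} (hη : 0 < η.im) {n N : ℕ} {L : Fin n → ℂ}
    (hL : ∑ i, L i = 2 * (N : ℂ)) (lam : ℂ) (m m' : Level n N) :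
    ∃ G, IsTraceFunction η L lam m m' G ∧ ∀ x : ℂ, (∀ k ∈ Finset.Icc 1 N, qnum η (x + k) ≠ 0) →
      AnalyticAt ℂ G x := by
  obtain ⟨c, hc⟩ := exists_chainCoef_polynomial η L hL lam m m'
  set A : ℂ := qpow η (-(N * (N + 1) / 2)) * (qpow η 1 - qpow η (-1)) ^ N with hA
  set G₀ : ℂ → ℂ := traceSum η N (fun i => A * c i) lam with hG₀
  have hmer : MeromorphicOn G₀ Set.univ := meromorphicOn_traceSum η N _ lam
  have hev : ∀ x : ℂ, AnalyticAt ℂ G₀ x → toMeromorphicNFOn G₀ Set.univ =ᶠ[nhds x] G₀ := fun x hx => by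
    have := toMeromorphicNFOn_eq_toMeromorphicNFAt_on_nhds hmer (Set.mem_univ x)
    rwa [toMeromorphicNFAt_eq_self.mpr hx.meromorphicNFAt] at this
  have han : ∀ x : ℂ, (∀ k ∈ Finset.Icc 1 N, qnum η (x + k) ≠ 0) → AnalyticAt ℂ G₀ x :=
    fun x hx => analyticAt_traceSum hη N _ lam hx
  -- Passing to the normal form leaves the explicit sum unchanged near every point where it is
  -- analytic. The norm of q^{-2N} serves as the convergence bound.
  refine ⟨toMeromorphicNFOn G₀ Set.univ, ⟨meromorphicNFOn_toMeromorphicNFOn _ _,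
    ‖qpow η (-(2 * N))‖, fun x hx => ?_⟩, fun x hx => (han x hx).congr (hev x (han x hx)).symm⟩
  have hallowed : ∀ k ∈ Finset.Icc 1 N, qnum η (x + k) ≠ 0 := by
    intro k hk h
    rw [qnum_eq_zero_iff hη] at h
    have := norm_qpow_neg_lt_one_of_norm hη (Finset.mem_Icc.mp hk).2 hx
    rw [qpow_neg, h, inv_one, norm_one] at this
    exact lt_irrefl _ this
  rw [(hev x (han x hallowed)).eq_of_nhds]
  have hs := hasSum_traceSum hη N (fun i => A * c i) lam hx
  convert hs using 2 with k
  rw [traceTerm, Phi_apply_diagonal hη, hc]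
  simp only [mul_assoc A, ← Finset.mul_sum]
  rw [hA]; ring

/-- The traces converge to meromorphic functions. -/
theorem isTraceFunction_traceFun {η : ℂ} (hη : 0 < η.im) {n N : ℕ} {L : Fin n → ℂ}
    (hL : ∑ i, L i = 2 * (N : ℂ)) (lam : ℂ) (m m' : Level n N) :
    IsTraceFunction η L lam m m' (traceFun η L lam m m') := by
  obtain ⟨G, hG, -⟩ := exists_isTraceFunction hη hL lam m m'
  exact Classical.epsilon_spec (p := fun G => IsTraceFunction η L lam m m' G) ⟨G, hG⟩

theorem analyticAt_traceFun {η : ℂ} (hη : 0 < η.im) {n N : ℕ} {L : Fin n → ℂ}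
    (hL : ∑ i, L i = 2 * (N : ℂ)) (lam : ℂ) (m m' : Level n N) {x : ℂ}
    (hx : ∀ k ∈ Finset.Icc 1 N, qnum η (x + k) ≠ 0) : AnalyticAt ℂ (traceFun η L lam m m') x := by
  obtain ⟨G, hG, h⟩ := exists_isTraceFunction hη hL lam m m'
  rw [isTraceFunction_unique hη (isTraceFunction_traceFun hη hL lam m m') hG]
  exact h x hx

theorem countable_qnum_eq_zero {η : ℂ} (hη : 0 < η.im) (c : ℂ) :
    {x : ℂ | qnum η (x + c) = 0}.Countable := by
  refine (Set.countable_range fun j : ℤ => j / η - c).mono fun x hx => ?_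
  have hx' : qpow η (2 * (x + c)) = 1 := (qnum_eq_zero_iff hη _).mp hx
  rw [qpow, Complex.exp_eq_one_iff] at hx'
  obtain ⟨j, hj⟩ := hx'
  refine ⟨j, ?_⟩
  have h0 : η ≠ 0 := by rintro rfl; simp at hη
  have h1 : (2 * Real.pi * I : ℂ) ≠ 0 := Complex.two_pi_I_ne_zero
  have : (2 * Real.pi * I : ℂ) * (η * (x + c) - j) = 0 := by linear_combination hj
  have h2 := sub_eq_zero.mp ((mul_eq_zero.mp this).resolve_left h1)
  beta_reduce
  rw [← h2]
  field_simp
  ring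

/-- Analytic continuation of identities from the domain of convergence of the traces. -/
theorem eq_of_eq_of_large_norm {η : ℂ} (hη : 0 < η.im) (N : ℕ) {f g : ℂ → ℂ}
    (hf : ∀ x : ℂ, (∀ k ∈ Finset.Icc 1 N, qnum η (x + k) ≠ 0) → AnalyticAt ℂ f x)
    (hg : ∀ x : ℂ, (∀ k ∈ Finset.Icc 1 N, qnum η (x + k) ≠ 0) → AnalyticAt ℂ g x) {C : ℝ}
    (h : ∀ x : ℂ, C < ‖qpow η (2 * x)‖ → f x = g x) {x : ℂ}
    (hx : ∀ k ∈ Finset.Icc 1 N, qnum η (x + k) ≠ 0) : f x = g x := by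
  set S : Set ℂ := (⋃ k ∈ Finset.Icc 1 N, {x : ℂ | qnum η (x + (k : ℕ)) = 0})ᶜ with hS
  have hmem : ∀ x, x ∈ S ↔ ∀ k ∈ Finset.Icc 1 N, qnum η (x + k) ≠ 0 := fun x => by
    simp [hS]
  -- The excluded points form a countable set, and the complement of a countable subset of the
  -- complex plane is connected.
  have hconn : IsPreconnected S := by
    refine (Set.Countable.isConnected_compl_of_one_lt_rank ?_ ?_).isPreconnected
    · rw [Complex.rank_real_complex]; exact Cardinal.one_lt_two
    · exact Set.Countable.biUnion (Finset.countable_toSet _) fun k _ => countable_qnum_eq_zero hη k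
  obtain ⟨y, hy⟩ := exists_large_norm_qpow hη (max C ‖qpow η (-(2 * N))‖)
  have hyS : y ∈ S := (hmem y).mpr fun k hk h0 => by
    rw [qnum_eq_zero_iff hη] at h0
    have := norm_qpow_neg_lt_one_of_norm hη (Finset.mem_Icc.mp hk).2 ((le_max_right _ _).trans_lt hy)
    rw [qpow_neg, h0, inv_one, norm_one] at this
    exact lt_irrefl _ this
  refine AnalyticOnNhd.eqOn_of_preconnected_of_eventuallyEq (fun z hz => hf z ((hmem z).mp hz))
    (fun z hz => hg z ((hmem z).mp hz)) hconn hyS ?_ ((hmem x).mpr hx)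
  filter_upwards [(isOpen_large_norm_qpow η _).mem_nhds hy] with z hz
  exact h z ((le_max_left _ _).trans_lt hz)

/-! ### The exchange relation for compositions of intertwining operators -/

/-- The matrix elements `chainCoef` for sequences indexed by natural numbers. -/
def chainSeq (η : ℂ) (L : ℕ → ℂ) (m b : ℕ → ℕ) : ℕ → ℂ → ℤ → ℂ
  | 0, _, _ => 1
  | n + 1, lam, k => tcoef η (L n) (m n) lam k (b n) *
      chainSeq η L m b n (lam - L n + 2 * m n) (k + m n - b n)

theorem chainCoef_eq_chainSeq (η : ℂ) (L : ℕ → ℂ) (m b : ℕ → ℕ) (n : ℕ) (lam : ℂ) (k : ℤ) :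
    chainCoef η n (fun i => L i) (fun i => m i) lam k (fun i => b i) =
      chainSeq η L m b n lam k := by
  induction n generalizing lam k with
  | zero => rfl
  | succ n ih =>
    rw [chainSeq, chainCoef, ← ih]
    rfl

theorem chainSeq_congr (η : ℂ) {L L' : ℕ → ℂ} {m m' b b' : ℕ → ℕ} (n : ℕ) (lam : ℂ) (k : ℤ)
    (hL : ∀ r < n, L r = L' r) (hm : ∀ r < n, m r = m' r) (hb : ∀ r < n, b r = b' r) :
    chainSeq η L m b n lam k = chainSeq η L' m' b' n lam k := by
  induction n generalizing lam k with
  | zero => rfl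
  | succ n ih =>
    rw [chainSeq, chainSeq, hL n (by omega), hm n (by omega), hb n (by omega),
      ih _ _ (fun r hr => hL r (by omega)) (fun r hr => hm r (by omega)) (fun r hr => hb r (by omega))]

/-- Replace the entries at `p` and `p + 1`. -/
def setPair (m : ℕ → ℕ) (p : ℕ) (x : ℕ × ℕ) : ℕ → ℕ :=
  Function.update (Function.update m p x.1) (p + 1) x.2

theorem setPair_left (m : ℕ → ℕ) (p : ℕ) (x : ℕ × ℕ) : setPair m p x p = x.1 := by
  simp [setPair]

theorem setPair_right (m : ℕ → ℕ) (p : ℕ) (x : ℕ × ℕ) : setPair m p x (p + 1) = x.2 := by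
  simp [setPair]

theorem setPair_of_ne (m : ℕ → ℕ) {p r : ℕ} (x : ℕ × ℕ) (h : r ≠ p) (h' : r ≠ p + 1) :
    setPair m p x r = m r := by
  simp [setPair, h, h']

/-- The operators applied later see the last two only through the sums of their indices and weights,
so an exchange of those two leaves them unchanged. -/
theorem chainSeq_add_two (η : ℂ) (L : ℕ → ℂ) (m b : ℕ → ℕ) (p : ℕ) (lam : ℂ) (k : ℤ) :
    chainSeq η L m b (p + 2) lam k =
      pairCoef η (L p) (L (p + 1)) (m p) (m (p + 1)) lam k (b p) (b (p + 1)) *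
      chainSeq η L m b p (lam - (L p + L (p + 1)) + 2 * (m p + m (p + 1) : ℕ))
        (k + (m p + m (p + 1) : ℕ) - (b p + b (p + 1) : ℕ)) := by
  rw [chainSeq, chainSeq, pairCoef, mul_assoc]
  push_cast
  congr 3 <;> ring

open Finset.HasAntidiagonal in
-- The operators to the right of positions p, p + 1 act first and shift λ by minus their weights,
-- which is the origin of the argument λ - h^{(p+2, …)}. Induction strips them off until the
-- exchanged pair is the last.
theorem chainSeq_exchange {η : ℂ} (hη : 0 < η.im) (L : ℕ → ℂ) (m b : ℕ → ℕ) (p n : ℕ)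
    (hn : p + 2 ≤ n) (lam : ℂ) (k : ℤ)
    (h : Generic η (L p) (L (p + 1)) (m p + m (p + 1))
      (lam - ∑ r ∈ Finset.Ico (p + 2) n, (L r - 2 * m r))) :
    ∑ x ∈ antidiagonal (m p + m (p + 1)), dynamicalR η (L (p + 1)) (L p)
        (lam - ∑ r ∈ Finset.Ico (p + 2) n, (L r - 2 * m r)) x.2 x.1 (m p) (m (p + 1)) *
      chainSeq η L (setPair m p x) b n lam k =
    ∑ c ∈ antidiagonal (b p + b (p + 1)),
      chainSeq η (L ∘ Equiv.swap p (p + 1)) m (setPair b p c) n lam k *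
        quantumR η (L (p + 1)) (L p) 0 (b (p + 1)) (b p) c.1 c.2 := by
  induction n, hn using Nat.le_induction generalizing lam k with
  | base =>
    simp only [Finset.Ico_self, Finset.sum_empty, sub_zero] at h ⊢
    simp only [chainSeq_add_two, setPair_left, setPair_right, Function.comp_apply,
      Equiv.swap_apply_left, Equiv.swap_apply_right]
    have hl : ∀ x ∈ antidiagonal (m p + m (p + 1)), dynamicalR η (L (p + 1)) (L p) lam x.2 x.1
        (m p) (m (p + 1)) * (pairCoef η (L p) (L (p + 1)) x.1 x.2 lam k (b p) (b (p + 1)) *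
        chainSeq η L (setPair m p x) b p (lam - (L p + L (p + 1)) + 2 * (x.1 + x.2 : ℕ))
        (k + (x.1 + x.2 : ℕ) - (b p + b (p + 1) : ℕ))) =
        dynamicalR η (L (p + 1)) (L p) lam x.2 x.1 (m p) (m (p + 1)) *
          pairCoef η (L p) (L (p + 1)) x.1 x.2 lam k (b p) (b (p + 1)) *
        chainSeq η L m b p (lam - (L p + L (p + 1)) + 2 * (m p + m (p + 1) : ℕ))
        (k + (m p + m (p + 1) : ℕ) - (b p + b (p + 1) : ℕ)) := by
      intro x hx
      rw [mem_antidiagonal.mp hx, mul_assoc]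
      congr 2
      exact chainSeq_congr η p _ _ (fun _ _ => rfl)
        (fun r hr => setPair_of_ne m x (by omega) (by omega)) (fun _ _ => rfl)
    have hr : ∀ c ∈ antidiagonal (b p + b (p + 1)),
        pairCoef η (L (p + 1)) (L p) (m p) (m (p + 1)) lam k c.1 c.2 *
        chainSeq η (L ∘ Equiv.swap p (p + 1)) m (setPair b p c) p
          (lam - (L (p + 1) + L p) + 2 * (m p + m (p + 1) : ℕ))
          (k + (m p + m (p + 1) : ℕ) - (c.1 + c.2 : ℕ)) *
        quantumR η (L (p + 1)) (L p) 0 (b (p + 1)) (b p) c.1 c.2 =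
        pairCoef η (L (p + 1)) (L p) (m p) (m (p + 1)) lam k c.1 c.2 *
          quantumR η (L (p + 1)) (L p) 0 (b (p + 1)) (b p) c.1 c.2 *
        chainSeq η L m b p (lam - (L p + L (p + 1)) + 2 * (m p + m (p + 1) : ℕ))
        (k + (m p + m (p + 1) : ℕ) - (b p + b (p + 1) : ℕ)) := by
      intro c hc
      rw [mem_antidiagonal.mp hc, add_comm (L (p + 1)), chainSeq_congr η p _ _
        (L := L ∘ Equiv.swap p (p + 1)) (L' := L) (m' := m) (b := setPair b p c) (b' := b)
        (fun r hr => by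
          rw [Function.comp_apply, Equiv.swap_apply_of_ne_of_ne (by omega) (by omega)])
        (fun _ _ => rfl) (fun r hr => setPair_of_ne b c (by omega) (by omega))]
      ring
    rw [Finset.sum_congr rfl hl, Finset.sum_congr rfl hr, ← Finset.sum_mul, ← Finset.sum_mul,
      exchange hη rfl h, ← sum_quantumR_eq_rContract η _ _ 0]
  | succ n hn ih =>
    rw [Finset.sum_Ico_succ_top hn] at h ⊢
    rw [show lam - (∑ r ∈ Finset.Ico (p + 2) n, (L r - 2 * m r) + (L n - 2 * m n)) =
      lam - L n + 2 * m n - ∑ r ∈ Finset.Ico (p + 2) n, (L r - 2 * m r) by ring] at h ⊢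
    have := ih (lam - L n + 2 * m n) (k + m n - b n) h
    simp only [chainSeq, setPair_of_ne _ _ (show n ≠ p by omega) (show n ≠ p + 1 by omega),
      Function.comp_apply, Equiv.swap_apply_of_ne_of_ne (show n ≠ p by omega)
      (show n ≠ p + 1 by omega)]
    simp only [mul_left_comm _ (tcoef η (L n) (m n) lam k (b n)),
      mul_assoc (tcoef η (L n) (m n) lam k (b n)), ← Finset.mul_sum, this]

/-! ### Operators in two neighbouring tensor factors -/

/-- Extension of a finite sequence by zero. -/
def extend {α : Type} [Zero α] {n : ℕ} (f : Fin n → α) (r : ℕ) : α :=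
  if h : r < n then f ⟨r, h⟩ else 0

theorem extend_of_lt {α : Type} [Zero α] {n : ℕ} (f : Fin n → α) {r : ℕ} (h : r < n) :
    extend f r = f ⟨r, h⟩ := dif_pos h

theorem extend_coe {α : Type} [Zero α] {n : ℕ} (f : Fin n → α) : (fun i : Fin n => extend f i) = f := by
  funext i
  rw [extend_of_lt f i.2]

theorem sum_extend {α : Type} [AddCommMonoid α] {n : ℕ} (f : Fin n → α) :
    ∑ r ∈ Finset.range n, extend f r = ∑ i, f i := by
  rw [Finset.sum_range]
  exact Finset.sum_congr rfl fun i _ => extend_of_lt f i.2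

theorem sum_range_split (f : ℕ → ℕ) (p d : ℕ) : ∑ r ∈ Finset.range (p + 2 + d), f r =
    ∑ r ∈ Finset.range p, f r + (f p + f (p + 1)) + ∑ r ∈ Finset.range d, f (p + 2 + r) := by
  rw [Finset.sum_range_add f (p + 2) d, Finset.sum_range_succ, Finset.sum_range_succ,
    add_assoc (∑ r ∈ Finset.range p, f r)]

theorem setPair_sum (m : ℕ → ℕ) {p n : ℕ} (hp : p + 1 < n) {x : ℕ × ℕ} (hx : x.1 + x.2 = m p + m (p + 1)) :
    ∑ r ∈ Finset.range n, setPair m p x r = ∑ r ∈ Finset.range n, m r := by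
  obtain ⟨d, rfl⟩ : ∃ d, n = p + 2 + d := ⟨n - (p + 2), by omega⟩
  have h₁ : ∀ r ∈ Finset.range p, setPair m p x r = m r := fun r hr => by
    have := Finset.mem_range.mp hr
    exact setPair_of_ne m x (by omega) (by omega)
  have h₂ : ∀ r ∈ Finset.range d, setPair m p x (p + 2 + r) = m (p + 2 + r) := fun r hr =>
    setPair_of_ne m x (by omega) (by omega)
  rw [sum_range_split, sum_range_split, Finset.sum_congr rfl h₁, Finset.sum_congr rfl h₂,
    setPair_left, setPair_right, hx]

/-- Replace the entries at `p` and `p + 1` of a multi-index. -/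
def levelPair {n N : ℕ} (m : Level n N) {p : ℕ} (hp : p + 1 < n) (x : ℕ × ℕ)
    (hx : x.1 + x.2 = extend m.1 p + extend m.1 (p + 1)) : Level n N :=
  ⟨fun i => setPair (extend m.1) p x i, by
    rw [Finset.Nat.mem_antidiagonalTuple, ← Finset.sum_range fun r => setPair (extend m.1) p x r,
      setPair_sum _ hp hx, sum_extend, m.sum_eq]⟩

theorem Level.extend_sum_eq {n N : ℕ} {m a : Level n N} {p : ℕ} (hp : p + 1 < n)
    (h : ∀ r : Fin n, (r : ℕ) ≠ p → (r : ℕ) ≠ p + 1 → m.1 r = a.1 r) :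
    extend a.1 p + extend a.1 (p + 1) = extend m.1 p + extend m.1 (p + 1) := by
  have hs : ∑ r ∈ Finset.range n, extend a.1 r = ∑ r ∈ Finset.range n, extend m.1 r := by
    rw [sum_extend, sum_extend, a.sum_eq, m.sum_eq]
  obtain ⟨d, rfl⟩ : ∃ d, n = p + 2 + d := ⟨n - (p + 2), by omega⟩
  have e₁ : ∀ r ∈ Finset.range p, extend a.1 r = extend m.1 r := fun r hr => by
    have := Finset.mem_range.mp hr
    rw [extend_of_lt _ (by omega), extend_of_lt _ (by omega), h ⟨r, by omega⟩] <;>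
      simp only [] <;> omega
  have e₂ : ∀ r ∈ Finset.range d, extend a.1 (p + 2 + r) = extend m.1 (p + 2 + r) := fun r hr => by
    have := Finset.mem_range.mp hr
    rw [extend_of_lt _ (by omega), extend_of_lt _ (by omega), h ⟨p + 2 + r, by omega⟩] <;>
      simp only [] <;> omega
  have s₁ : ∑ r ∈ Finset.range p, extend a.1 r = ∑ r ∈ Finset.range p, extend m.1 r :=
    Finset.sum_congr rfl e₁
  rw [sum_range_split (extend a.1), sum_range_split (extend m.1), s₁, Finset.sum_congr rfl e₂] at hs
  omega

open Finset.HasAntidiagonal in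
/-- A sum over the multi-indices which agree with `m` outside of `p` and `p + 1`. -/
theorem sum_level_pair {n N : ℕ} (m : Level n N) {p : ℕ} (hp : p + 1 < n) (f : Level n N → ℂ) :
    (∑ a : Level n N, if ∀ r : Fin n, (r : ℕ) ≠ p → (r : ℕ) ≠ p + 1 → m.1 r = a.1 r then f a else 0) =
      ∑ x : antidiagonal (extend m.1 p + extend m.1 (p + 1)),
        f (levelPair m hp x.1 (mem_antidiagonal.mp x.2)) := by
  symm
  refine Finset.sum_of_injOn (fun x => levelPair m hp x.1 (mem_antidiagonal.mp x.2)) ?_ ?_ ?_ ?_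
  · rintro ⟨x, hx⟩ _ ⟨y, hy⟩ _ hxy
    have h₁ := congrFun (congrArg Subtype.val hxy) ⟨p, by omega⟩
    have h₂ := congrFun (congrArg Subtype.val hxy) ⟨p + 1, by omega⟩
    simp only [levelPair, setPair_left, setPair_right] at h₁ h₂
    exact Subtype.ext (Prod.ext h₁ h₂)
  · exact fun _ _ => Finset.mem_coe.mpr (Finset.mem_univ _)
  · intro a _ ha
    refine if_neg fun h => ha ?_
    refine ⟨⟨(extend a.1 p, extend a.1 (p + 1)), mem_antidiagonal.mpr (Level.extend_sum_eq hp h)⟩,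
      Finset.mem_coe.mpr (Finset.mem_univ _), Subtype.ext (funext fun r => ?_)⟩
    simp only [levelPair]
    by_cases h₁ : (r : ℕ) = p
    · rw [h₁, setPair_left]
      simp only
      rw [← h₁, extend_of_lt _ r.2]
    by_cases h₂ : (r : ℕ) = p + 1
    · rw [h₂, setPair_right]
      simp only
      rw [← h₂, extend_of_lt _ r.2]
    rw [setPair_of_ne _ _ h₁ h₂, extend_of_lt _ r.2, h r h₁ h₂]
  · rintro ⟨x, hx⟩ _
    rw [if_pos]
    intro r h₁ h₂
    simp only [levelPair]
    rw [setPair_of_ne _ _ h₁ h₂, extend_of_lt _ r.2]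

theorem extend_levelPair_left {n N : ℕ} (m : Level n N) {p : ℕ} (hp : p + 1 < n) (x : ℕ × ℕ)
    (hx : x.1 + x.2 = extend m.1 p + extend m.1 (p + 1)) :
    extend (levelPair m hp x hx).1 p = x.1 := by
  rw [extend_of_lt _ (by omega)]; exact setPair_left _ _ _

theorem extend_levelPair_right {n N : ℕ} (m : Level n N) {p : ℕ} (hp : p + 1 < n) (x : ℕ × ℕ)
    (hx : x.1 + x.2 = extend m.1 p + extend m.1 (p + 1)) :
    extend (levelPair m hp x hx).1 (p + 1) = x.2 := by
  rw [extend_of_lt _ (by omega)]; exact setPair_right _ _ _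

theorem levelPair_val_of_ne {n N : ℕ} (m : Level n N) {p : ℕ} (hp : p + 1 < n) (x : ℕ × ℕ)
    (hx : x.1 + x.2 = extend m.1 p + extend m.1 (p + 1)) (r : Fin n) (h₁ : (r : ℕ) ≠ p)
    (h₂ : (r : ℕ) ≠ p + 1) : (levelPair m hp x hx).1 r = m.1 r := by
  simp only [levelPair]
  rw [setPair_of_ne _ _ h₁ h₂, extend_of_lt _ r.2]

/-- The total weight of the tensor factors to the right of the positions `p` and `p + 1`. -/
def rightWeight {n : ℕ} (L : Fin n → ℂ) (m : Fin n → ℕ) (p : ℕ) : ℂ :=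
  ∑ r : Fin n, if p + 1 < (r : ℕ) then L r - 2 * m r else 0

theorem rightWeight_eq_sum {n : ℕ} (L : Fin n → ℂ) (m : Fin n → ℕ) (p : ℕ) :
    rightWeight L m p = ∑ r ∈ Finset.Ico (p + 2) n, (extend L r - 2 * extend m r) := by
  have h : ∀ r : Fin n, (if p + 1 < (r : ℕ) then L r - 2 * m r else 0) =
      (fun s : ℕ => if p + 1 < s then extend L s - 2 * ((extend m s : ℕ) : ℂ) else 0) (r : ℕ) := fun r => by
    simp only [extend_of_lt _ r.2]
  rw [rightWeight, Finset.sum_congr rfl fun r _ => h r,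
    ← Finset.sum_range fun r : ℕ => if p + 1 < r then extend L r - 2 * ((extend m r : ℕ) : ℂ) else 0,
    ← Finset.sum_filter]
  refine Finset.sum_congr ?_ fun _ _ => rfl
  ext r
  simp only [Finset.mem_filter, Finset.mem_range, Finset.mem_Ico]
  omega

theorem rightWeight_congr {n : ℕ} (L : Fin n → ℂ) {m a : Fin n → ℕ} {p : ℕ}
    (h : ∀ r : Fin n, (r : ℕ) ≠ p → (r : ℕ) ≠ p + 1 → m r = a r) :
    rightWeight L m p = rightWeight L a p := by
  refine Finset.sum_congr rfl fun r _ => ?_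
  split_ifs with hr
  · rw [h r (by omega) (by omega)]
  · rfl

theorem braid_apply (R : RFamily) {n N : ℕ} (L : Fin n → ℂ) {p : ℕ} (hp : p + 1 < n) (lam : ℂ)
    (b a : Level n N) : braid R L p lam b a =
      if ∀ r : Fin n, (r : ℕ) ≠ p → (r : ℕ) ≠ p + 1 → b.1 r = a.1 r then
        R (extend L (p + 1)) (extend L p) (lam - rightWeight L a.1 p) (extend a.1 (p + 1))
          (extend a.1 p) (extend b.1 p) (extend b.1 (p + 1)) else 0 := by
  rw [show (braid R L p lam : Matrix (Level n N) (Level n N) ℂ) = _ from dif_pos hp, extend_of_lt L hp, extend_of_lt L (by omega : p < n), extend_of_lt a.1 hp,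
    extend_of_lt a.1 (by omega : p < n), extend_of_lt b.1 hp, extend_of_lt b.1 (by omega : p < n)]
  rfl

theorem braid_of_le (R : RFamily) {n N : ℕ} (L : Fin n → ℂ) {p : ℕ} (hp : ¬p + 1 < n) (lam : ℂ) :
    (braid R L p lam : Matrix (Level n N) (Level n N) ℂ) = 1 := dif_neg hp

/-- The genericity condition on `λ` for the operators in the positions `p` and `p + 1`. -/
def BraidGeneric (η : ℂ) {n : ℕ} (N : ℕ) (L : Fin n → ℂ) (p : ℕ) (lam : ℂ) : Prop :=
  p + 1 < n → ∀ a : Level n N,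
    Generic η (extend L p) (extend L (p + 1)) (extend a.1 p + extend a.1 (p + 1))
      (lam - rightWeight L a.1 p) ∧
    Generic η (extend L (p + 1)) (extend L p) (extend a.1 p + extend a.1 (p + 1))
      (lam - rightWeight L a.1 p)

theorem eventually_generic_add {η : ℂ} (hη : 0 < η.im) (L₁ L₂ : ℂ) (N : ℕ) (c : ℂ) :
    ∀ᶠ lam in codiscrete ℂ, Generic η L₁ L₂ N (lam + c) := by
  filter_upwards [eventually_qnum_int_ne_zero hη (c - L₂) (2 * N + 1),
    eventually_qnum_int_ne_zero hη (c - L₁ - L₂) (2 * N + 1)] with lam h₁ h₂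
  refine generic_of_int (2 * N + 1) le_rfl (fun j hj => ?_) fun j hj => ?_
  · simpa only [add_sub_assoc] using h₁ j hj
  · simpa only [add_sub_assoc] using h₂ j hj

theorem eventually_braidGeneric {η : ℂ} (hη : 0 < η.im) {n : ℕ} (N : ℕ) (L : Fin n → ℂ) (p : ℕ)
    (c : ℂ) : ∀ᶠ lam in codiscrete ℂ, BraidGeneric η N L p (lam + c) := by
  by_cases hp : p + 1 < n
  · have : ∀ᶠ lam in codiscrete ℂ, ∀ a : Level n N,
        Generic η (extend L p) (extend L (p + 1)) (extend a.1 p + extend a.1 (p + 1))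
          (lam + c - rightWeight L a.1 p) ∧
        Generic η (extend L (p + 1)) (extend L p) (extend a.1 p + extend a.1 (p + 1))
          (lam + c - rightWeight L a.1 p) := by
      refine eventually_all.mpr fun a => ?_
      simp only [add_sub_assoc]
      exact (eventually_generic_add hη _ _ _ _).and (eventually_generic_add hη _ _ _ _)
    filter_upwards [this] with lam h _ using h
  · exact Eventually.of_forall fun lam h => absurd h hp

/-! ### Invertibility -/

open Finset.HasAntidiagonal in
-- The quantum R-matrix is triangular with powers of q on the diagonal, so a row vector that it
-- annihilates vanishes entry by entry.
theorem quantumR_left_kernel {η : ℂ} (La Lb z : ℂ) {s : ℕ} (X : ℕ × ℕ → ℂ)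
    (hX : ∀ a ∈ antidiagonal s, ∑ x ∈ antidiagonal s, X x * quantumR η La Lb z a.2 a.1 x.1 x.2 = 0)
    (x : ℕ × ℕ) (hx : x.1 + x.2 = s) : X x = 0 := by
  obtain ⟨x₁, x₂⟩ := x
  simp only at hx
  induction x₁ using Nat.strong_induction_on generalizing x₂ with
  | _ x₁ ih =>
    have h := hX (x₂, x₁) (mem_antidiagonal.mpr (by simp only; omega))
    rw [Finset.sum_eq_single (x₁, x₂)] at h
    · refine (mul_eq_zero.mp h).resolve_right ?_
      rw [quantumR_eq, if_pos ⟨le_rfl, rfl⟩, Nat.sub_self, rCoef, qpoch_zero, qpoch_zero, qfact_zero,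
        pow_zero]
      simp only [mul_one, div_one]
      exact mul_ne_zero (qpow_ne_zero _ _) (qpow_ne_zero _ _)
    · rintro ⟨c₁, c₂⟩ hc hne
      have hc' : c₁ + c₂ = s := mem_antidiagonal.mp hc
      rcases lt_trichotomy c₁ x₁ with hlt | heq | hgt
      · rw [ih c₁ hlt c₂ hc', zero_mul]
      · exact absurd (by ext <;> simp <;> omega) hne
      · rw [quantumR_eq, if_neg (by simp only; omega), mul_zero]
    · intro hn
      exact absurd (mem_antidiagonal.mpr hx) hn

open Finset.HasAntidiagonal in
-- By the exchange relation, a row vector annihilated by the dynamical R-matrix yields a combination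
-- of the reversed products annihilated by the quantum R-matrix. The latter is invertible, and the
-- reversed products are linearly independent. This is why genericity is required for both orders of
-- the weights.
theorem dynamicalR_left_kernel {η : ℂ} (hη : 0 < η.im) {L₁ L₂ lam : ℂ} {s : ℕ}
    (h₁ : Generic η L₁ L₂ s lam) (h₂ : Generic η L₂ L₁ s lam) (X : ℕ × ℕ → ℂ)
    (hX : ∀ a ∈ antidiagonal s,
      ∑ x ∈ antidiagonal s, X x * dynamicalR η L₂ L₁ lam a.2 a.1 x.1 x.2 = 0)
    (x : ℕ × ℕ) (hx : x.1 + x.2 = s) : X x = 0 := by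
  refine pairCoef_linearIndependent hη h₂ X (fun b hb => ?_) x hx
  have key := quantumR_left_kernel (η := η) L₂ L₁ 0
    (fun c => ∑ y ∈ antidiagonal s, X y * pairCoef η L₂ L₁ y.1 y.2 lam 0 c.1 c.2) (s := s) ?_
    (s - b, b) (by simp only; omega)
  · exact key
  · rintro ⟨b₁, b₂⟩ hb
    have hb' : b₁ + b₂ = s := mem_antidiagonal.mp hb
    have h0 : ∑ a ∈ antidiagonal s, (∑ y ∈ antidiagonal s,
        X y * dynamicalR η L₂ L₁ lam a.2 a.1 y.1 y.2) * pairCoef η L₁ L₂ a.1 a.2 lam 0 b₁ b₂ = 0 :=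
      Finset.sum_eq_zero fun a ha => by rw [hX a ha, zero_mul]
    refine Eq.trans ?_ h0
    simp only [Finset.sum_mul]
    refine Finset.sum_comm.trans (Eq.trans (Finset.sum_congr rfl fun y hy => ?_) Finset.sum_comm)
    simp only [mul_assoc, ← Finset.mul_sum]
    rw [exchange hη (mem_antidiagonal.mp hy) h₁, ← sum_quantumR_eq_rContract η L₁ L₂ 0, hb']

open Finset.HasAntidiagonal in
-- The matrix is block diagonal: a block is given by fixing all entries other than those at p and p
-- + 1, and it suffices to have trivial left kernel in each block.
theorem isUnit_braid_of_left_kernel {R : RFamily} {n N : ℕ} (L : Fin n → ℂ) {p : ℕ} (hp : p + 1 < n)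
    (lam : ℂ) (h : ∀ (m : Level n N) (X : ℕ × ℕ → ℂ),
      (∀ a ∈ antidiagonal (extend m.1 p + extend m.1 (p + 1)),
        ∑ x ∈ antidiagonal (extend m.1 p + extend m.1 (p + 1)),
          X x * R (extend L (p + 1)) (extend L p) (lam - rightWeight L m.1 p) a.2 a.1 x.1 x.2 = 0) →
      ∀ x : ℕ × ℕ, x.1 + x.2 = extend m.1 p + extend m.1 (p + 1) → X x = 0) :
    IsUnit (braid R L p lam : Matrix (Level n N) (Level n N) ℂ) := by
  suffices key : ∀ u : Level n N → ℂ, Matrix.vecMul u (braid R L p lam) = 0 → u = 0 by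
    refine Matrix.vecMul_injective_iff_isUnit.mp fun v w hvw => sub_eq_zero.mp (key _ ?_)
    rw [Matrix.sub_vecMul, sub_eq_zero]
    exact hvw
  intro u hu
  funext m
  set s := extend m.1 p + extend m.1 (p + 1) with hs
  have := h m (fun x => if hx : x.1 + x.2 = s then u (levelPair m hp x hx) else 0) ?_
    (extend m.1 p, extend m.1 (p + 1)) rfl
  · simp only [← hs, dif_pos] at this
    rw [Pi.zero_apply, ← this]
    congr 1
    refine Subtype.ext (funext fun r => ?_)
    by_cases h₁ : (r : ℕ) = p
    · rw [← extend_of_lt m.1 r.2, ← extend_of_lt (levelPair m hp _ _).1 r.2, h₁,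
        extend_levelPair_left]
    by_cases h₂ : (r : ℕ) = p + 1
    · rw [← extend_of_lt m.1 r.2, ← extend_of_lt (levelPair m hp _ _).1 r.2, h₂,
        extend_levelPair_right]
    exact (levelPair_val_of_ne m hp _ _ r h₁ h₂).symm
  · intro a ha
    have ha' := mem_antidiagonal.mp ha
    refine Eq.trans ?_ (congrFun hu (levelPair m hp a ha'))
    rw [Matrix.vecMul, dotProduct]
    have hb : ∀ b : Level n N, u b * braid R L p lam b (levelPair m hp a ha') =
        if ∀ r : Fin n, (r : ℕ) ≠ p → (r : ℕ) ≠ p + 1 → m.1 r = b.1 r then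
          u b * R (extend L (p + 1)) (extend L p) (lam - rightWeight L m.1 p) a.2 a.1
            (extend b.1 p) (extend b.1 (p + 1)) else 0 := by
      intro b
      rw [braid_apply _ _ hp, extend_levelPair_left, extend_levelPair_right,
        rightWeight_congr L fun r h₁ h₂ => levelPair_val_of_ne m hp a ha' r h₁ h₂]
      have : (∀ r : Fin n, (r : ℕ) ≠ p → (r : ℕ) ≠ p + 1 → b.1 r = (levelPair m hp a ha').1 r) ↔
          ∀ r : Fin n, (r : ℕ) ≠ p → (r : ℕ) ≠ p + 1 → m.1 r = b.1 r := by
        refine forall_congr' fun r => forall_congr' fun h₁ => forall_congr' fun h₂ => ?_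
        rw [levelPair_val_of_ne m hp a ha' r h₁ h₂, eq_comm]
      simp only [this, mul_ite, mul_zero]
    rw [Finset.sum_congr rfl fun b _ => hb b, sum_level_pair m hp fun b => u b *
      R (extend L (p + 1)) (extend L p) (lam - rightWeight L m.1 p) a.2 a.1
        (extend b.1 p) (extend b.1 (p + 1)), ← Finset.sum_coe_sort]
    refine Finset.sum_congr rfl fun x _ => ?_
    rw [dif_pos (mem_antidiagonal.mp x.2), extend_levelPair_left, extend_levelPair_right]

theorem isUnit_braid_quantumR (η : ℂ) {n N : ℕ} (L : Fin n → ℂ) (p : ℕ) (lam : ℂ) :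
    IsUnit (braid (quantumR η) L p lam : Matrix (Level n N) (Level n N) ℂ) := by
  by_cases hp : p + 1 < n
  · exact isUnit_braid_of_left_kernel L hp lam fun m X hX => quantumR_left_kernel _ _ _ X hX
  · rw [braid_of_le _ _ hp]; exact isUnit_one

theorem isUnit_braid_dynamicalR {η : ℂ} (hη : 0 < η.im) {n N : ℕ} {L : Fin n → ℂ} {p : ℕ} {lam : ℂ}
    (h : BraidGeneric η N L p lam) :
    IsUnit (braid (dynamicalR η) L p lam : Matrix (Level n N) (Level n N) ℂ) := by
  by_cases hp : p + 1 < n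
  · exact isUnit_braid_of_left_kernel L hp lam fun m X hX =>
      dynamicalR_left_kernel hη (h hp m).1 (h hp m).2 X hX
  · rw [braid_of_le _ _ hp]; exact isUnit_one

/-! ### The exchange relation for the trace matrix -/

theorem swapAt_eq {n : ℕ} (L : Fin n → ℂ) {p : ℕ} (hp : p + 1 < n) :
    swapAt L p = fun i : Fin n => (extend L ∘ Equiv.swap p (p + 1)) i := by
  rw [swapAt, dif_pos hp]
  funext i
  simp only [Function.comp_apply]
  by_cases h₁ : (i : ℕ) = p
  · have hi : i = ⟨p, by omega⟩ := Fin.ext h₁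
    rw [h₁, Equiv.swap_apply_left, extend_of_lt _ hp]
    exact congrArg L ((congrArg _ hi).trans (Equiv.swap_apply_left _ _))
  by_cases h₂ : (i : ℕ) = p + 1
  · have hi : i = ⟨p + 1, hp⟩ := Fin.ext h₂
    rw [h₂, Equiv.swap_apply_right, extend_of_lt _ (by omega : p < n)]
    exact congrArg L ((congrArg _ hi).trans (Equiv.swap_apply_right _ _))
  rw [Equiv.swap_apply_of_ne_of_ne h₁ h₂, extend_of_lt _ i.2, Equiv.swap_apply_of_ne_of_ne]
  · exact fun h => h₁ (congrArg Fin.val h)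
  · exact fun h => h₂ (congrArg Fin.val h)

theorem swapAt_of_le {n : ℕ} (L : Fin n → ℂ) {p : ℕ} (hp : ¬p + 1 < n) : swapAt L p = L := dif_neg hp

theorem sum_swapAt {n : ℕ} (L : Fin n → ℂ) (p : ℕ) : ∑ i, swapAt L p i = ∑ i, L i := by
  rw [swapAt]
  split_ifs with h
  · exact Equiv.sum_comp _ L
  · rfl

open Finset.HasAntidiagonal in
-- The matrix form of `chainSeq_exchange`: the dynamical R-matrix acts on the labels of the
-- operators, the quantum one on the components of their values.
theorem braid_chainCoef {η : ℂ} (hη : 0 < η.im) {n N : ℕ} (L : Fin n → ℂ) (p : ℕ) (lam : ℂ)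
    (h : BraidGeneric η N L p lam) (k : ℤ) (m b : Level n N) :
    ∑ a : Level n N, braid (dynamicalR η) L p lam m a * chainCoef η n L a.1 lam k b.1 =
      ∑ c : Level n N, chainCoef η n (swapAt L p) m.1 lam k c.1 * braid (quantumR η) L p 0 c b := by
  by_cases hp : p + 1 < n
  swap
  · simp [braid_of_le _ _ hp, swapAt_of_le _ hp, Matrix.one_apply]
  have hl : ∀ a : Level n N, braid (dynamicalR η) L p lam m a * chainCoef η n L a.1 lam k b.1 =
      if ∀ r : Fin n, (r : ℕ) ≠ p → (r : ℕ) ≠ p + 1 → m.1 r = a.1 r then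
        dynamicalR η (extend L (p + 1)) (extend L p) (lam - rightWeight L m.1 p) (extend a.1 (p + 1))
          (extend a.1 p) (extend m.1 p) (extend m.1 (p + 1)) * chainCoef η n L a.1 lam k b.1 else 0 := by
    intro a
    rw [braid_apply _ _ hp]
    split_ifs with ha
    · rw [rightWeight_congr L ha]
    · rw [zero_mul]
  have hr : ∀ c : Level n N, chainCoef η n (swapAt L p) m.1 lam k c.1 * braid (quantumR η) L p 0 c b =
      if ∀ r : Fin n, (r : ℕ) ≠ p → (r : ℕ) ≠ p + 1 → b.1 r = c.1 r then
        chainCoef η n (swapAt L p) m.1 lam k c.1 * quantumR η (extend L (p + 1)) (extend L p) 0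
          (extend b.1 (p + 1)) (extend b.1 p) (extend c.1 p) (extend c.1 (p + 1)) else 0 := by
    intro c
    rw [braid_apply _ _ hp]
    simp only [eq_comm (a := b.1 _)]
    split_ifs with ha
    · rfl
    · rw [mul_zero]
  rw [Finset.sum_congr rfl fun a _ => hl a, Finset.sum_congr rfl fun c _ => hr c,
    sum_level_pair m hp fun a => dynamicalR η (extend L (p + 1)) (extend L p)
      (lam - rightWeight L m.1 p) (extend a.1 (p + 1)) (extend a.1 p) (extend m.1 p)
      (extend m.1 (p + 1)) * chainCoef η n L a.1 lam k b.1,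
    sum_level_pair b hp fun c => chainCoef η n (swapAt L p) m.1 lam k c.1 *
      quantumR η (extend L (p + 1)) (extend L p) 0 (extend b.1 (p + 1)) (extend b.1 p) (extend c.1 p)
        (extend c.1 (p + 1))]
  simp only [extend_levelPair_left, extend_levelPair_right]
  have hm := (h hp m).1
  rw [rightWeight_eq_sum] at hm ⊢
  have key := chainSeq_exchange hη (extend L) (extend m.1) (extend b.1) p n (by omega) lam k hm
  rw [← Finset.sum_coe_sort (antidiagonal (extend m.1 p + extend m.1 (p + 1))),
    ← Finset.sum_coe_sort (antidiagonal (extend b.1 p + extend b.1 (p + 1)))] at key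
  refine Eq.trans (Finset.sum_congr rfl fun x _ => ?_) (key.trans (Finset.sum_congr rfl fun c _ => ?_))
  · rw [← chainCoef_eq_chainSeq, extend_coe, extend_coe]
    rfl
  · rw [← chainCoef_eq_chainSeq, extend_coe, ← swapAt_eq L hp]
    rfl

theorem traceTerm_eq {η : ℂ} (hη : 0 < η.im) {n N : ℕ} (L : Fin n → ℂ) (lam : ℂ) (m m' : Level n N)
    (k : ℕ) (x : ℂ) : traceTerm η L lam m m' k x = chainCoef η n L m.1 lam k m'.1 *
      (qpow η (-(N * (N + 1) / 2)) * (qpow η 1 - qpow η (-1)) ^ N * (qpow η x - qpow η (-x)) *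
        qpow η ((lam - 1 - 2 * k) * x)) := by
  rw [traceTerm, Phi_apply_diagonal hη]; ring

/-- The exchange relation for the universal trace matrix. -/
theorem braid_mul_traceMatrix {η : ℂ} (hη : 0 < η.im) {n N : ℕ} {L : Fin n → ℂ}
    (hL : ∑ i, L i = 2 * (N : ℂ)) (p : ℕ) {lam : ℂ} (h : BraidGeneric η N L p lam) {x : ℂ}
    (hx : ∀ k ∈ Finset.Icc 1 N, qnum η (x + k) ≠ 0) :
    braid (dynamicalR η) L p lam * (traceMatrix η L lam x : Matrix (Level n N) (Level n N) ℂ) =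
      traceMatrix η (swapAt L p) lam x * braid (quantumR η) L p 0 := by
  have hL' : ∑ i, swapAt L p i = 2 * (N : ℂ) := by rw [sum_swapAt, hL]
  ext m b
  rw [Matrix.mul_apply, Matrix.mul_apply]
  have h₁ := fun a : Level n N => (isTraceFunction_traceFun hη hL lam a b).2
  have h₂ := fun c : Level n N => (isTraceFunction_traceFun hη hL' lam m c).2
  choose C₁ h₁ using h₁
  choose C₂ h₂ using h₂
  -- There are finitely many matrix elements, so all their trace series converge on a common domain.
  obtain ⟨B₁, hB₁⟩ := (Set.finite_range C₁).bddAbove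
  obtain ⟨B₂, hB₂⟩ := (Set.finite_range C₂).bddAbove
  refine eq_of_eq_of_large_norm hη N (C := max B₁ B₂)
    (f := fun x => ∑ a, braid (dynamicalR η) L p lam m a * traceMatrix η L lam x a b)
    (g := fun x => ∑ c, traceMatrix η (swapAt L p) lam x m c * braid (quantumR η) L p 0 c b)
    (fun z hz => ?_) (fun z hz => ?_) (fun z hz => ?_) hx
  · exact Finset.analyticAt_fun_sum _ fun a _ =>
      analyticAt_const.mul (analyticAt_traceFun hη hL lam a b hz)
  · exact Finset.analyticAt_fun_sum _ fun c _ =>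
      (analyticAt_traceFun hη hL' lam m c hz).mul analyticAt_const
  · have s₁ : HasSum (fun k : ℕ => ∑ a, braid (dynamicalR η) L p lam m a *
        traceTerm η L lam a b k z) (∑ a, braid (dynamicalR η) L p lam m a *
        traceMatrix η L lam z a b) := hasSum_sum fun a _ => (h₁ a z
          (((hB₁ ⟨a, rfl⟩).trans (le_max_left _ _)).trans_lt hz)).mul_left _
    have s₂ : HasSum (fun k : ℕ => ∑ c, traceTerm η (swapAt L p) lam m c k z *
        braid (quantumR η) L p 0 c b) (∑ c, traceMatrix η (swapAt L p) lam z m c *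
        braid (quantumR η) L p 0 c b) := hasSum_sum fun c _ => (h₂ c z
          (((hB₂ ⟨c, rfl⟩).trans (le_max_right _ _)).trans_lt hz)).mul_right _
    refine s₁.unique ?_
    convert s₂ using 2 with k
    simp only [traceTerm_eq hη, mul_right_comm _ _ (braid (quantumR η) L p 0 _ b)]
    rw [← Finset.sum_mul, ← braid_chainCoef hη L p lam h, Finset.sum_mul]
    exact Finset.sum_congr rfl fun a _ => (mul_assoc _ _ _).symm

/-! ### Cyclicity of the trace -/

theorem chainCoef_succ (η : ℂ) (n : ℕ) (L : Fin (n + 1) → ℂ) (m : Fin (n + 1) → ℕ) (lam : ℂ)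
    (k : ℤ) (b : Fin (n + 1) → ℕ) : chainCoef η (n + 1) L m lam k b =
      tcoef η (L (Fin.last n)) (m (Fin.last n)) lam k (b (Fin.last n)) *
        chainCoef η n (Fin.init L) (Fin.init m) (lam - L (Fin.last n) + 2 * m (Fin.last n))
          (k + m (Fin.last n) - b (Fin.last n)) (Fin.init b) := rfl

/-- Splits off the operator applied last, whereas the definition splits off the one applied first;
cyclicity compares the two. -/
theorem chainCoef_succ_left (η : ℂ) (n : ℕ) (L : Fin (n + 1) → ℂ) (m : Fin (n + 1) → ℕ) (lam : ℂ)
    (k : ℤ) (b : Fin (n + 1) → ℕ) : chainCoef η (n + 1) L m lam k b =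
      chainCoef η n (Fin.tail L) (Fin.tail m) lam k (Fin.tail b) *
        tcoef η (L 0) (m 0) (lam - ∑ i : Fin n, (L i.succ - 2 * m i.succ))
          (k + ∑ i : Fin n, ((m i.succ : ℤ) - b i.succ)) (b 0) := by
  induction n generalizing lam k with
  | zero =>
    rw [chainCoef]
    simp [chainCoef]
  | succ n ih =>
    rw [chainCoef_succ, ih, chainCoef_succ η n (Fin.tail L), Fin.sum_univ_castSucc, Fin.sum_univ_castSucc, mul_assoc]
    simp only [Fin.tail_init_eq_init_tail]
    congr 3
    · simp only [Fin.init, Fin.succ_last, Fin.succ_castSucc]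
      ring
    · simp only [Fin.init, Fin.succ_last, Fin.succ_castSucc]
      ring

theorem chainCoef_of_neg (η : ℂ) (n : ℕ) (L : Fin (n + 1) → ℂ) (m : Fin (n + 1) → ℕ) (lam : ℂ)
    {k : ℤ} (b : Fin (n + 1) → ℕ) (hk : k < 0) : chainCoef η (n + 1) L m lam k b = 0 := by
  rw [chainCoef, tcoef_of_neg_left _ _ _ _ _ hk, zero_mul]

theorem init_comp_finRotate {α : Type} {n : ℕ} (f : Fin (n + 1) → α) :
    Fin.init (f ∘ finRotate (n + 1)) = Fin.tail f := by
  funext i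
  simp [Fin.init, Fin.tail]

/-- Moving the operator applied last to the position where it is applied first. Since the total
weight is zero, that operator acts at parameter λ in both orders, and the starting index changes
from k to the index at which it is applied. -/
theorem chainCoef_comp_finRotate (η : ℂ) {n N : ℕ} {L : Fin (n + 1) → ℂ}
    (hL : ∑ i, L i = 2 * (N : ℂ)) (lam : ℂ) (k : ℤ) (a c : Level (n + 1) N) :
    chainCoef η (n + 1) L a.1 (lam - L 0 + 2 * a.1 0) k c.1 =
      chainCoef η (n + 1) (L ∘ finRotate (n + 1)) (a.1 ∘ finRotate (n + 1)) lam
        (k + (c.1 0 - a.1 0)) (c.1 ∘ finRotate (n + 1)) := by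
  have ha : (∑ i : Fin n, (a.1 i.succ : ℤ)) = N - a.1 0 := by
    have := a.sum_eq
    rw [Fin.sum_univ_succ] at this
    have : ((a.1 0 + ∑ i : Fin n, a.1 i.succ : ℕ) : ℤ) = N := by exact_mod_cast this
    push_cast at this
    linarith
  have hc : (∑ i : Fin n, (c.1 i.succ : ℤ)) = N - c.1 0 := by
    have := c.sum_eq
    rw [Fin.sum_univ_succ] at this
    have : ((c.1 0 + ∑ i : Fin n, c.1 i.succ : ℕ) : ℤ) = N := by exact_mod_cast this
    push_cast at this
    linarith
  have ha' : (∑ i : Fin n, (a.1 i.succ : ℂ)) = N - a.1 0 := by exact_mod_cast congrArg (Int.cast : ℤ → ℂ) ha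
  have hL' : ∑ i : Fin n, L i.succ = 2 * N - L 0 := by
    rw [← hL, Fin.sum_univ_succ]; ring
  rw [chainCoef_succ_left, chainCoef, init_comp_finRotate, init_comp_finRotate, init_comp_finRotate,
    Finset.sum_sub_distrib, Finset.sum_sub_distrib, ← Finset.mul_sum, ha, hc, ha', hL', mul_comm]
  simp only [Function.comp_apply, finRotate_last]
  congr 2
  · ring
  · ring
  · ring

/-- The cyclic permutation of a multi-index. -/
def Level.rotate {n N : ℕ} (a : Level n N) : Level n N :=
  ⟨a.1 ∘ finRotate n, by
    rw [Finset.Nat.mem_antidiagonalTuple]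
    exact (Equiv.sum_comp (finRotate n) a.1).trans a.sum_eq⟩

theorem sum_comp_finRotate {n : ℕ} (L : Fin n → ℂ) : ∑ i, (L ∘ finRotate n) i = ∑ i, L i :=
  Equiv.sum_comp (finRotate n) L

theorem Level.rotate_injective {n N : ℕ} : Function.Injective (Level.rotate : Level n N → Level n N) := by
  intro a c h
  exact Subtype.ext ((finRotate n).surjective.injective_comp_right (congrArg Subtype.val h))

theorem Level.rotate_bijective {n N : ℕ} : Function.Bijective (Level.rotate : Level n N → Level n N) :=
  Finite.injective_iff_bijective.mp Level.rotate_injective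

/-- The trace as a sum over all integers. -/
theorem hasSum_int_of_traceTerm {η : ℂ} (hη : 0 < η.im) {n N : ℕ} (L : Fin (n + 1) → ℂ) (lam : ℂ)
    (m m' : Level (n + 1) N) (x s : ℂ) :
    HasSum (fun k : ℕ => traceTerm η L lam m m' k x) s ↔
    HasSum (fun k : ℤ => chainCoef η (n + 1) L m.1 lam k m'.1 *
      (qpow η (-(N * (N + 1) / 2)) * (qpow η 1 - qpow η (-1)) ^ N * (qpow η x - qpow η (-x)) *
        qpow η ((lam - 1 - 2 * k) * x))) s := by
  rw [← (Nat.cast_injective (R := ℤ)).hasSum_iff]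
  · simp only [Function.comp_def, traceTerm_eq hη, Int.cast_natCast]
  · intro k hk
    rw [chainCoef_of_neg, zero_mul]
    by_contra h
    exact hk ⟨k.toNat, by simp; omega⟩

/-- Rotation shifts both λ and the summation index k. The discrepancy between the two values of
q^{xh} is the weight of the rotated factor, which gives the power of q. -/
theorem traceMatrix_rotate {η : ℂ} (hη : 0 < η.im) {n N : ℕ} [NeZero n] {L : Fin n → ℂ}
    (hL : ∑ i, L i = 2 * (N : ℂ)) (lam : ℂ) {x : ℂ} (hx : ∀ k ∈ Finset.Icc 1 N, qnum η (x + k) ≠ 0)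
    (a c : Level n N) : traceMatrix η L (lam - L 0 + 2 * a.1 0) x a c =
      traceMatrix η (L ∘ finRotate n) lam x a.rotate c.rotate * qpow η (-((L 0 - 2 * c.1 0) * x)) := by
  obtain ⟨n, rfl⟩ : ∃ d, n = d + 1 := Nat.exists_eq_succ_of_ne_zero (NeZero.ne n)
  have hL' := (sum_comp_finRotate L).trans hL
  obtain ⟨C, hC⟩ := (isTraceFunction_traceFun hη hL (lam - L 0 + 2 * a.1 0) a c).2
  obtain ⟨D, hD⟩ := (isTraceFunction_traceFun hη hL' lam a.rotate c.rotate).2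
  refine eq_of_eq_of_large_norm hη N (C := max C D)
    (f := fun x => traceMatrix η L (lam - L 0 + 2 * a.1 0) x a c)
    (g := fun x => traceMatrix η (L ∘ finRotate _) lam x a.rotate c.rotate *
      qpow η (-((L 0 - 2 * c.1 0) * x)))
    (fun z hz => analyticAt_traceFun hη hL _ a c hz)
    (fun z hz => (analyticAt_traceFun hη hL' lam _ _ hz).mul ?_) (fun z hz => ?_) hx
  · unfold qpow; fun_prop
  · have s₁ := hC z ((le_max_left _ _).trans_lt hz)
    have s₂ := hD z ((le_max_right _ _).trans_lt hz)
    rw [hasSum_int_of_traceTerm hη] at s₁ s₂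
    -- The shift of k may be negative; summing over all integers makes it a bijection and avoids
    -- boundary terms.
    rw [← (Equiv.addRight ((c.1 0 : ℤ) - a.1 0)).hasSum_iff] at s₂
    refine s₁.unique (Eq.mp (congrArg (fun f : ℤ → ℂ => HasSum f _) (funext fun k => ?_))
      (s₂.mul_right (qpow η (-((L 0 - 2 * c.1 0) * z)))))
    symm
    rw [chainCoef_comp_finRotate η hL, Function.comp_apply, Equiv.coe_addRight]
    have e : qpow η ((lam - L 0 + 2 * a.1 0 - 1 - 2 * k) * z) =
        qpow η ((lam - 1 - 2 * ((k + (c.1 0 - a.1 0) : ℤ) : ℂ)) * z) *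
          qpow η (-((L 0 - 2 * c.1 0) * z)) := by
      rw [← qpow_add]
      congr 1
      push_cast
      ring
    rw [e]
    simp only [Level.rotate]
    ring

theorem cyclicQ_apply (η : ℂ) {n N : ℕ} [NeZero n] (Λ x : ℂ) (b a : Level n N) :
    cyclicQ η Λ x b a =
      if b.1 = a.1 ∘ finRotate n then qpow η (-((Λ - 2 * a.1 0) * x)) else 0 := rfl

/-- Cyclicity of the trace. -/
theorem cyclicShift_traceMatrix {η : ℂ} (hη : 0 < η.im) {n N : ℕ} [NeZero n] {L : Fin n → ℂ}
    (hL : ∑ i, L i = 2 * (N : ℂ)) (lam : ℂ) {x : ℂ} (hx : ∀ k ∈ Finset.Icc 1 N, qnum η (x + k) ≠ 0)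
    (ξ : Level n N → ℂ) :
    cyclicShift (L 0) (fun mu => (traceMatrix η L mu x).mulVec ξ) lam =
      (traceMatrix η (L ∘ finRotate n) lam x).mulVec ((cyclicQ η (L 0) x).mulVec ξ) := by
  have hq : ∀ c : Level n N, (cyclicQ η (L 0) x).mulVec ξ c.rotate =
      qpow η (-((L 0 - 2 * c.1 0) * x)) * ξ c := by
    intro c
    refine (Finset.sum_eq_single c (fun d _ hd => ?_) fun h => absurd (Finset.mem_univ _) h).trans ?_
    · beta_reduce
      rw [cyclicQ_apply, if_neg, zero_mul]
      exact fun h => hd (Level.rotate_injective (Subtype.ext h.symm))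
    · beta_reduce
      rw [cyclicQ_apply, if_pos (show c.rotate.1 = c.1 ∘ finRotate n from rfl)]
  funext b
  obtain ⟨a, rfl⟩ := Level.rotate_bijective.2 b
  rw [cyclicShift, Finset.sum_eq_single a, if_pos (show a.rotate.1 = a.1 ∘ finRotate n from rfl)]
  · rw [Matrix.mulVec, Matrix.mulVec, dotProduct, dotProduct]
    refine Finset.sum_bij (fun c _ => c.rotate) (fun _ _ => Finset.mem_univ _)
      (fun _ _ _ _ h => Level.rotate_injective h)
      (fun c _ => (Level.rotate_bijective.2 c).imp fun _ h => ⟨Finset.mem_univ _, h⟩) fun c _ => ?_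
    rw [hq, traceMatrix_rotate hη hL lam hx, mul_assoc]
  · exact fun d _ hd => if_neg fun h => hd (Level.rotate_injective (Subtype.ext h.symm))
  · exact fun h => absurd (Finset.mem_univ _) h

/-! ### The qKZ and qKZB operators -/

theorem extend_swapAt {n : ℕ} (L : Fin n → ℂ) {p : ℕ} (hp : p + 1 < n) {r : ℕ} (hr : r < n) :
    extend (swapAt L p) r = extend L (Equiv.swap p (p + 1) r) := by
  rw [extend_of_lt _ hr, swapAt_eq L hp]
  rfl

/-- The arrangement after the factor at position `p` has been moved to the front. -/
def frontAt {n : ℕ} : ℕ → (Fin n → ℂ) → Fin n → ℂ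
  | 0, L => L
  | p + 1, L => frontAt p (swapAt L p)

/-- The arrangement after the factor at position `p` has been moved to position `p + d`. -/
def backAt {n : ℕ} : ℕ → ℕ → (Fin n → ℂ) → Fin n → ℂ
  | 0, _, L => L
  | d + 1, p, L => backAt d (p + 1) (swapAt L p)

theorem sum_frontAt {n : ℕ} (p : ℕ) (L : Fin n → ℂ) : ∑ i, frontAt p L i = ∑ i, L i := by
  induction p generalizing L with
  | zero => rfl
  | succ p ih => rw [frontAt, ih, sum_swapAt]

theorem extend_frontAt {n : ℕ} {p : ℕ} (hp : p < n) (L : Fin n → ℂ) {r : ℕ} (hr : r < n) :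
    extend (frontAt p L) r =
      extend L (if r = 0 then p else if r ≤ p then r - 1 else r) := by
  induction p generalizing L with
  | zero =>
    rw [frontAt]
    congr 1
    split_ifs <;> omega
  | succ p ih =>
    rw [frontAt, ih (by omega), extend_swapAt _ hp (by split_ifs <;> omega)]
    congr 1
    rw [Equiv.swap_apply_def]
    split_ifs <;> omega

theorem extend_backAt {n : ℕ} {d p : ℕ} (hp : p + d < n) (L : Fin n → ℂ) {r : ℕ} (hr : r < n) :
    extend (backAt d p L) r =
      extend L (if r < p ∨ p + d < r then r else if r = p + d then p else r + 1) := by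
  induction d generalizing p L with
  | zero =>
    rw [backAt]
    congr 1
    split_ifs <;> omega
  | succ d ih =>
    rw [backAt, ih (by omega), extend_swapAt _ (by omega) (by split_ifs <;> omega)]
    congr 1
    rw [Equiv.swap_apply_def]
    split_ifs <;> omega

theorem frontAt_zero {n : ℕ} [NeZero n] (j : Fin n) (L : Fin n → ℂ) : frontAt j L 0 = L j := by
  have h := extend_frontAt j.2 L (NeZero.pos n)
  rw [if_pos rfl, extend_of_lt _ (NeZero.pos n), extend_of_lt _ j.2] at h
  exact h

/-- Moving a factor to the front and then rotating it to the end leaves the others in their original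
order, as does moving it directly to the end. -/
theorem frontAt_comp_finRotate {n : ℕ} (j : Fin n) (L : Fin n → ℂ) :
    frontAt j L ∘ finRotate n = backAt (n - 1 - j) j L := by
  obtain ⟨n, rfl⟩ : ∃ d, n = d + 1 := ⟨n - 1, by have := j.2; omega⟩
  funext i
  rw [← extend_of_lt (backAt (n + 1 - 1 - j) j L) i.2, extend_backAt (by have := j.2; omega) _ i.2,
    Function.comp_apply, ← extend_of_lt (frontAt j L) (finRotate (n + 1) i).2,
    extend_frontAt j.2 _ (finRotate (n + 1) i).2, coe_finRotate]
  congr 1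
  have hi := i.2
  have hj := j.2
  simp only [Fin.ext_iff, Fin.val_last]
  by_cases h : (i : ℕ) = n
  · simp only [if_pos h]
    split_ifs <;> omega
  · simp only [if_neg h]
    split_ifs <;> first | contradiction | omega

/-- Genericity of `λ` for all the factors of `toFront`. -/
def FrontGeneric (η : ℂ) {n : ℕ} (N : ℕ) : ℕ → (Fin n → ℂ) → ℂ → Prop
  | 0, _, _ => True
  | p + 1, L, lam => BraidGeneric η N L p lam ∧ FrontGeneric η N p (swapAt L p) lam

/-- Genericity of `λ` for all the factors of `fromBack`. -/
def BackGeneric (η : ℂ) {n : ℕ} (N : ℕ) : ℕ → ℕ → (Fin n → ℂ) → ℂ → Prop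
  | 0, _, _, _ => True
  | d + 1, p, L, lam => BraidGeneric η N L p lam ∧ BackGeneric η N d (p + 1) (swapAt L p) lam

theorem eventually_frontGeneric {η : ℂ} (hη : 0 < η.im) {n : ℕ} (N p : ℕ) (L : Fin n → ℂ) (c : ℂ) :
    ∀ᶠ lam in codiscrete ℂ, FrontGeneric η N p L (lam + c) := by
  induction p generalizing L with
  | zero => exact Eventually.of_forall fun _ => trivial
  | succ p ih => exact (eventually_braidGeneric hη N L p c).and (ih _)

theorem eventually_backGeneric {η : ℂ} (hη : 0 < η.im) {n : ℕ} (N d p : ℕ) (L : Fin n → ℂ) :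
    ∀ᶠ lam in codiscrete ℂ, BackGeneric η N d p L lam := by
  induction d generalizing p L with
  | zero => exact Eventually.of_forall fun _ => trivial
  | succ d ih =>
    refine ((eventually_braidGeneric hη N L p 0).mono fun lam h => ?_).and (ih _ _)
    rwa [add_zero] at h

/-- Repeated use of `braid_mul_traceMatrix`, the arrangement of weights changing at each
interchange. -/
theorem toFront_mul_traceMatrix {η : ℂ} (hη : 0 < η.im) {n N : ℕ} {L : Fin n → ℂ}
    (hL : ∑ i, L i = 2 * (N : ℂ)) (p : ℕ) {lam : ℂ} (h : FrontGeneric η N p L lam) {x : ℂ}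
    (hx : ∀ k ∈ Finset.Icc 1 N, qnum η (x + k) ≠ 0) :
    toFront (dynamicalR η) p L lam * (traceMatrix η L lam x : Matrix (Level n N) (Level n N) ℂ) =
      traceMatrix η (frontAt p L) lam x * toFront (quantumR η) p L 0 := by
  induction p generalizing L with
  | zero => rw [toFront, toFront, one_mul, mul_one, frontAt]
  | succ p ih =>
    rw [toFront, toFront, mul_assoc, braid_mul_traceMatrix hη hL p h.1 hx, ← mul_assoc,
      ih ((sum_swapAt L p).trans hL) h.2, mul_assoc, frontAt]

theorem fromBack_mul_traceMatrix {η : ℂ} (hη : 0 < η.im) {n N : ℕ} {L : Fin n → ℂ}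
    (hL : ∑ i, L i = 2 * (N : ℂ)) (d p : ℕ) {lam : ℂ} (h : BackGeneric η N d p L lam) {x : ℂ}
    (hx : ∀ k ∈ Finset.Icc 1 N, qnum η (x + k) ≠ 0) :
    fromBack (dynamicalR η) d p L lam *
        (traceMatrix η (backAt d p L) lam x : Matrix (Level n N) (Level n N) ℂ) =
      traceMatrix η L lam x * fromBack (quantumR η) d p L 0 := by
  induction d generalizing p L with
  | zero => rw [fromBack, fromBack, one_mul, mul_one, backAt]
  | succ d ih =>
    have hd := (Matrix.isUnit_iff_isUnit_det _).mp (isUnit_braid_dynamicalR hη h.1)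
    have hq := (Matrix.isUnit_iff_isUnit_det _).mp
      (isUnit_braid_quantumR η L p 0 : IsUnit (braid (quantumR η) L p 0 : Matrix (Level n N) _ ℂ))
    -- The exchange relation multiplied by the inverses of the two R-matrices.
    have key : (braid (dynamicalR η) L p lam)⁻¹ * traceMatrix η (swapAt L p) lam x =
        (traceMatrix η L lam x : Matrix (Level n N) (Level n N) ℂ) * (braid (quantumR η) L p 0)⁻¹ := by
      rw [← Matrix.mul_nonsing_inv_cancel_right _ (traceMatrix η (swapAt L p) lam x) hq,
        ← braid_mul_traceMatrix hη hL p h.1 hx, mul_assoc, Matrix.nonsing_inv_mul_cancel_left _ _ hd]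
    rw [fromBack, fromBack, mul_assoc, backAt, ih ((sum_swapAt L p).trans hL) _ h.2, ← mul_assoc, key,
      mul_assoc]

/-- At a given λ only finitely many shifted values are evaluated, so the exchange relations before
the cyclic shift need genericity at those points only. -/
theorem cyclicShift_congr {n N : ℕ} [NeZero n] (Λ lam : ℂ) {ψ ψ' : ℂ → Level n N → ℂ}
    (h : ∀ a : Level n N, ψ (lam - Λ + 2 * a.1 0) = ψ' (lam - Λ + 2 * a.1 0)) :
    cyclicShift Λ ψ lam = cyclicShift Λ ψ' lam := by
  funext b
  exact Finset.sum_congr rfl fun a _ => by rw [h a]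

/-- The universal trace matrix intertwines the qKZ and the qKZB operators. -/
theorem qKZB_traceMatrix {η : ℂ} (hη : 0 < η.im) {n N : ℕ} [NeZero n] {L : Fin n → ℂ}
    (hL : ∑ i, L i = 2 * (N : ℂ)) {lam : ℂ} (j : Fin n)
    (hb : BackGeneric η N (n - 1 - j) j L lam)
    (hf : ∀ a : Level n N, FrontGeneric η N j L (lam - L j + 2 * a.1 0)) {x : ℂ}
    (hx : ∀ k ∈ Finset.Icc 1 N, qnum η (x + k) ≠ 0) (φ : Level n N → ℂ) :
    qKZB η L j (fun mu => (traceMatrix η L mu x).mulVec φ) lam =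
      (traceMatrix η L lam x).mulVec ((qKZ η L j x).mulVec φ) := by
  have hF := (sum_frontAt j L).trans hL
  have h₁ : cyclicShift (L j) (fun mu => (toFront (dynamicalR η) j L mu).mulVec
      ((traceMatrix η L mu x).mulVec φ)) lam =
      (traceMatrix η (backAt (n - 1 - j) j L) lam x).mulVec
        ((cyclicQ η (L j) x).mulVec ((toFront (quantumR η) j L 0).mulVec φ)) := by
    -- The interchanges that bring the factor to the front are commuted past the trace matrix at
    -- each shifted parameter, so that cyclicity applies to the rearranged weights.
    rw [cyclicShift_congr (ψ' := fun mu => (traceMatrix η (frontAt j L) mu x).mulVec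
      ((toFront (quantumR η) j L 0).mulVec φ)), ← frontAt_zero j L, cyclicShift_traceMatrix hη hF _ hx,
      frontAt_comp_finRotate]
    intro a
    rw [Matrix.mulVec_mulVec, Matrix.mulVec_mulVec, toFront_mul_traceMatrix hη hL j (hf a) hx]
  rw [qKZB, h₁, Matrix.mulVec_mulVec, fromBack_mul_traceMatrix hη hL _ _ hb hx, qKZ]
  simp only [Matrix.mulVec_mulVec, mul_assoc]

end

end QKZB

/-! ### The intertwining theorem for the qKZ and qKZB operators -/

theorem theorem6p1 (η : ℂ) (hη : 0 < η.im) :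
    QKZB.IsDynamicalRMatrix η (QKZB.dynamicalR η) ∧
    ∀ (n N : ℕ) [NeZero n] (Λ : Fin n → ℂ), ∑ i, Λ i = 2 * (N : ℂ) →
      (∀ (lam : ℂ) (m m' : QKZB.Level n N),
        QKZB.IsTraceFunction η Λ lam m m' (QKZB.traceFun η Λ lam m m') ∧
        ∀ x : ℂ, (∀ k ∈ Finset.Icc 1 N, QKZB.qnum η (x + k) ≠ 0) →
          AnalyticAt ℂ (QKZB.traceFun η Λ lam m m') x) ∧
      (∀ p : ℕ,
        IsUnit (QKZB.braid (QKZB.quantumR η) Λ p 0 :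
          Matrix (QKZB.Level n N) (QKZB.Level n N) ℂ) ∧
        ∀ᶠ lam in codiscrete ℂ,
          IsUnit (QKZB.braid (QKZB.dynamicalR η) Λ p lam :
            Matrix (QKZB.Level n N) (QKZB.Level n N) ℂ)) ∧
      ∀ᶠ lam in codiscrete ℂ, ∀ x : ℂ, (∀ k ∈ Finset.Icc 1 N, QKZB.qnum η (x + k) ≠ 0) →
        ∀ (j : Fin n) (φ : QKZB.Level n N → ℂ),
          QKZB.qKZB η Λ j (fun mu => (QKZB.traceMatrix η Λ mu x).mulVec φ) lam =
            (QKZB.traceMatrix η Λ lam x).mulVec ((QKZB.qKZ η Λ j x).mulVec φ) := by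
  refine ⟨QKZB.isDynamicalRMatrix_dynamicalR hη, fun n N _ Λ hΛ => ⟨fun lam m m' =>
    ⟨QKZB.isTraceFunction_traceFun hη hΛ lam m m', fun x hx =>
      QKZB.analyticAt_traceFun hη hΛ lam m m' hx⟩, fun p => ⟨QKZB.isUnit_braid_quantumR η Λ p 0, ?_⟩,
    ?_⟩⟩
  · filter_upwards [QKZB.eventually_braidGeneric hη N Λ p 0] with lam h
    rw [add_zero] at h
    exact QKZB.isUnit_braid_dynamicalR hη h
  · have hb := eventually_all.mpr fun j : Fin n =>
      QKZB.eventually_backGeneric hη N (n - 1 - j) j Λ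
    -- The interchanges before the cyclic shift are evaluated at λ - Λ_j + 2a₀. Finitely many j and
    -- multi-indices a occur and x does not, so one codiscrete set of λ serves for all x.
    have hf := eventually_all.mpr fun j : Fin n => eventually_all.mpr fun a : QKZB.Level n N =>
      QKZB.eventually_frontGeneric hη N j Λ (-Λ j + 2 * a.1 0)
    filter_upwards [hb, hf] with lam hb hf x hx j φ
    refine QKZB.qKZB_traceMatrix hη hΛ j (hb j) (fun a => ?_) hx φ
    simpa only [sub_eq_add_neg, add_assoc] using hf j a
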